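/- Let $\gamma:[0,\infty)\to[\varepsilon,1-\varepsilon]$ (for some $\varepsilon>0$) be Lipschitz-continuous and strictly increasing. Let $N(ds,dz)$ be a Poisson random measure on $[0,\infty)\times[0,\infty)$ with intensity measure $ds\,dz$, defined on a probability space, and let $\mathcal F_t=\sigma(N(A):A\subset[0,t]\times[0,\infty)\text{ Borel})$. Let $M=(M_t)_{t\ge 0}$ be a càdlàg $[0,\infty)$-valued process, adapted to $(\mathcal F_t)_{t\ge 0}$ (up to null sets), such that almost surely, for all $t\ge 0$, $$M_t=\int_{(0,t]}\int_0^\infty (1+z)^{-1/\gamma(M_{s-})}\,N(ds,dz).$$ (Thus $M$ is the increasing Markov process started from $0$ with generator $\mathcal L\phi(y)=\int_0^1[\phi(y+u)-\phi(y)]\,\gamma(y)u^{-1-\gamma(y)}\,du$.) Fix $t_0\ge 0$. Then, conditionally on $\mathcal F_{t_0}$, the processes $$X^\alpha=\Big(\frac{M_{t_0+\alpha t}-M_{t_0}}{\alpha^{1/\gamma(M_{t_0})}}\Big)_{t\in[0,1]}$$ converge in law, as $\alpha\to0^+$, to the stable Lévy subordinator (without drift, started from $0$) with Lévy measure $\gamma(M_{t_0})u^{-1-\gamma(M_{t_0})}\,du$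 on $(0,\infty)$, where the space $D$ of càdlàg functions $[0,1]\to\mathbb R$ carries the topology of uniform convergence. Precisely: the path $(M_{t_0+s})_{s\ge0}$ has a regular conditional law given $\mathcal F_{t_0}$, and for every version of it, for almost every $\omega$, the law $Q^\alpha_\omega$ of $X^\alpha$ under the conditional law at $\omega$ satisfies $\int f\,dQ^\alpha_\omega\to\int f\,d\mu_\omega$ as $\alpha\to0^+$ for every bounded $f:D\to\mathbb R$ that is continuous for uniform convergence and measurable for the $\sigma$-algebra generated by the evaluations $x\mapsto x(t)$. Here $\mu_\omega$ is the law on $D$ of the stable Lévy subordinator with Lévy measure $\gamma(M_{t_0}(\omega))u^{-1-\gamma(M_{t_0}(\omega))}\,du$ on $(0,\infty)$. -/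

import Mathlib

open MeasureTheory ProbabilityTheory Set Filter Topology
open scoped NNReal ENNReal unitInterval

noncomputable section

/-! ### Càdlàg paths -/

/-- `x` is càdlàg: right-continuous with left limits. (At a minimum of `T` the punctured left
neighbourhood is empty, and at a maximum right-continuity says nothing.) -/
def IsCadlag {T E : Type*} [TopologicalSpace T] [Preorder T] [TopologicalSpace E]
    (x : T → E) : Prop :=
  ∀ t, ContinuousWithinAt x (Ici t) t ∧ ∃ l, Tendsto x (𝓝[<] t) (𝓝 l)

/-- The space of càdlàg functions `T → E`. -/
def CadlagPath (T E : Type*) [TopologicalSpace T] [Preorder T] [TopologicalSpace E] : Type _ :=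
  {x : T → E // IsCadlag x}

instance CadlagPath.instCoeFun {T E : Type*} [TopologicalSpace T] [Preorder T]
    [TopologicalSpace E] : CoeFun (CadlagPath T E) (fun _ => T → E) :=
  ⟨fun x => x.1⟩

/-- The σ-algebra generated by the evaluations `x ↦ x t`. -/
instance CadlagPath.instMeasurableSpace {T E : Type*} [TopologicalSpace T] [Preorder T]
    [TopologicalSpace E] [MeasurableSpace E] : MeasurableSpace (CadlagPath T E) :=
  MeasurableSpace.comap (fun x : CadlagPath T E => (x : T → E)) MeasurableSpace.pi

/-- The topology of uniform convergence on the space of càdlàg functions. -/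
instance CadlagPath.instTopologicalSpace {T E : Type*} [TopologicalSpace T] [Preorder T]
    [UniformSpace E] : TopologicalSpace (CadlagPath T E) :=
  TopologicalSpace.induced (fun x : CadlagPath T E => UniformFun.ofFun (x : T → E)) inferInstance

/-- A time change `φ` that is increasing and continuous, and either strictly increasing or
constant, preserves the càdlàg property. -/
theorem IsCadlag.comp_time {S T E : Type*} [TopologicalSpace S] [PartialOrder S]
    [TopologicalSpace T]
    [Preorder T] [TopologicalSpace E] {x : T → E} (hx : IsCadlag x) {φ : S → T}
    (hc : Continuous φ) (hφ : StrictMono φ ∨ ∃ c, ∀ s, φ s = c) : IsCadlag (fun s => x (φ s)) := by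
  rcases hφ with hφ | ⟨c, h⟩
  · intro s
    refine ⟨(hx (φ s)).1.comp hc.continuousWithinAt (fun u hu => hφ.monotone hu), ?_⟩
    obtain ⟨l, hl⟩ := (hx (φ s)).2
    exact ⟨l, hl.comp (tendsto_nhdsWithin_of_tendsto_nhds_of_eventually_within _
      (hc.continuousAt.tendsto.mono_left nhdsWithin_le_nhds)
      (eventually_mem_nhdsWithin.mono fun u hu => hφ hu))⟩
  · intro s
    simp only [h]
    exact ⟨continuousWithinAt_const, _, tendsto_const_nhds⟩

/-- Post-composition with a continuous map preserves the càdlàg property. -/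
theorem IsCadlag.continuous_comp {T E F : Type*} [TopologicalSpace T] [Preorder T]
    [TopologicalSpace E] [TopologicalSpace F] {x : T → E} (hx : IsCadlag x) {g : E → F}
    (hg : Continuous g) : IsCadlag (fun t => g (x t)) := fun t =>
  ⟨hg.continuousAt.comp_continuousWithinAt (hx t).1, by
    obtain ⟨l, hl⟩ := (hx t).2
    exact ⟨g l, (hg.tendsto l).comp hl⟩⟩

/-- The path after time `t₀`: `s ↦ x (t₀ + s)`. -/
def CadlagPath.shift {E : Type*} [TopologicalSpace E] (t₀ : ℝ≥0) (x : CadlagPath ℝ≥0 E) :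
    CadlagPath ℝ≥0 E :=
  ⟨fun s => x (t₀ + s), x.2.comp_time (by fun_prop)
    (Or.inl fun _ _ h => (add_lt_add_iff_left t₀).2 h)⟩

/-- The rescaled path `t ↦ (x (α t) - x 0) / α ^ (1 / γ (x 0))`, `t ∈ [0,1]`. -/
def CadlagPath.rescale (γ : ℝ≥0 → ℝ) (α : ℝ≥0) (x : CadlagPath ℝ≥0 ℝ≥0) : CadlagPath I ℝ :=
  ⟨fun t => ((x (α * unitInterval.toNNReal t) : ℝ) - x 0) / (α : ℝ) ^ (1 / γ (x 0)), by
    have h : IsCadlag (fun t : I => x (α * unitInterval.toNNReal t)) := by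
      refine x.2.comp_time (φ := fun t : I => α * unitInterval.toNNReal t) (by fun_prop) ?_
      rcases eq_or_ne α 0 with rfl | hα
      · exact Or.inr ⟨0, fun s => zero_mul _⟩
      · exact Or.inl fun s t hst => (mul_lt_mul_iff_right₀ (pos_iff_ne_zero.2 hα)).2 hst
    exact h.continuous_comp (g := fun y : ℝ≥0 => ((y : ℝ) - x 0) / (α : ℝ) ^ (1 / γ (x 0)))
      (by fun_prop)⟩

/-! ### Poisson random measures -/

/-- Lebesgue measure on `[0,∞)`. -/
def nnrealLebesgue : Measure ℝ≥0 := Measure.comap ((↑) : ℝ≥0 → ℝ) volume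

/-- `N` is a Poisson random measure with intensity `Λ`. -/
structure IsPoissonRandomMeasure {Ω S : Type*} [MeasurableSpace Ω] [MeasurableSpace S]
    (N : Ω → Measure S) (Λ : Measure S) (P : Measure Ω) : Prop where
  measurable : ∀ A, MeasurableSet A → Measurable fun ω => N ω A
  law : ∀ A, MeasurableSet A → Λ A ≠ ∞ →
    P.map (fun ω => N ω A) = (poissonMeasure (Λ A).toNNReal).map (fun n : ℕ => (n : ℝ≥0∞))
  indep : ∀ (n : ℕ) (A : Fin n → Set S), (∀ i, MeasurableSet (A i)) →
    Pairwise (fun i j => Disjoint (A i) (A j)) → iIndepFun (fun i ω => N ω (A i)) P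

/-- `F_t = σ(N(A) : A ⊆ [0,t] × [0,∞) Borel)`. -/
abbrev poissonFiltration {Ω : Type*} (N : Ω → Measure (ℝ≥0 × ℝ≥0)) (t : ℝ≥0) : MeasurableSpace Ω :=
  ⨆ A : {A : Set (ℝ≥0 × ℝ≥0) // MeasurableSet A ∧ A ⊆ Iic t ×ˢ univ},
    MeasurableSpace.comap (fun ω => N ω A.1) inferInstance

/-! ### The jump process -/

/-- `G(β,z) = (1+z)^{-1/β}`. -/
def jumpSize (β : ℝ) (z : ℝ≥0) : ℝ≥0 := (1 + z) ^ (-1 / β)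

/-- `M` is a càdlàg process, adapted to the (completed) filtration of `N`, that solves
`M_t = ∫_{(0,t]} ∫_0^∞ G(γ(M_{s-}), z) N(ds,dz)` for all `t ≥ 0`, almost surely. -/
structure IsJumpSolution {Ω : Type*} [MeasurableSpace Ω] (γ : ℝ≥0 → ℝ)
    (N : Ω → Measure (ℝ≥0 × ℝ≥0)) (P : Measure Ω) (M : Ω → CadlagPath ℝ≥0 ℝ≥0) : Prop where
  measurable : Measurable M
  adapted : ∀ t, AEStronglyMeasurable[poissonFiltration N t] (fun ω => M ω t) P
  eq : ∀ᵐ ω ∂P, ∀ t : ℝ≥0, (M ω t : ℝ≥0∞) =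
    ∫⁻ p in Ioc 0 t ×ˢ univ, (jumpSize (γ (Function.leftLim (M ω) p.1)) p.2 : ℝ≥0∞) ∂(N ω)

/-! ### Subordinators -/

/-- `X`, indexed by `[0,1]`, is a driftless subordinator with Lévy measure `ν`: it starts at `0`,
is nondecreasing, has independent increments, and its increments have the Laplace transform
`E exp(-r (X_t - X_s)) = exp(-(t-s) ∫ (1 - e^{-ru}) ν(du))`. -/
structure IsSubordinator {Ω : Type*} [MeasurableSpace Ω] (ν : Measure ℝ) (X : I → Ω → ℝ)
    (P : Measure Ω) : Prop where
  levy_pos : ν (Iic 0) = 0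
  levy_fin : ∫⁻ u, ENNReal.ofReal (min 1 u) ∂ν < ∞
  zero : ∀ᵐ ω ∂P, X 0 ω = 0
  mono : ∀ᵐ ω ∂P, Monotone fun t => X t ω
  indep : HasIndepIncrements X P
  laplace : ∀ s t : I, s ≤ t → ∀ r : ℝ, 0 ≤ r →
    ∫ ω, Real.exp (-r * (X t ω - X s ω)) ∂P =
      Real.exp (-((t : ℝ) - s) * ∫ u, (1 - Real.exp (-r * u)) ∂ν)

/-- The measure `β u^{-1-β} du` on `(0,∞)`. -/
def stableLevyMeasure (β : ℝ) : Measure ℝ :=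
  (volume.restrict (Ioi 0)).withDensity fun u => ENNReal.ofReal (β * u ^ (-1 - β))

/-- `μ` is the law on the càdlàg space of a càdlàg subordinator with Lévy measure `ν`. -/
def IsSubordinatorLaw (ν : Measure ℝ) (μ : Measure (CadlagPath I ℝ)) : Prop :=
  IsProbabilityMeasure μ ∧ IsSubordinator ν (fun t (x : CadlagPath I ℝ) => x t) μ

/-! ### Conditional laws and convergence in law -/

/-- `κ` is a regular conditional law of the random element `Y` given the sub-σ-algebra `F`. -/
def IsRegularCondLaw {Ω E : Type*} {mΩ : MeasurableSpace Ω} [MeasurableSpace E] (P : Measure Ω)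
    (F : MeasurableSpace Ω) (Y : Ω → E) (κ : @Kernel Ω E F _) : Prop :=
  (∀ ω, IsProbabilityMeasure (κ ω)) ∧
  ∀ A, MeasurableSet[F] A → ∀ B, MeasurableSet B → P (A ∩ Y ⁻¹' B) = ∫⁻ ω in A, κ ω B ∂P

/-- Convergence in law of probability measures on a space with a topology and a σ-algebra that
may be smaller than the Borel one: `∫ f dμ_i → ∫ f dμ` for all bounded continuous measurable `f`. -/
def TendstoInLaw {ι E : Type*} [TopologicalSpace E] [MeasurableSpace E] (μs : ι → Measure E)
    (l : Filter ι) (μ : Measure E) : Prop :=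
  ∀ f : E → ℝ, Continuous f → Measurable f → (∃ C, ∀ x, |f x| ≤ C) →
    Tendsto (fun i => ∫ x, f x ∂(μs i)) l (𝓝 (∫ x, f x ∂μ))

end

/-! Put `β = γ (M t₀)` and freeze the exponent: let `Y` be the sum of the jumps `z ^ (-1/β)` over
the points of `N` with time in `(t₀, t₀ + t]`. For fixed `β` this is a stable subordinator, and its
self-similarity makes the law of `Y (α t) / α ^ (1/β)` on `[0,1]` the same for all `α > 0`. So it
suffices that `M (t₀ + ·) - M t₀` and `Y` differ by `o(d ^ (1/β))`, uniformly on `[0, d]`, along `d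
= 2⁻ⁿ`.

This holds almost surely and path by path. For small `d` no point of the window has `z < 1`, and the
sum of `z ^ (-r)` over the window is at most `d ^ q` whenever `q < r` and `1 < r`
(`ae_eventually_lintegral_rpow_le`, by Borel–Cantelli). Replacing `1 + z` by `z` costs about `z ^
(-(r+1))` per jump, where `r < 1/β` is close to `1/β`, hence `d ^ q'` in total with some `q' > 1/β`.
Freezing the exponent costs `z ^ (-r)` per jump times the variation of `1/γ` along the path; by the
Lipschitz bound the latter is of the order of the increment of `M`, at most `d ^ q`, so the total is
of order `d ^ (2q)` with `2q > 1/β` (`abs_jump_sub_le`, `eventually_abs_sub_stable_le`).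

The points after `t₀` are independent of `F_{t₀}`, and `β` is `F_{t₀}`-measurable up to null sets.
Conditionally on `F_{t₀}`, the rescaled `Y` therefore has exactly the stable law of index `β`, and
the closeness survives under almost every conditional law (`ae_tendstoInLaw_rescale`).

The uniform topology is not separable and a test function need not be uniformly continuous, so
uniform closeness does not give convergence in law at once. Since the law `μ` of the approximating
path is the same for all `α`, one can condition on that path being `y`: the conditional mean of the
truncated distance tends to zero in `L¹(μ)`, hence along a subsequence for almost every `y`, and
continuity of the test function at `y` alone is enough (`tendstoInLaw_of_coupling`).

Conditional laws come from coding monotone càdlàg paths by their values at the nonnegative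
rationals, a standard Borel space. -/

/-! ### Independence properties of Poisson random measures -/

/-- Families of independent random variables, grouped by rows, are independent. -/
theorem iIndepFun_curry {Ω ι κ X : Type*} [MeasurableSpace Ω] [MeasurableSpace X] {P : Measure Ω}
    [IsProbabilityMeasure P] {Y : ι × κ → Ω → X} (hY : ∀ p, Measurable (Y p)) (h : iIndepFun Y P) :
    iIndepFun (fun i ω j => Y (i, j) ω) P := by
  have hp : ∀ i j, IsProbabilityMeasure (P.map (Y (i, j))) := fun i j =>
    Measure.isProbabilityMeasure_map (hY _).aemeasurable
  have hrow : ∀ i, P.map (fun ω j => Y (i, j) ω) =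
      Measure.infinitePi fun j => P.map (Y (i, j)) := fun i =>
    (h.precomp (g := fun j => (i, j)) fun _ _ h => by simpa using h).map_fun_eq_infinitePi_map
      (fun _ => hY _)
  rw [iIndepFun_iff_map_fun_eq_infinitePi_map (by fun_prop)]
  simp_rw [hrow]
  rw [← Measure.infinitePi_map_curry (fun i j => P.map (Y (i, j))),
    ← h.map_fun_eq_infinitePi_map hY, Measure.map_map (by fun_prop) (by fun_prop)]
  rfl

/-- The σ-algebra generated by the restriction of a random measure to `D`. -/
abbrev restrictionSigma {Ω S : Type*} [MeasurableSpace S] (N : Ω → Measure S) (D : Set S) :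
    MeasurableSpace Ω :=
  ⨆ A : {A : Set S // MeasurableSet A ∧ A ⊆ D},
    MeasurableSpace.comap (fun ω => N ω A.1) inferInstance

section
variable {Ω S : Type*} [MeasurableSpace S] {N : Ω → Measure S}

theorem restrictionSigma_le [mΩ : MeasurableSpace Ω]
    (hN : ∀ A, MeasurableSet A → Measurable fun ω => N ω A) (D : Set S) :
    restrictionSigma N D ≤ mΩ :=
  iSup_le fun A => (hN A.1 A.2.1).comap_le

theorem measurable_restrictionSigma {D A : Set S} (hA : MeasurableSet A) (hAD : A ⊆ D) :
    Measurable[restrictionSigma N D] fun ω => N ω A :=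
  measurable_iff_comap_le.2
    (le_iSup (fun A : {A : Set S // MeasurableSet A ∧ A ⊆ D} =>
      MeasurableSpace.comap (fun ω => N ω A.1) inferInstance) ⟨A, hA, hAD⟩)

/-- The σ-algebra generated by the masses of the cells of a countable partition. -/
abbrev partitionSigma (N : Ω → Measure S) (D : Set S) (c : S → ℕ) : MeasurableSpace Ω :=
  MeasurableSpace.comap (fun ω (j : ℕ) => N ω (c ⁻¹' {j} ∩ D)) MeasurableSpace.pi

theorem measurable_partitionSigma (D : Set S) (c : S → ℕ) (j : ℕ) :
    Measurable[partitionSigma N D c] fun ω => N ω (c ⁻¹' {j} ∩ D) :=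
  (measurable_pi_apply j).comp (comap_measurable fun ω (j : ℕ) => N ω (c ⁻¹' {j} ∩ D))

/-- Each cell of `c` is a countable disjoint union of cells of the finer `e`. With `e` a pairing of
two partitions, this gives a common refinement, so that the events seen by some countable partition
form a π-system. -/
theorem partitionSigma_le_pair {D : Set S} (hD : MeasurableSet D) {c e : S → ℕ}
    (he : Measurable e) (f : ℕ → ℕ) (hf : ∀ x, c x = f (e x)) :
    partitionSigma N D c ≤ partitionSigma N D e := by
  refine measurable_iff_comap_le.1 (@measurable_pi_lambda _ _ _ (partitionSigma N D e) _ _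
    fun j => ?_)
  have h : (fun ω => N ω (c ⁻¹' {j} ∩ D)) =
      fun ω => ∑' k, (f ⁻¹' {j}).indicator (fun k => N ω (e ⁻¹' {k} ∩ D)) k := by
    ext ω
    have hU : c ⁻¹' {j} ∩ D = ⋃ k : f ⁻¹' {j}, e ⁻¹' {(k : ℕ)} ∩ D := by
      ext x; simp [hf]
    rw [hU, measure_iUnion, ← tsum_subtype]
    · intro a b hab
      refine Set.disjoint_left.2 fun x hx hx' => hab (Subtype.ext ?_)
      exact hx.1.symm.trans hx'.1
    · exact fun k => (he (measurableSet_singleton _)).inter hD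
  rw [h]
  let := partitionSigma N D e
  refine Measurable.tsum fun k => ?_
  by_cases hk : k ∈ f ⁻¹' {j}
  · simpa [hk] using measurable_partitionSigma D e k
  · simp [hk]

variable [MeasurableSpace Ω] {Λ : Measure S} {P : Measure Ω}

theorem IsPoissonRandomMeasure.iIndepFun_countable [IsProbabilityMeasure P]
    (hN : IsPoissonRandomMeasure N Λ P) {ι : Type*} (A : ι → Set S) (hA : ∀ i, MeasurableSet (A i))
    (hd : Pairwise fun i j => Disjoint (A i) (A j)) : iIndepFun (fun i ω => N ω (A i)) P := by
  rw [iIndepFun_iff_finset]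
  intro s
  have h := hN.indep s.card (fun k => A (s.equivFin.symm k)) (fun _ => hA _) fun i j hij =>
    hd fun h => hij (s.equivFin.symm.injective (Subtype.ext h))
  convert h.precomp s.equivFin.injective using 2 with i
  simp

/-- The restrictions of a Poisson random measure to disjoint sets are independent. -/
theorem IsPoissonRandomMeasure.iIndep_restrictionSigma [IsProbabilityMeasure P]
    (hN : IsPoissonRandomMeasure N Λ P) {ι : Type*} {D : ι → Set S}
    (hD : ∀ i, MeasurableSet (D i)) (hd : Pairwise fun i j => Disjoint (D i) (D j)) :
    iIndep (fun i => restrictionSigma N (D i)) P := by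
  classical
  have hle : ∀ i c, Measurable c → partitionSigma N (D i) c ≤ restrictionSigma N (D i) := by
    intro i c hc
    refine measurable_iff_comap_le.1 (@measurable_pi_lambda _ _ _ (restrictionSigma N (D i)) _ _
      fun j => ?_)
    exact measurable_restrictionSigma ((hc (measurableSet_singleton _)).inter (hD i))
      inter_subset_right
  refine iIndepSets.iIndep (fun i => restrictionSigma_le hN.measurable _)
    (fun i => {E | ∃ c : S → ℕ, Measurable c ∧ MeasurableSet[partitionSigma N (D i) c] E}) ?_ ?_ ?_
  · rintro i E ⟨c, hc, hE⟩ F ⟨d, hd, hF⟩ -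
    have hp : Measurable fun x => Nat.pair (c x) (d x) :=
      (Measurable.of_discrete (f := fun p : ℕ × ℕ => Nat.pair p.1 p.2)).comp (hc.prodMk hd)
    exact ⟨_, hp, MeasurableSet.inter
      (partitionSigma_le_pair (hD i) hp (fun n => n.unpair.1) (by simp) _ hE)
      (partitionSigma_le_pair (hD i) hp (fun n => n.unpair.2) (by simp) _ hF)⟩
  · intro i
    apply le_antisymm
    · refine iSup_le fun A => ?_
      -- The mass of `A` is the mass of cell `1` in the partition into `A` and its complement.
      have hc : Measurable (A.1.indicator fun _ => (1 : ℕ)) := measurable_one.indicator A.2.1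
      rintro E ⟨B, hB, rfl⟩
      refine MeasurableSpace.measurableSet_generateFrom ⟨_, hc, ?_⟩
      have := measurable_partitionSigma (N := N) (D i) (A.1.indicator fun _ => (1 : ℕ)) 1 hB
      have h1 : (A.1.indicator fun _ => (1 : ℕ)) ⁻¹' {1} ∩ D i = A.1 := by
        ext x
        by_cases hx : x ∈ A.1
        · simp [hx, A.2.2 hx]
        · simp [hx]
      rwa [h1] at this
    · refine MeasurableSpace.generateFrom_le ?_
      rintro E ⟨c, hc, hE⟩
      exact hle i c hc _ hE
  · rw [iIndepSets_iff]
    intro s E hE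
    choose! c hc using hE
    -- Off `s` the chosen `c i` is arbitrary; the one-cell partition replaces it, so that every row
    -- consists of measurable sets.
    set c' : ι → S → ℕ := fun i => if i ∈ s then c i else 0 with hc'
    have hcm : ∀ i, Measurable (c' i) := by
      intro i
      by_cases hi : i ∈ s
      · simpa [hc', hi] using (hc i hi).1
      · simpa [hc', hi] using measurable_zero
    -- All cells of all rows are pairwise disjoint, so their masses are jointly independent, and
    -- grouping them by rows keeps independence.
    have hrow := iIndepFun_curry (Y := fun (p : ι × ℕ) ω => N ω (c' p.1 ⁻¹' {p.2} ∩ D p.1))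
      (fun p => hN.measurable _ ((hcm _ (measurableSet_singleton _)).inter (hD _)))
      (hN.iIndepFun_countable (fun p : ι × ℕ => c' p.1 ⁻¹' {p.2} ∩ D p.1)
        (fun p => (hcm _ (measurableSet_singleton _)).inter (hD _)) (by
          rintro ⟨i, j⟩ ⟨i', j'⟩ hne
          by_cases hi : i = i'
          · subst hi
            refine Set.disjoint_left.2 fun x hx hx' => hne ?_
            have : j = j' := hx.1.symm.trans hx'.1
            rw [this]
          · exact (hd hi).mono inter_subset_right inter_subset_right))
    refine hrow.iIndep.meas_biInter (S := s) (s := E) fun i hi => ?_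
    have := (hc i hi).2
    have hi' : c' i = c i := if_pos hi
    rw [← hi'] at this
    exact this

end

/-! ### First moments and Laplace functionals of Poisson random measures -/

theorem lintegral_natCast_poissonMeasure (r : ℝ≥0) :
    ∫⁻ n : ℕ, (n : ℝ≥0∞) ∂poissonMeasure r = r := by
  have h1 : ∑' n : ℕ, ENNReal.ofReal (Real.exp (-r) * r ^ n / n.factorial) = 1 := by
    rw [← ENNReal.ofReal_tsum_of_nonneg (fun n => by positivity)
      (hasSum_one_poissonMeasure r).summable, (hasSum_one_poissonMeasure r).tsum_eq,
      ENNReal.ofReal_one]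
  rw [poissonMeasure, lintegral_sum_measure]
  simp only [lintegral_smul_measure, lintegral_dirac, smul_eq_mul]
  rw [tsum_eq_zero_add' ENNReal.summable]
  simp only [Nat.cast_zero, mul_zero, zero_add]
  have h2 : ∀ n : ℕ, ENNReal.ofReal (Real.exp (-r) * r ^ (n + 1) / (n + 1).factorial) *
      ((n + 1 : ℕ) : ℝ≥0∞) = ENNReal.ofReal (Real.exp (-r) * r ^ n / n.factorial) * r := by
    intro n
    rw [← ENNReal.ofReal_natCast, ← ENNReal.ofReal_coe_nnreal, ← ENNReal.ofReal_mul (by positivity),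
      ← ENNReal.ofReal_mul (by positivity)]
    congr 1
    rw [Nat.factorial_succ]
    push_cast
    field_simp
    ring
  simp_rw [h2]
  rw [ENNReal.tsum_mul_right, h1, one_mul]

theorem integral_exp_neg_mul_poissonMeasure (r : ℝ≥0) (c : ℝ) :
    ∫ n : ℕ, Real.exp (-(c * n)) ∂poissonMeasure r = Real.exp (-(r * (1 - Real.exp (-c)))) := by
  rw [integral_poissonMeasure]
  have h : ∀ n : ℕ, (Real.exp (-r) * r ^ n / n.factorial) • Real.exp (-(c * n)) =
      Real.exp (-r) * ((r * Real.exp (-c)) ^ n / n.factorial) := by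
    intro n
    rw [mul_pow, ← Real.exp_nat_mul, smul_eq_mul]
    rw [show (n : ℝ) * -c = -(c * n) by ring]
    ring
  simp_rw [h]
  rw [tsum_mul_left]
  have := (NormedSpace.expSeries_div_hasSum_exp (r * Real.exp (-c) : ℝ)).tsum_eq
  rw [this, ← Real.exp_eq_exp_ℝ, ← Real.exp_add]
  congr 1
  ring

section
variable {Ω S : Type*} [MeasurableSpace Ω] [MeasurableSpace S] {N : Ω → Measure S}
  {Λ : Measure S} {P : Measure Ω}

theorem IsPoissonRandomMeasure.measurable_measure (hN : IsPoissonRandomMeasure N Λ P) :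
    Measurable N :=
  Measure.measurable_of_measurable_coe _ hN.measurable

theorem IsPoissonRandomMeasure.lintegral_apply (hN : IsPoissonRandomMeasure N Λ P)
    [SigmaFinite Λ] {A : Set S} (hA : MeasurableSet A) : ∫⁻ ω, N ω A ∂P = Λ A := by
  have hfin : ∀ B, MeasurableSet B → Λ B ≠ ∞ → ∫⁻ ω, N ω B ∂P = Λ B := by
    intro B hB hBf
    have h := lintegral_map (μ := P) measurable_id (hN.measurable B hB)
    simp only [id] at h
    rw [← h, hN.law B hB hBf, lintegral_map (f := fun x => x) measurable_id (Measurable.of_discrete)]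
    rw [lintegral_natCast_poissonMeasure, ENNReal.coe_toNNReal hBf]
  set s : ℕ → Set S := fun n => disjointed (spanningSets Λ) n ∩ A
  have hs : ∀ n, MeasurableSet (s n) := fun n =>
    (MeasurableSet.disjointed (measurableSet_spanningSets Λ) n).inter hA
  have hU : A = ⋃ n, s n := by
    rw [← iUnion_inter, iUnion_disjointed, iUnion_spanningSets, univ_inter]
  have hd : Pairwise (Function.onFun Disjoint s) := fun i j hij =>
    (disjoint_disjointed _ hij).mono inter_subset_left inter_subset_left
  have hf : ∀ n, Λ (s n) ≠ ∞ := fun n => ((measure_mono (inter_subset_left.trans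
    (disjointed_subset _ n))).trans_lt (measure_spanningSets_lt_top Λ n)).ne
  rw [hU, measure_iUnion hd hs]
  simp_rw [measure_iUnion hd hs]
  rw [lintegral_tsum fun n => (hN.measurable _ (hs n)).aemeasurable]
  exact tsum_congr fun n => hfin _ (hs n) (hf n)

/-- Campbell's formula. -/
theorem IsPoissonRandomMeasure.lintegral_lintegral (hN : IsPoissonRandomMeasure N Λ P)
    [SigmaFinite Λ] {f : S → ℝ≥0∞} (hf : Measurable f) :
    ∫⁻ ω, ∫⁻ x, f x ∂N ω ∂P = ∫⁻ x, f x ∂Λ := by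
  have h : P.bind N = Λ := by
    ext A hA
    rw [Measure.bind_apply hA hN.measurable_measure.aemeasurable, hN.lintegral_apply hA]
  rw [← Measure.lintegral_bind hN.measurable_measure.aemeasurable hf.aemeasurable, h]

theorem IsPoissonRandomMeasure.ae_lt_top (hN : IsPoissonRandomMeasure N Λ P) [SigmaFinite Λ]
    {A : Set S} (hA : MeasurableSet A) (hf : Λ A ≠ ∞) : ∀ᵐ ω ∂P, N ω A < ∞ :=
  MeasureTheory.ae_lt_top (hN.measurable A hA) (by rwa [hN.lintegral_apply hA])

theorem IsPoissonRandomMeasure.integral_exp_neg_mul [IsProbabilityMeasure P]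
    (hN : IsPoissonRandomMeasure N Λ P) {A : Set S} (hA : MeasurableSet A) (c : ℝ≥0∞)
    (hf : c ≠ 0 → Λ A ≠ ∞) :
    ∫ ω, Real.exp (-(c * N ω A).toReal) ∂P =
      Real.exp (-((1 - Real.exp (-c.toReal)) * (Λ A).toReal)) := by
  rcases eq_or_ne c 0 with rfl | hc
  · simp
  have h : ∫ ω, Real.exp (-(c * N ω A).toReal) ∂P =
      ∫ y, Real.exp (-(c * y).toReal) ∂(P.map fun ω => N ω A) := by
    rw [integral_map (hN.measurable A hA).aemeasurable]
    exact (Real.measurable_exp.comp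
      (measurable_id.const_mul c).ennreal_toReal.neg).aestronglyMeasurable
  rw [h, hN.law A hA (hf hc), integral_map (Measurable.of_discrete).aemeasurable]
  · simp only [ENNReal.toReal_mul, ENNReal.toReal_natCast]
    rw [integral_exp_neg_mul_poissonMeasure, ENNReal.coe_toNNReal_eq_toReal, mul_comm]
  · exact (Real.measurable_exp.comp
      (measurable_id.const_mul c).ennreal_toReal.neg).aestronglyMeasurable

/-- The integral of a simple function is a finite combination of independent Poisson variables, so
the Laplace transform factorizes. The fibre of the value `0` may have infinite mass, since it
contributes nothing. -/
theorem IsPoissonRandomMeasure.laplace_simpleFunc [IsProbabilityMeasure P] [SigmaFinite Λ]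
    (hN : IsPoissonRandomMeasure N Λ P) (g : SimpleFunc S ℝ≥0∞) (hg : ∀ x, g x ≠ ∞)
    (hfin : ∀ c, c ≠ 0 → Λ (g ⁻¹' {c}) ≠ ∞) :
    ∫ ω, Real.exp (-(∫⁻ x, g x ∂N ω).toReal) ∂P =
      Real.exp (-(∫⁻ x, ENNReal.ofReal (1 - Real.exp (-(g x).toReal)) ∂Λ).toReal) := by
  have hrange : ∀ c : g.range, (c : ℝ≥0∞) ≠ ∞ := by
    rintro ⟨c, hc⟩
    obtain ⟨x, rfl⟩ := SimpleFunc.mem_range.1 hc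
    exact hg x
  have hleft : ∀ᵐ ω ∂P, Real.exp (-(∫⁻ x, g x ∂N ω).toReal) =
      ∏ c : g.range, Real.exp (-((c : ℝ≥0∞) * N ω (g ⁻¹' {(c : ℝ≥0∞)})).toReal) := by
    have : ∀ᵐ ω ∂P, ∀ c : g.range, (c : ℝ≥0∞) ≠ 0 → N ω (g ⁻¹' {(c : ℝ≥0∞)}) < ∞ := by
      rw [ae_all_iff]
      intro c
      by_cases hc : (c : ℝ≥0∞) = 0
      · simp [hc]
      · filter_upwards [hN.ae_lt_top (g.measurableSet_fiber c) (hfin c hc)] with ω h _ using h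
    filter_upwards [this] with ω hω
    rw [SimpleFunc.lintegral_eq_lintegral, SimpleFunc.lintegral, ← Real.exp_sum,
      ← Finset.sum_coe_sort, ENNReal.toReal_sum, Finset.sum_neg_distrib]
    intro c _
    rcases eq_or_ne (c : ℝ≥0∞) 0 with hc | hc
    · simp [hc]
    · exact ENNReal.mul_ne_top (hrange c) (hω c hc).ne
  have hind : iIndepFun (fun (c : g.range) ω => N ω (g ⁻¹' {(c : ℝ≥0∞)})) P :=
    hN.iIndepFun_countable _ (fun c => g.measurableSet_fiber c) fun c d hcd =>
      Set.disjoint_left.2 fun x hx hx' => hcd (Subtype.ext (hx.symm.trans hx'))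
  have hm : ∀ c : g.range, Measurable fun y : ℝ≥0∞ => Real.exp (-((c : ℝ≥0∞) * y).toReal) :=
    fun c => Real.measurable_exp.comp (measurable_id.const_mul _).ennreal_toReal.neg
  have hprod := (hind.comp _ hm).integral_fun_prod_eq_prod_integral (fun c =>
    ((hm c).comp (hN.measurable _ (g.measurableSet_fiber c))).aestronglyMeasurable)
  simp only [Function.comp_apply] at hprod
  rw [integral_congr_ae hleft, hprod]
  have hright : ∫⁻ x, ENNReal.ofReal (1 - Real.exp (-(g x).toReal)) ∂Λ =
      ∑ c : g.range, ENNReal.ofReal (1 - Real.exp (-(c : ℝ≥0∞).toReal)) *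
        Λ (g ⁻¹' {(c : ℝ≥0∞)}) := by
    have := SimpleFunc.map_lintegral (fun y : ℝ≥0∞ => ENNReal.ofReal (1 - Real.exp (-y.toReal))) g
      (μ := Λ)
    rw [← SimpleFunc.lintegral_eq_lintegral] at this
    simp only [SimpleFunc.map_apply] at this
    rw [this, ← Finset.sum_coe_sort]
  rw [hright, ENNReal.toReal_sum, ← Finset.sum_neg_distrib, Real.exp_sum]
  · refine Finset.prod_congr rfl fun c _ => ?_
    rw [hN.integral_exp_neg_mul (g.measurableSet_fiber c) c (hfin c), ENNReal.toReal_mul,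
      ENNReal.toReal_ofReal]
    simp
  · intro c _
    rcases eq_or_ne (c : ℝ≥0∞) 0 with hc | hc
    · simp [hc]
    · exact ENNReal.mul_ne_top ENNReal.ofReal_ne_top (hfin c hc)

/-- The Laplace functional of a Poisson random measure. -/
theorem IsPoissonRandomMeasure.laplace [IsProbabilityMeasure P] [SigmaFinite Λ]
    (hN : IsPoissonRandomMeasure N Λ P) {f : S → ℝ≥0∞} (hf : Measurable f) (hf_top : ∀ x, f x ≠ ∞)
    (hint : ∀ᵐ ω ∂P, ∫⁻ x, f x ∂N ω ≠ ∞)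
    (hfin : ∫⁻ x, ENNReal.ofReal (1 - Real.exp (-(f x).toReal)) ∂Λ ≠ ∞) :
    ∫ ω, Real.exp (-(∫⁻ x, f x ∂N ω).toReal) ∂P =
      Real.exp (-(∫⁻ x, ENNReal.ofReal (1 - Real.exp (-(f x).toReal)) ∂Λ).toReal) := by
  -- Cutting off to `spanningSets Λ n` gives the fibres of nonzero values finite mass.
  set g : ℕ → SimpleFunc S ℝ≥0∞ := fun n => (SimpleFunc.eapprox f n).restrict (spanningSets Λ n)
  have hg : ∀ n x, g n x = (spanningSets Λ n).indicator (SimpleFunc.eapprox f n) x := fun n x => by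
    simp only [g]
    rw [SimpleFunc.restrict_apply _ (measurableSet_spanningSets Λ n)]
  have hmono : ∀ x, Monotone fun n => g n x := by
    intro x m n hmn
    simp only [hg]
    refine (indicator_le_indicator (SimpleFunc.monotone_eapprox f hmn x)).trans ?_
    exact indicator_le_indicator_of_subset (monotone_spanningSets Λ hmn) (fun _ => zero_le) x
  have htend : ∀ x, Tendsto (fun n => g n x) atTop (𝓝 (f x)) := by
    intro x
    have h1 : Tendsto (fun n => SimpleFunc.eapprox f n x) atTop (𝓝 (f x)) := by
      rw [← SimpleFunc.iSup_eapprox_apply hf x]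
      exact tendsto_atTop_iSup fun m n hmn => SimpleFunc.monotone_eapprox f hmn x
    refine h1.congr' ?_
    filter_upwards [eventually_ge_atTop (spanningSetsIndex Λ x)] with n hn
    rw [hg, indicator_of_mem (monotone_spanningSets Λ hn (mem_spanningSetsIndex Λ x))]
  have hgtop : ∀ n x, g n x ≠ ∞ := fun n x => by
    have : g n x ≤ f x := (hmono x).ge_of_tendsto (htend x) n
    exact (this.trans_lt (hf_top x).lt_top).ne
  have hgfin : ∀ n c, c ≠ 0 → Λ (g n ⁻¹' {c}) ≠ ∞ := by
    intro n c hc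
    refine ((measure_mono ?_).trans_lt (measure_spanningSets_lt_top Λ n)).ne
    intro x hx
    by_contra h
    refine hc ?_
    have h2 : g n x = c := hx
    rw [← h2, hg, indicator_of_notMem h]
  have hcont : ∀ y : ℝ≥0∞, y ≠ ∞ → ContinuousAt (fun y : ℝ≥0∞ => Real.exp (-y.toReal)) y :=
    fun y hy => Real.continuous_exp.continuousAt.comp (ENNReal.continuousAt_toReal hy).neg
  have hL : Tendsto (fun n => ∫ ω, Real.exp (-(∫⁻ x, g n x ∂N ω).toReal) ∂P) atTop
      (𝓝 (∫ ω, Real.exp (-(∫⁻ x, f x ∂N ω).toReal) ∂P)) := by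
    refine tendsto_integral_of_dominated_convergence (fun _ => 1) (fun n => ?_)
      (integrable_const _) (fun n => ae_of_all _ fun ω => ?_) ?_
    · exact (Real.measurable_exp.comp ((Measure.measurable_lintegral (g n).measurable).comp
        hN.measurable_measure).ennreal_toReal.neg).aestronglyMeasurable
    · rw [Real.norm_eq_abs, Real.abs_exp]
      exact Real.exp_le_one_iff.2 (neg_nonpos.2 ENNReal.toReal_nonneg)
    · filter_upwards [hint] with ω hω
      refine (hcont _ hω).tendsto.comp ?_
      exact lintegral_tendsto_of_tendsto_of_monotone (fun n => (g n).measurable.aemeasurable)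
        (ae_of_all _ hmono) (ae_of_all _ htend)
  have hR : Tendsto (fun n => Real.exp
      (-(∫⁻ x, ENNReal.ofReal (1 - Real.exp (-(g n x).toReal)) ∂Λ).toReal)) atTop
      (𝓝 (Real.exp (-(∫⁻ x, ENNReal.ofReal (1 - Real.exp (-(f x).toReal)) ∂Λ).toReal))) := by
    refine (hcont _ hfin).tendsto.comp ?_
    refine lintegral_tendsto_of_tendsto_of_monotone (fun n => ?_) (ae_of_all _ fun x m n hmn => ?_)
      (ae_of_all _ fun x => ?_)
    · exact (measurable_const.sub (Real.measurable_exp.comp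
        (g n).measurable.ennreal_toReal.neg)).ennreal_ofReal.aemeasurable
    · have := ENNReal.toReal_mono (hgtop n x) (hmono x hmn)
      dsimp only
      gcongr
    · exact (ENNReal.continuous_ofReal.tendsto _).comp
        (((hcont _ (hf_top x)).tendsto.comp (htend x)).const_sub 1)
  refine tendsto_nhds_unique hL (hR.congr fun n => ?_)
  exact (hN.laplace_simpleFunc (g n) (hgtop n) (hgfin n)).symm

end

/-! ### Measurability and coding of càdlàg paths -/

section
variable {T E Ω : Type*} [TopologicalSpace T] [Preorder T] [TopologicalSpace E]
  [MeasurableSpace E] [MeasurableSpace Ω]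

theorem CadlagPath.measurable_coe : Measurable fun x : CadlagPath T E => (x : T → E) :=
  comap_measurable _

theorem CadlagPath.measurable_eval (t : T) : Measurable fun x : CadlagPath T E => x t :=
  (measurable_pi_apply t).comp CadlagPath.measurable_coe

theorem CadlagPath.measurable_of_eval {X : Ω → CadlagPath T E}
    (h : ∀ t, Measurable fun ω => X ω t) : Measurable X := by
  rw [CadlagPath.instMeasurableSpace, measurable_comap_iff]
  exact measurable_pi_lambda _ h

end

theorem CadlagPath.measure_ext {T E : Type*} [TopologicalSpace T] [Preorder T]
    [TopologicalSpace E] [MeasurableSpace E] {μ ν : Measure (CadlagPath T E)} [IsFiniteMeasure μ]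
    [IsFiniteMeasure ν]
    (h : ∀ s : Finset T, μ.map (fun x (t : s) => x t) = ν.map fun x (t : s) => x t) : μ = ν := by
  have hcoe : μ.map (fun x : CadlagPath T E => (x : T → E)) =
      ν.map fun x : CadlagPath T E => (x : T → E) := by
    refine IsProjectiveLimit.unique (P := fun s : Finset T => μ.map fun x (t : s) => x t)
      (fun s => ?_) fun s => ?_
    · rw [Measure.map_map (by fun_prop) CadlagPath.measurable_coe]; rfl
    · rw [Measure.map_map (by fun_prop) CadlagPath.measurable_coe]; exact (h s).symm
  ext A hA
  obtain ⟨B, hB, rfl⟩ := hA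
  rw [← Measure.map_apply CadlagPath.measurable_coe hB, hcoe,
    Measure.map_apply CadlagPath.measurable_coe hB]

theorem exists_nnrat_btwn {s t : ℝ≥0} (h : s < t) : ∃ q : ℚ≥0, s < (q : ℝ≥0) ∧ (q : ℝ≥0) < t := by
  obtain ⟨q, h1, h2⟩ := exists_rat_btwn (NNReal.coe_lt_coe.2 h)
  have hq : (0 : ℚ) ≤ q := by exact_mod_cast s.2.trans h1.le
  lift q to ℚ≥0 using hq
  refine ⟨q, ?_, ?_⟩ <;> rw [← NNReal.coe_lt_coe] <;> simpa using ‹_›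

theorem nhdsGT_inf_range_nnrat_neBot (t : ℝ≥0) :
    (𝓝[>] t ⊓ 𝓟 (range fun q : ℚ≥0 => (q : ℝ≥0))).NeBot := by
  rw [inf_principal_neBot_iff]
  intro U hU
  obtain ⟨u, hu, hU⟩ := (mem_nhdsGT_iff_exists_Ioo_subset' (show t < t + 1 by simp)).1 hU
  obtain ⟨q, h1, h2⟩ := exists_nnrat_btwn hu
  exact ⟨q, hU ⟨h1, h2⟩, q, rfl⟩

theorem IsCadlag.tendsto_nnrat {E : Type*} [TopologicalSpace E] {x : ℝ≥0 → E} (hx : IsCadlag x)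
    (t : ℝ≥0) : Tendsto x (𝓝[>] t ⊓ 𝓟 (range fun q : ℚ≥0 => (q : ℝ≥0))) (𝓝 (x t)) :=
  (hx t).1.tendsto.mono_left (inf_le_left.trans (nhdsWithin_mono _ Ioi_subset_Ici_self))

theorem isCadlag_of_monotone {x : ℝ≥0 → ℝ≥0} (hx : Monotone x)
    (hr : ∀ t, ContinuousWithinAt x (Ici t) t) : IsCadlag x := fun t =>
  ⟨hr t, _, hx.tendsto_leftLim t⟩

/-- The right-continuous regularization of a function on the rationals. -/
noncomputable def rightReg (x : ℚ≥0 → ℝ≥0) (t : ℝ≥0) : ℝ≥0 :=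
  ⨅ q : {q : ℚ≥0 // t < (q : ℝ≥0)}, x q

instance (t : ℝ≥0) : Nonempty {q : ℚ≥0 // t < (q : ℝ≥0)} := by
  obtain ⟨q, h, -⟩ := exists_nnrat_btwn (show t < t + 1 by simp)
  exact ⟨q, h⟩

theorem rightReg_mono (x : ℚ≥0 → ℝ≥0) : Monotone (rightReg x) := by
  intro s t hst
  exact le_ciInf fun q => ciInf_le (OrderBot.bddBelow _)
    (⟨q.1, hst.trans_lt q.2⟩ : {q : ℚ≥0 // s < (q : ℝ≥0)})

theorem isCadlag_rightReg (x : ℚ≥0 → ℝ≥0) : IsCadlag (rightReg x) := by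
  refine isCadlag_of_monotone (rightReg_mono x) fun t => ?_
  refine tendsto_order.2 ⟨fun a ha => ?_, fun a ha => ?_⟩
  · filter_upwards [self_mem_nhdsWithin] with s hs using ha.trans_le (rightReg_mono x hs)
  · obtain ⟨q, hq⟩ := exists_lt_of_ciInf_lt ha
    filter_upwards [mem_nhdsWithin_of_mem_nhds (Iio_mem_nhds q.2)] with s hs
    exact (ciInf_le (OrderBot.bddBelow _)
      (⟨q.1, hs⟩ : {q : ℚ≥0 // s < (q : ℝ≥0)})).trans_lt hq

/-- The càdlàg path with prescribed values at the rationals (if it is monotone). -/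
noncomputable def CadlagPath.ofRat (x : ℚ≥0 → ℝ≥0) : CadlagPath ℝ≥0 ℝ≥0 :=
  ⟨rightReg x, isCadlag_rightReg x⟩

/-- The values of a path at the rationals. -/
def CadlagPath.toRat (x : CadlagPath ℝ≥0 ℝ≥0) (q : ℚ≥0) : ℝ≥0 := x (q : ℝ≥0)

theorem CadlagPath.measurable_ofRat : Measurable CadlagPath.ofRat :=
  CadlagPath.measurable_of_eval fun _ => Measurable.iInf fun q => measurable_pi_apply q.1

theorem CadlagPath.measurable_toRat : Measurable CadlagPath.toRat :=
  measurable_pi_lambda _ fun _ => CadlagPath.measurable_eval _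

theorem rightReg_eq {x : ℝ≥0 → ℝ≥0} (hx : Monotone x) {t : ℝ≥0}
    (hr : ContinuousWithinAt x (Ici t) t) : rightReg (fun q => x q) t = x t := by
  refine le_antisymm ?_ (le_ciInf fun q => hx q.2.le)
  refine le_of_forall_gt fun a ha => ?_
  have h : ∀ᶠ s in 𝓝[>] t ⊓ 𝓟 (range fun q : ℚ≥0 => (q : ℝ≥0)), x s < a :=
    (hr.tendsto.mono_left (inf_le_left.trans (nhdsWithin_mono _ Ioi_subset_Ici_self))).eventually
      (Iio_mem_nhds ha)
  have h1 : ∀ᶠ s in 𝓝[>] t ⊓ 𝓟 (range fun q : ℚ≥0 => (q : ℝ≥0)), t < s :=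
    mem_inf_of_left self_mem_nhdsWithin
  have h2 : ∀ᶠ s in 𝓝[>] t ⊓ 𝓟 (range fun q : ℚ≥0 => (q : ℝ≥0)),
      s ∈ range fun q : ℚ≥0 => (q : ℝ≥0) := mem_inf_of_right (mem_principal_self _)
  have := nhdsGT_inf_range_nnrat_neBot t
  obtain ⟨_, hs, hts, q, rfl⟩ := (h.and (h1.and h2)).exists
  exact (ciInf_le (OrderBot.bddBelow _)
    (⟨q, hts⟩ : {q : ℚ≥0 // t < (q : ℝ≥0)})).trans_lt hs

theorem CadlagPath.ofRat_toRat {x : CadlagPath ℝ≥0 ℝ≥0} (hx : Monotone (x : ℝ≥0 → ℝ≥0)) :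
    CadlagPath.ofRat x.toRat = x :=
  Subtype.ext (funext fun t => rightReg_eq hx (x.2 t).1)

/-- By right-continuity every evaluation is a limit of evaluations at rationals. Countable
generation makes conditional laws unique up to null sets. -/
instance : MeasurableSpace.CountablyGenerated (CadlagPath ℝ≥0 ℝ≥0) := by
  have h : (CadlagPath.instMeasurableSpace : MeasurableSpace (CadlagPath ℝ≥0 ℝ≥0)) =
      MeasurableSpace.comap CadlagPath.toRat inferInstance := by
    refine le_antisymm ?_ CadlagPath.measurable_toRat.comap_le
    refine measurable_iff_comap_le.1 ?_
    let : MeasurableSpace (CadlagPath ℝ≥0 ℝ≥0) :=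
      MeasurableSpace.comap CadlagPath.toRat inferInstance
    refine measurable_pi_lambda _ fun t => ?_
    have := nhdsGT_inf_range_nnrat_neBot t
    obtain ⟨u, hu⟩ := (𝓝[>] t ⊓ 𝓟 (range fun q : ℚ≥0 => (q : ℝ≥0))).exists_seq_tendsto
    have h2 : ∀ᶠ n in atTop, u n ∈ range fun q : ℚ≥0 => (q : ℝ≥0) :=
      hu.eventually (mem_inf_of_right (mem_principal_self _))
    obtain ⟨n₀, hn₀⟩ := eventually_atTop.1 h2
    choose q hq using fun n => hn₀ (n + n₀) (by simp)
    refine measurable_of_tendsto_metrizable (f := fun n (x : CadlagPath ℝ≥0 ℝ≥0) => x.toRat (q n))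
      (fun n => (measurable_pi_apply (q n)).comp (comap_measurable CadlagPath.toRat)) ?_
    refine tendsto_pi_nhds.2 fun x => ?_
    have := (x.2.tendsto_nnrat t).comp (hu.comp (tendsto_add_atTop_nat n₀))
    refine this.congr fun n => ?_
    simp only [Function.comp_apply, CadlagPath.toRat]
    rw [← hq n]
  rw [h]
  exact MeasurableSpace.CountablyGenerated.comap _

theorem CadlagPath.measurable_shift (t : ℝ≥0) :
    Measurable (CadlagPath.shift t : CadlagPath ℝ≥0 ℝ≥0 → CadlagPath ℝ≥0 ℝ≥0) :=
  CadlagPath.measurable_of_eval fun _ => CadlagPath.measurable_eval _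

theorem CadlagPath.measurable_rescale {γ : ℝ≥0 → ℝ} (hγ : Measurable γ) (α : ℝ≥0) :
    Measurable (CadlagPath.rescale γ α) := by
  refine CadlagPath.measurable_of_eval fun t => ?_
  have h0 := CadlagPath.measurable_eval (E := ℝ≥0) (0 : ℝ≥0)
  have h1 := CadlagPath.measurable_eval (E := ℝ≥0) (α * unitInterval.toNNReal t)
  exact (h1.coe_nnreal_real.sub h0.coe_nnreal_real).div
    (measurable_const.pow (measurable_const.div (hγ.comp h0)))

/-! ### The uniform distance -/

/-- The uniform distance between two paths. -/
noncomputable def supEdist (x y : CadlagPath I ℝ) : ℝ≥0∞ := ⨆ t : I, edist (x t) (y t)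

/-- Right-continuity recovers every time `t < 1` from a countable dense set. The endpoint `1` has no
times to its right and is added by hand. -/
theorem exists_countable_supEdist : ∃ s : Set I, s.Countable ∧
    ∀ x y : CadlagPath I ℝ, supEdist x y = ⨆ t : s, edist (x t) (y t) := by
  obtain ⟨s, hsc, hsd⟩ := TopologicalSpace.exists_countable_dense I
  refine ⟨insert 1 s, hsc.insert 1, fun x y => le_antisymm (iSup_le fun t => ?_)
    (iSup_le fun t => le_iSup (fun t : I => edist (x t) (y t)) t)⟩
  rcases eq_or_ne t 1 with rfl | ht
  · exact le_iSup (fun t : (insert 1 s : Set I) => edist (x t) (y t)) ⟨1, mem_insert _ _⟩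
  have ht1 : t < 1 := lt_of_le_of_ne unitInterval.le_one' ht
  have hcl : t ∈ closure (Ioi t ∩ s) := by
    have h1 := hsd.open_subset_closure_inter (isOpen_Ioi (a := t))
    have h2 : t ∈ closure (Ioi t) := by
      have h3 : closure (Ioi t) = Ici t := closure_Ioi' ⟨1, ht1⟩
      rw [h3]; exact self_mem_Ici
    exact closure_minimal h1 isClosed_closure h2
  have : (𝓝[Ioi t ∩ s] t).NeBot := mem_closure_iff_nhdsWithin_neBot.1 hcl
  have hle : 𝓝[Ioi t ∩ s] t ≤ 𝓝[Ici t] t :=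
    nhdsWithin_mono _ (inter_subset_left.trans Ioi_subset_Ici_self)
  have hlim : Tendsto (fun r => edist (x r) (y r)) (𝓝[Ioi t ∩ s] t) (𝓝 (edist (x t) (y t))) :=
    ((x.2 t).1.tendsto.mono_left hle).edist ((y.2 t).1.tendsto.mono_left hle)
  refine le_of_tendsto hlim ?_
  filter_upwards [self_mem_nhdsWithin] with r hr
  exact le_iSup (fun t : (insert 1 s : Set I) => edist (x t) (y t)) ⟨r, mem_insert_of_mem _ hr.2⟩

theorem measurable_supEdist :
    Measurable fun p : CadlagPath I ℝ × CadlagPath I ℝ => supEdist p.1 p.2 := by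
  obtain ⟨s, hs, h⟩ := exists_countable_supEdist
  have := hs.to_subtype
  simp_rw [h]
  exact Measurable.iSup fun t => ((CadlagPath.measurable_eval _).comp measurable_fst).edist
    ((CadlagPath.measurable_eval _).comp measurable_snd)

theorem exists_forall_supEdist_le {f : CadlagPath I ℝ → ℝ} (hf : Continuous f)
    (y : CadlagPath I ℝ) {ε : ℝ} (hε : 0 < ε) :
    ∃ δ : ℝ≥0∞, 0 < δ ∧ ∀ x, supEdist x y ≤ δ → |f x - f y| ≤ ε := by
  have hmem : f ⁻¹' Metric.closedBall (f y) ε ∈ 𝓝 y :=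
    hf.continuousAt (Metric.closedBall_mem_nhds _ hε)
  rw [nhds_induced, mem_comap] at hmem
  obtain ⟨U, hU, hUf⟩ := hmem
  obtain ⟨δ, hδ, hδU⟩ := ((UniformFun.hasBasis_nhds_of_basis I ℝ _
    uniformity_basis_edist_le).mem_iff).1 hU
  refine ⟨δ, hδ, fun x hx => ?_⟩
  have hxU : UniformFun.ofFun (x : I → ℝ) ∈ U := hδU fun t => by
    show edist (y t) (x t) ≤ δ
    rw [edist_comm]
    exact (le_iSup (fun t : I => edist (x t) (y t)) t).trans hx
  have := hUf hxU
  rwa [mem_preimage, Metric.mem_closedBall, Real.dist_eq] at this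

/-! ### Convergence in law from couplings with a fixed limit law -/

/-- A sequence of functions converging to zero in mean has a subsequence converging almost
everywhere. -/
theorem exists_subseq_tendsto_zero_of_lintegral {E : Type*} [MeasurableSpace E] {μ : Measure E}
    {h : ℕ → E → ℝ≥0∞} (hm : ∀ n, Measurable (h n))
    (hh : Tendsto (fun n => ∫⁻ x, h n x ∂μ) atTop (𝓝 0)) :
    ∃ ms : ℕ → ℕ, ∀ᵐ x ∂μ, Tendsto (fun k => h (ms k) x) atTop (𝓝 0) := by
  obtain ⟨ε, hε, hεs⟩ := ENNReal.exists_pos_sum_of_countable' one_ne_zero ℕ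
  choose ms hms using fun k => ((tendsto_order.1 hh).2 (ε k) (hε k)).exists
  refine ⟨ms, ?_⟩
  have hsum : ∫⁻ x, ∑' k, h (ms k) x ∂μ ≠ ∞ := by
    rw [lintegral_tsum fun k => (hm _).aemeasurable]
    exact ((ENNReal.tsum_le_tsum fun k => (hms k).le).trans_lt (hεs.trans ENNReal.one_lt_top)).ne
  filter_upwards [ae_lt_top (Measurable.tsum fun k => hm (ms k)) hsum] with x hx
  exact ENNReal.tendsto_atTop_zero_of_tsum_ne_top hx.ne

/-- Let `g i (Z)` and `Y i` be random paths whose uniform distance tends to zero, where `Y i` has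
law `μ`. Then `g i (Z)` converges in law to `μ`. As the uniform topology is not separable, the
proof conditions on `Y i` and uses the continuity of test functions at a given path only. -/
theorem tendstoInLaw_of_coupling {Ω A ι : Type*} [MeasurableSpace Ω] {Q : Measure Ω}
    [IsProbabilityMeasure Q] [MeasurableSpace A] [StandardBorelSpace A] [Nonempty A] {Z : Ω → A}
    (hZ : Measurable Z) {l : Filter ι} [l.IsCountablyGenerated] {g : ι → A → CadlagPath I ℝ}
    (hg : ∀ i, Measurable (g i)) {Y : ι → Ω → CadlagPath I ℝ} (hY : ∀ i, Measurable (Y i))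
    {μ : Measure (CadlagPath I ℝ)} (hlaw : ∀ᶠ i in l, Q.map (Y i) = μ)
    (hd : ∀ᵐ ω ∂Q, Tendsto (fun i => supEdist (g i (Z ω)) (Y i ω)) l (𝓝 0)) :
    TendstoInLaw (fun i => Q.map fun ω => g i (Z ω)) l μ := by
  rintro f hf hfm ⟨C, hC⟩
  -- Almost everywhere convergence of the conditional distances is available only along
  -- subsequences, which suffices because `l` is countably generated.
  refine tendsto_of_subseq_tendsto fun ns hns => ?_
  obtain ⟨n₀, hn₀⟩ := eventually_atTop.1 (hns.eventually hlaw)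
  have hμ : IsProbabilityMeasure μ := by
    rw [← hn₀ n₀ le_rfl]; exact Measure.isProbabilityMeasure_map (hY _).aemeasurable
  set m : ℕ → ι := fun n => ns (n + n₀)
  have hm : Tendsto m atTop l := hns.comp (tendsto_add_atTop_nat n₀)
  have hlm : ∀ n, Q.map (Y (m n)) = μ := fun n => hn₀ _ (by simp)
  set K : ℕ → Kernel (CadlagPath I ℝ) A := fun n => condDistrib Z (Y (m n)) Q
  have hK : ∀ n, μ ⊗ₘ K n = Q.map fun ω => (Y (m n) ω, Z ω) := fun n => by
    rw [← hlm n]; exact compProd_map_condDistrib hZ.aemeasurable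
  set D : ℕ → CadlagPath I ℝ × A → ℝ≥0∞ := fun n p => min 1 (supEdist (g (m n) p.2) p.1)
  have hD : ∀ n, Measurable (D n) := fun n => measurable_const.min
    (measurable_supEdist.comp (((hg _).comp measurable_snd).prodMk measurable_fst))
  have hD1 : ∀ n p, D n p ≤ 1 := fun n p => min_le_left _ _
  -- Mean truncated distance given that the path of law `μ` equals `y`.
  set h : ℕ → CadlagPath I ℝ → ℝ≥0∞ := fun n y => ∫⁻ a, D n (y, a) ∂K n y
  have hh : Tendsto (fun n => ∫⁻ y, h n y ∂μ) atTop (𝓝 0) := by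
    have h1 : ∀ n, ∫⁻ y, h n y ∂μ = ∫⁻ ω, D n (Y (m n) ω, Z ω) ∂Q := fun n => by
      rw [← Measure.lintegral_compProd (hD n), hK, lintegral_map (hD n) ((hY _).prodMk hZ)]
    simp_rw [h1]
    have := tendsto_lintegral_of_dominated_convergence (μ := Q) (f := fun _ => 0)
      (F := fun n ω => D n (Y (m n) ω, Z ω)) (fun _ => 1)
      (fun n => (hD n).comp ((hY _).prodMk hZ)) (fun n => ae_of_all _ fun ω => hD1 _ _) (by simp) ?_
    · simpa using this
    · filter_upwards [hd] with ω hω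
      have := (tendsto_const_nhds (x := (1 : ℝ≥0∞))).min (hω.comp hm)
      simpa using this
  obtain ⟨ks, hks⟩ := exists_subseq_tendsto_zero_of_lintegral
    (fun n => (hD n).lintegral_kernel_prod_right') hh
  refine ⟨fun k => ks k + n₀, ?_⟩
  have hint : ∀ k, ∫ x, f x ∂(Q.map fun ω => g (m (ks k)) (Z ω)) =
      ∫ y, ∫ a, f (g (m (ks k)) a) ∂K (ks k) y ∂μ := by
    intro k
    have hfg : Measurable fun p : CadlagPath I ℝ × A => f (g (m (ks k)) p.2) :=
      hfm.comp ((hg _).comp measurable_snd)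
    have hgZ : Measurable fun ω => g (m (ks k)) (Z ω) := (hg _).comp hZ
    rw [← Measure.integral_compProd (f := fun p : CadlagPath I ℝ × A => f (g (m (ks k)) p.2)), hK,
      integral_map ((hY _).prodMk hZ).aemeasurable hfg.aestronglyMeasurable,
      integral_map hgZ.aemeasurable hfm.aestronglyMeasurable]
    exact Integrable.of_bound hfg.aestronglyMeasurable C (ae_of_all _ fun p => hC _)
  refine Tendsto.congr (fun k => (hint k).symm) ?_
  refine tendsto_integral_of_dominated_convergence (fun _ => C) (fun k => ?_)
    (integrable_const _) (fun k => ae_of_all _ fun y => ?_) ?_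
  · have hfg : Measurable fun p : CadlagPath I ℝ × A => f (g (m (ks k)) p.2) :=
      hfm.comp ((hg _).comp measurable_snd)
    exact (hfg.stronglyMeasurable.integral_kernel_prod_right' (κ := K (ks k))).aestronglyMeasurable
  · refine (norm_integral_le_of_norm_le_const (ae_of_all _ fun a => hC _)).trans ?_
    simp
  · filter_upwards [hks] with y hy
    have hC0 : 0 ≤ C := (abs_nonneg _).trans (hC y)
    rw [Metric.tendsto_atTop]
    intro ε hε
    obtain ⟨δ', hδ', hδf⟩ := exists_forall_supEdist_le hf y (half_pos hε)
    obtain ⟨δ, hδ, hδ1⟩ : ∃ δ : ℝ, 0 < δ ∧ ENNReal.ofReal δ ≤ min δ' 1 := by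
      refine ⟨(min δ' 1).toReal, ENNReal.toReal_pos (by simp [hδ'.ne']) (by simp), ?_⟩
      rw [ENNReal.ofReal_toReal (by simp)]
    -- Within distance `δ'` of `y` continuity at `y` applies; otherwise the truncated distance is at
    -- least `δ`, and the trivial bound `2 * C` is absorbed into its multiple.
    have hpt : ∀ n a, |f (g (m n) a) - f y| ≤ ε / 2 + 2 * C / δ * (D n (y, a)).toReal := by
      intro n a
      have hDtop : D n (y, a) ≠ ∞ := ((hD1 n _).trans_lt ENNReal.one_lt_top).ne
      by_cases hle : supEdist (g (m n) a) y ≤ δ'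
      · refine (hδf _ hle).trans (le_add_of_nonneg_right (by positivity))
      · have h1 : δ ≤ (D n (y, a)).toReal := by
          rw [← ENNReal.ofReal_le_iff_le_toReal hDtop]
          refine hδ1.trans ?_
          rw [min_comm]
          exact min_le_min_left _ (not_le.1 hle).le
        have h2 : |f (g (m n) a) - f y| ≤ 2 * C := by
          refine (abs_sub _ _).trans ?_
          linarith [hC (g (m n) a), hC y]
        have h3 : 2 * C ≤ 2 * C / δ * (D n (y, a)).toReal := by
          rw [div_mul_eq_mul_div, le_div_iff₀ hδ]
          exact mul_le_mul_of_nonneg_left h1 (by positivity)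
        linarith
    have hlim : Tendsto (fun k => 2 * C / δ * (h (ks k) y).toReal) atTop (𝓝 0) := by
      have := ((ENNReal.tendsto_toReal ENNReal.zero_ne_top).comp hy).const_mul (2 * C / δ)
      simpa using this
    obtain ⟨k₀, hk₀⟩ := eventually_atTop.1 (hlim.eventually (Iio_mem_nhds (half_pos hε)))
    refine ⟨k₀, fun k hk => ?_⟩
    have hfa : Integrable (fun a => f (g (m (ks k)) a)) (K (ks k) y) :=
      Integrable.of_bound (hfm.comp (hg _)).aestronglyMeasurable C (ae_of_all _ fun p => hC _)
    have hDa : Integrable (fun a => (D (ks k) (y, a)).toReal) (K (ks k) y) := by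
      refine Integrable.of_bound ((hD _).comp measurable_prodMk_left).ennreal_toReal.aestronglyMeasurable
        1 (ae_of_all _ fun a => ?_)
      rw [Real.norm_eq_abs, abs_of_nonneg ENNReal.toReal_nonneg]
      exact ENNReal.toReal_mono ENNReal.one_ne_top (hD1 _ _)
    have hDint : ∫ a, (D (ks k) (y, a)).toReal ∂K (ks k) y = (h (ks k) y).toReal :=
      integral_toReal ((hD _).comp measurable_prodMk_left).aemeasurable
        (ae_of_all _ fun a => (hD1 _ _).trans_lt ENNReal.one_lt_top)
    have hsub : ∫ a, f (g (m (ks k)) a) ∂K (ks k) y - f y =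
        ∫ a, (f (g (m (ks k)) a) - f y) ∂K (ks k) y := by
      rw [integral_sub hfa (integrable_const _)]; simp
    rw [Real.dist_eq, hsub]
    calc |∫ a, (f (g (m (ks k)) a) - f y) ∂K (ks k) y|
        ≤ ∫ a, |f (g (m (ks k)) a) - f y| ∂K (ks k) y := abs_integral_le_integral_abs
      _ ≤ ∫ a, (ε / 2 + 2 * C / δ * (D (ks k) (y, a)).toReal) ∂K (ks k) y :=
          integral_mono ((hfa.sub (integrable_const _)).abs)
            ((integrable_const _).add (hDa.const_mul _)) fun a => hpt _ a
      _ = ε / 2 + 2 * C / δ * (h (ks k) y).toReal := by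
          rw [integral_add (integrable_const _) (hDa.const_mul _), integral_const_mul, hDint]
          simp
      _ < ε := by linarith [hk₀ k hk]

/-! ### Uniqueness of the law of a subordinator -/

/-- The function `x ↦ exp (-x)` on `[0,∞)`. -/
noncomputable def expNegBounded : BoundedContinuousFunction ℝ≥0 ℝ :=
  BoundedContinuousFunction.ofNormedAddCommGroup (fun x : ℝ≥0 => Real.exp (-(x : ℝ)))
    (by fun_prop) 1 fun x => by
      rw [Real.norm_eq_abs, Real.abs_exp]
      exact Real.exp_le_one_iff.2 (neg_nonpos.2 x.2)

/-- Polynomials in `exp (-x)` form an algebra of bounded continuous functions that separates points,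
and on a Polish space the integrals over such an algebra determine a finite measure. -/
theorem NNReal.measure_ext_of_laplace {μ ν : Measure ℝ≥0} [IsFiniteMeasure μ] [IsFiniteMeasure ν]
    (h : ∀ n : ℕ, ∫ x : ℝ≥0, Real.exp (-(n : ℝ) * x) ∂μ = ∫ x : ℝ≥0, Real.exp (-(n : ℝ) * x) ∂ν) :
    μ = ν := by
  have hpow : ∀ (n : ℕ) (x : ℝ≥0), (expNegBounded ^ n) x = Real.exp (-(n : ℝ) * x) := by
    intro n x
    rw [BoundedContinuousFunction.pow_apply]
    show Real.exp (-(x : ℝ)) ^ n = _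
    rw [← Real.exp_nat_mul]
    congr 1
    ring
  let A : StarSubalgebra ℝ (BoundedContinuousFunction ℝ≥0 ℝ) :=
    { toSubalgebra := (Polynomial.aeval (R := ℝ) expNegBounded).range
      star_mem' := fun {a} ha => by
        have : star a = a := by ext x; simp
        rwa [this] }
  refine ext_of_forall_mem_subalgebra_integral_eq_of_polish (𝕜 := ℝ) (A := A) ?_ ?_
  · intro x y hxy
    refine ⟨fun x => Real.exp (-(x : ℝ)), ⟨_, ⟨expNegBounded, ⟨Polynomial.X, ?_⟩, rfl⟩, rfl⟩, ?_⟩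
    · simp
    · simpa using hxy
  · rintro _ ⟨p, rfl⟩
    have hint : ∀ (ρ : Measure ℝ≥0) [IsFiniteMeasure ρ] (f : BoundedContinuousFunction ℝ≥0 ℝ),
        Integrable f ρ := fun ρ _ f => f.integrable ρ
    induction p using Polynomial.induction_on' with
    | add p q hp hq =>
      simp only [map_add, BoundedContinuousFunction.coe_add, Pi.add_apply] at hp hq ⊢
      rw [integral_add (hint _ _) (hint _ _), integral_add (hint _ _) (hint _ _)]
      exact congrArg₂ _ hp hq
    | monomial n a =>
      have : ∀ x : ℝ≥0, (Polynomial.aeval expNegBounded (Polynomial.monomial n a)) x =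
          a * Real.exp (-(n : ℝ) * x) := by
        intro x
        rw [Polynomial.aeval_monomial, BoundedContinuousFunction.mul_apply, hpow]
        rfl
      refine (integral_congr_ae (ae_of_all _ this)).trans
        (Eq.trans ?_ (integral_congr_ae (ae_of_all _ this)).symm)
      rw [integral_const_mul, integral_const_mul, h]

theorem Real.measure_ext_of_laplace {μ ν : Measure ℝ} [IsFiniteMeasure μ] [IsFiniteMeasure ν]
    (hμ : ∀ᵐ x ∂μ, 0 ≤ x) (hν : ∀ᵐ x ∂ν, 0 ≤ x)
    (h : ∀ r : ℝ, 0 ≤ r → ∫ x, Real.exp (-r * x) ∂μ = ∫ x, Real.exp (-r * x) ∂ν) : μ = ν := by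
  have hback : ∀ ρ : Measure ℝ, (∀ᵐ x ∂ρ, 0 ≤ x) → (ρ.map Real.toNNReal).map (↑) = ρ := by
    intro ρ hρ
    rw [Measure.map_map measurable_coe_nnreal_real measurable_real_toNNReal]
    conv_rhs => rw [← Measure.map_id (μ := ρ)]
    exact Measure.map_congr (hρ.mono fun x hx => by simp [hx])
  rw [← hback μ hμ, ← hback ν hν]
  congr 1
  refine NNReal.measure_ext_of_laplace fun n => ?_
  have hmap : ∀ ρ : Measure ℝ, (∀ᵐ x ∂ρ, 0 ≤ x) →
      ∫ x : ℝ≥0, Real.exp (-(n : ℝ) * x) ∂ρ.map Real.toNNReal =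
        ∫ x, Real.exp (-(n : ℝ) * x) ∂ρ := by
    intro ρ hρ
    rw [integral_map measurable_real_toNNReal.aemeasurable (by fun_prop)]
    exact integral_congr_ae (hρ.mono fun x hx => by simp [hx])
  rw [hmap μ hμ, hmap ν hν, h n n.cast_nonneg]

theorem measurable_partialSum (n : ℕ) :
    Measurable fun v : Fin n → ℝ => (Fin.partialSum v : Fin (n + 1) → ℝ) := by
  refine measurable_pi_lambda _ fun k => ?_
  induction k using Fin.induction with
  | zero => simp
  | succ k ih =>
    simp_rw [Fin.partialSum_succ]
    exact ih.add (measurable_pi_apply k)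

theorem partialSum_increments {n : ℕ} (x : Fin (n + 1) → ℝ) (h0 : x 0 = 0) :
    Fin.partialSum (fun i : Fin n => x i.succ - x i.castSucc) = x := by
  ext k
  induction k using Fin.induction with
  | zero => simp [h0]
  | succ k ih => rw [Fin.partialSum_succ, ih]; ring

/-- The law of a càdlàg subordinator is determined by its Lévy measure. -/
theorem IsSubordinatorLaw.unique {ν : Measure ℝ} {μ₁ μ₂ : Measure (CadlagPath I ℝ)}
    (h₁ : IsSubordinatorLaw ν μ₁) (h₂ : IsSubordinatorLaw ν μ₂) : μ₁ = μ₂ := by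
  obtain ⟨hp₁, h₁⟩ := h₁
  obtain ⟨hp₂, h₂⟩ := h₂
  have hinc : ∀ s t : I, s ≤ t → μ₁.map (fun x : CadlagPath I ℝ => x t - x s) =
      μ₂.map fun x : CadlagPath I ℝ => x t - x s := by
    intro s t hst
    have hm : Measurable fun x : CadlagPath I ℝ => x t - x s :=
      (CadlagPath.measurable_eval t).sub (CadlagPath.measurable_eval s)
    have hpos : ∀ {μ : Measure (CadlagPath I ℝ)}, IsSubordinator ν (fun t x => x t) μ →
        ∀ᵐ y ∂μ.map (fun x : CadlagPath I ℝ => x t - x s), 0 ≤ y := by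
      intro μ h
      rw [ae_map_iff hm.aemeasurable measurableSet_Ici]
      filter_upwards [h.mono] with x hx using sub_nonneg.2 (hx hst)
    have hp₁' := Measure.isProbabilityMeasure_map (μ := μ₁) hm.aemeasurable
    have hp₂' := Measure.isProbabilityMeasure_map (μ := μ₂) hm.aemeasurable
    refine Real.measure_ext_of_laplace (hpos h₁) (hpos h₂) fun r hr => ?_
    rw [integral_map hm.aemeasurable (by fun_prop), integral_map hm.aemeasurable (by fun_prop),
      h₁.laplace s t hst r hr, h₂.laplace s t hst r hr]
  refine CadlagPath.measure_ext fun s => ?_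
  -- With the time `0` adjoined, where the path vanishes, the values at the chosen times are partial
  -- sums of independent increments, whose laws are already known to agree.
  obtain ⟨n, hn⟩ : ∃ n, (insert 0 s).card = n + 1 :=
    Nat.exists_eq_succ_of_ne_zero (Finset.card_ne_zero_of_mem (Finset.mem_insert_self 0 s))
  set t : Fin (n + 1) ↪o I := (insert 0 s).orderEmbOfFin hn with ht
  have ht0 : t 0 = 0 := by
    refine le_antisymm ?_ unitInterval.nonneg'
    have h := (Finset.range_orderEmbOfFin (insert 0 s) hn).symm.subset
      (Finset.mem_coe.2 (Finset.mem_insert_self 0 s))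
    obtain ⟨k, hk⟩ := h
    rw [← hk]
    exact t.monotone (Fin.zero_le k)
  have hsurj : ∀ i : s, ∃ k, t k = i := fun i =>
    (Finset.range_orderEmbOfFin (insert 0 s) hn).symm.subset
      (Finset.mem_coe.2 (Finset.mem_insert_of_mem i.2))
  choose k hk using hsurj
  have hmi : ∀ i : Fin n, Measurable fun x : CadlagPath I ℝ => x (t i.succ) - x (t i.castSucc) :=
    fun i => (CadlagPath.measurable_eval _).sub (CadlagPath.measurable_eval _)
  have hmain : ∀ {μ : Measure (CadlagPath I ℝ)} [IsProbabilityMeasure μ],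
      IsSubordinator ν (fun t x => x t) μ → μ.map (fun x (i : s) => x i) =
        (Measure.pi fun i : Fin n => μ.map fun x : CadlagPath I ℝ =>
          x (t i.succ) - x (t i.castSucc)).map
          fun v (i : s) => (Fin.partialSum v : Fin (n + 1) → ℝ) (k i) := by
    intro μ _ h
    rw [← (h.indep n t t.monotone).map_fun_eq_pi_map fun i => (hmi i).aemeasurable,
      Measure.map_map]
    · refine Measure.map_congr ?_
      filter_upwards [h.zero] with x hx
      ext i
      have := partialSum_increments (fun j => x (t j)) (by rw [ht0]; exact hx)
      simp only [Function.comp_apply]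
      rw [this]
      exact congrArg x.1 (hk i).symm
    · exact measurable_pi_lambda _ fun i =>
        (measurable_pi_apply _).comp (measurable_partialSum n)
    · exact measurable_pi_lambda _ hmi
  rw [hmain h₁, hmain h₂]
  simp_rw [hinc _ _ (t.monotone (Fin.castSucc_lt_succ).le)]

/-! ### Lebesgue measure on the half-line -/

theorem NNReal.measurableEmbedding_coe : MeasurableEmbedding ((↑) : ℝ≥0 → ℝ) :=
  MeasurableEmbedding.subtype_coe measurableSet_Ici

theorem nnrealLebesgue_apply (A : Set ℝ≥0) : nnrealLebesgue A = volume ((↑) '' A : Set ℝ) :=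
  NNReal.measurableEmbedding_coe.comap_apply _ _

theorem lintegral_nnrealLebesgue (f : ℝ → ℝ≥0∞) :
    ∫⁻ x : ℝ≥0, f x ∂nnrealLebesgue = ∫⁻ x in Ici 0, f x := by
  rw [nnrealLebesgue, ← NNReal.measurableEmbedding_coe.lintegral_map,
    NNReal.measurableEmbedding_coe.map_comap, NNReal.range_coe]

theorem setLIntegral_nnrealLebesgue (f : ℝ → ℝ≥0∞) (c : ℝ≥0) :
    ∫⁻ x in Ici c, f x ∂nnrealLebesgue = ∫⁻ x in Ici (c : ℝ), f x := by
  rw [← lintegral_indicator measurableSet_Ici, ← lintegral_indicator measurableSet_Ici]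
  have h : ∀ x : ℝ≥0, (Ici c).indicator (fun x : ℝ≥0 => f x) x =
      (Ici (c : ℝ)).indicator f (x : ℝ) := fun x => by
    simp only [indicator, mem_Ici, NNReal.coe_le_coe]
  simp_rw [h]
  rw [lintegral_nnrealLebesgue, setLIntegral_indicator measurableSet_Ici,
    Ici_inter_Ici, max_eq_left c.coe_nonneg, lintegral_indicator measurableSet_Ici]

theorem nnrealLebesgue_Ioc (a b : ℝ≥0) : nnrealLebesgue (Ioc a b) = (b - a : ℝ≥0) := by
  have h : ((↑) '' Ioc a b : Set ℝ) = Ioc (a : ℝ) b := by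
    ext x
    constructor
    · rintro ⟨y, hy, rfl⟩; exact ⟨NNReal.coe_lt_coe.2 hy.1, NNReal.coe_le_coe.2 hy.2⟩
    · intro hx
      lift x to ℝ≥0 using a.2.trans hx.1.le
      exact ⟨x, ⟨NNReal.coe_lt_coe.1 hx.1, NNReal.coe_le_coe.1 hx.2⟩, rfl⟩
  rw [nnrealLebesgue_apply, h, Real.volume_Ioc, ENNReal.ofReal,
    NNReal.sub_def]

theorem nnrealLebesgue_Iio (a : ℝ≥0) : nnrealLebesgue (Iio a) = a := by
  have h : ((↑) '' Iio a : Set ℝ) = Ico (0 : ℝ) a := by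
    ext x
    constructor
    · rintro ⟨y, hy, rfl⟩; exact ⟨y.2, NNReal.coe_lt_coe.2 hy⟩
    · intro hx
      lift x to ℝ≥0 using hx.1
      exact ⟨x, NNReal.coe_lt_coe.1 hx.2, rfl⟩
  rw [nnrealLebesgue_apply, h, Real.volume_Ico, sub_zero, ENNReal.ofReal_coe_nnreal]

instance : SigmaFinite nnrealLebesgue :=
  ⟨⟨{ set := fun n => Iio (n : ℝ≥0)
      set_mem := fun _ => trivial
      finite := fun n => by rw [nnrealLebesgue_Iio]; exact ENNReal.coe_lt_top
      spanning := iUnion_eq_univ_iff.2 fun x => exists_nat_gt x }⟩⟩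

/-- The intensity measure `ds dz`. -/
noncomputable abbrev quadrantLebesgue : Measure (ℝ≥0 × ℝ≥0) :=
  nnrealLebesgue.prod nnrealLebesgue

theorem quadrantLebesgue_prod (s t : ℝ≥0) (B : Set ℝ≥0) :
    quadrantLebesgue (Ioc s t ×ˢ B) = (t - s : ℝ≥0) * nnrealLebesgue B := by
  rw [Measure.prod_prod, nnrealLebesgue_Ioc]

theorem setLIntegral_quadrantLebesgue (s t : ℝ≥0) (B : Set ℝ≥0) {f : ℝ≥0 → ℝ≥0∞}
    (hf : Measurable f) :
    ∫⁻ p in Ioc s t ×ˢ B, f p.2 ∂quadrantLebesgue =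
      (t - s : ℝ≥0) * ∫⁻ z in B, f z ∂nnrealLebesgue := by
  rw [← Measure.prod_restrict, lintegral_prod (fun p : ℝ≥0 × ℝ≥0 => f p.2)
    (hf.comp measurable_snd).aemeasurable]
  simp only [lintegral_const, Measure.restrict_apply_univ, nnrealLebesgue_Ioc]
  rw [mul_comm]

/-! ### Random measures as kernels -/

section
variable {Ω S : Type*} [MeasurableSpace S] {N : Ω → Measure S}

theorem measurable_restrict_restrictionSigma {D : Set S} (hD : MeasurableSet D) :
    Measurable[restrictionSigma N D] fun ω => (N ω).restrict D := by
  refine @Measure.measurable_of_measurable_coe _ _ _ (restrictionSigma N D) _ fun A hA => ?_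
  simp_rw [Measure.restrict_apply hA]
  exact measurable_restrictionSigma (hA.inter hD) inter_subset_right

theorem measurable_setLIntegral_restrictionSigma {D : Set S} (hD : MeasurableSet D)
    {f : S → ℝ≥0∞} (hf : Measurable f) :
    Measurable[restrictionSigma N D] fun ω => ∫⁻ x in D, f x ∂N ω :=
  (Measure.measurable_lintegral hf).comp (measurable_restrict_restrictionSigma hD)

end

/-- A random measure that is finite on the cells of a countable partition agrees with an s-finite
kernel. -/
theorem exists_sFiniteKernel_eq {Ω S : Type*} [MeasurableSpace Ω] [MeasurableSpace S]
    {N : Ω → Measure S} (hN : Measurable N) (R : ℕ → Set S) (hR : ∀ k, MeasurableSet (R k))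
    (hd : Pairwise (Function.onFun Disjoint R)) (hU : ⋃ k, R k = univ) :
    ∃ η : Kernel Ω S, IsSFiniteKernel η ∧ ∀ ω, (∀ k, N ω (R k) ≠ ∞) → η ω = N ω := by
  classical
  -- On `E k j` the restriction to `R k` has mass at most `j + 1`, so cutting along these events
  -- writes the random measure as a countable sum of finite kernels.
  set E : ℕ → ℕ → Set Ω := fun k j => {ω | N ω (R k) ∈ Ico (j : ℝ≥0∞) (j + 1)}
  have hE : ∀ k j, MeasurableSet (E k j) := fun k j =>
    ((Measure.measurable_coe (hR k)).comp hN) measurableSet_Ico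
  set κ : ℕ → Kernel Ω S := fun k => ⟨fun ω => (N ω).restrict (R k),
    Measure.measurable_of_measurable_coe _ fun A hA => by
      simp_rw [Measure.restrict_apply hA]
      exact (Measure.measurable_coe (hA.inter (hR k))).comp hN⟩
  set κ' : ℕ × ℕ → Kernel Ω S := fun p => Kernel.piecewise (hE p.1 p.2) (κ p.1) 0
  have hfin : ∀ p, IsFiniteKernel (κ' p) := by
    intro p
    refine ⟨⟨(p.2 : ℝ≥0∞) + 1, by simp, fun ω => ?_⟩⟩
    by_cases h : ω ∈ E p.1 p.2
    · simp only [κ', Kernel.piecewise_apply, if_pos h]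
      show ((N ω).restrict (R p.1)) univ ≤ _
      rw [Measure.restrict_apply_univ]
      exact h.2.le
    · simp [κ', Kernel.piecewise_apply, if_neg h]
  refine ⟨Kernel.sum κ', inferInstance, fun ω hω => ?_⟩
  ext A hA
  rw [Kernel.sum_apply' _ _ hA, ENNReal.tsum_prod (f := fun k j => κ' (k, j) ω A)]
  have hinner : ∀ k, ∑' j, κ' (k, j) ω A = N ω (A ∩ R k) := by
    intro k
    obtain ⟨y, hy⟩ : ∃ y : ℝ≥0, (y : ℝ≥0∞) = N ω (R k) := ⟨_, ENNReal.coe_toNNReal (hω k)⟩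
    rw [tsum_eq_single ⌊y⌋₊]
    · have hmem : ω ∈ E k ⌊y⌋₊ := by
        show N ω (R k) ∈ Ico _ _
        rw [← hy]
        constructor
        · exact_mod_cast Nat.floor_le y.2
        · exact_mod_cast Nat.lt_floor_add_one y
      simp only [κ', Kernel.piecewise_apply, if_pos hmem]
      exact Measure.restrict_apply hA
    · intro j hj
      have hmem : ω ∉ E k j := by
        rintro ⟨h1, h2⟩
        rw [← hy] at h1 h2
        refine hj ((Nat.floor_eq_iff y.2).2 ⟨?_, ?_⟩).symm
        · exact_mod_cast h1
        · exact_mod_cast h2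
      simp [κ', Kernel.piecewise_apply, if_neg hmem]
  simp_rw [hinner]
  rw [← measure_iUnion (fun i j hij => (hd hij).mono inter_subset_right inter_subset_right)
    (fun k => hA.inter (hR k)), ← inter_iUnion, hU, inter_univ]

/-- Local finiteness of `N` holds only almost surely. An s-finite version, measurable for the points
in `D` alone, is what makes integrals against it jointly measurable in a parameter and `ω`. -/
theorem IsPoissonRandomMeasure.exists_kernel {Ω S : Type*} [MeasurableSpace Ω] [MeasurableSpace S]
    {N : Ω → Measure S} {Λ : Measure S} {P : Measure Ω} [SigmaFinite Λ]
    (hN : IsPoissonRandomMeasure N Λ P) {D : Set S} (hD : MeasurableSet D) :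
    ∃ η : @Kernel Ω S (restrictionSigma N D) _, @IsSFiniteKernel Ω S (restrictionSigma N D) _ η ∧
      ∀ᵐ ω ∂P, η ω = (N ω).restrict D := by
  obtain ⟨η, hη, h⟩ := @exists_sFiniteKernel_eq Ω S (restrictionSigma N D) _ _
    (measurable_restrict_restrictionSigma hD) (disjointed (spanningSets Λ))
    (MeasurableSet.disjointed (measurableSet_spanningSets Λ)) (disjoint_disjointed _)
    (by rw [iUnion_disjointed, iUnion_spanningSets])
  refine ⟨η, hη, ?_⟩
  have hfin : ∀ᵐ ω ∂P, ∀ k, N ω (spanningSets Λ k) < ∞ := ae_all_iff.2 fun k =>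
    hN.ae_lt_top (measurableSet_spanningSets Λ k) (measure_spanningSets_lt_top Λ k).ne
  filter_upwards [hfin] with ω hω
  refine h ω fun k => ?_
  exact ((Measure.restrict_apply_le _ _).trans (measure_mono (disjointed_subset _ k))
    |>.trans_lt (hω k)).ne

/-! ### Almost sure estimates for a Poisson random measure on the quadrant -/

section
variable {Ω S : Type*} [MeasurableSpace Ω] [MeasurableSpace S] {N : Ω → Measure S}
  {Λ : Measure S} {P : Measure Ω}

/-- The mass is almost surely an integer, so nonzero means at least `1`, and Markov's inequality
applies. -/
theorem IsPoissonRandomMeasure.measure_apply_ne_zero_le [SigmaFinite Λ]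
    (hN : IsPoissonRandomMeasure N Λ P) {A : Set S} (hA : MeasurableSet A) (hf : Λ A ≠ ∞) :
    P {ω | N ω A ≠ 0} ≤ Λ A := by
  have hnat : ∀ᵐ ω ∂P, N ω A ∈ range ((↑) : ℕ → ℝ≥0∞) := by
    refine ae_of_ae_map (hN.measurable A hA).aemeasurable (p := fun y => y ∈ range _) ?_
    rw [hN.law A hA hf, ae_map_iff (Measurable.of_discrete).aemeasurable
      (show MeasurableSet {y : ℝ≥0∞ | y ∈ range ((↑) : ℕ → ℝ≥0∞)} from
        (countable_range _).measurableSet)]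
    exact ae_of_all _ fun n => mem_range_self n
  have hle : P {ω | N ω A ≠ 0} ≤ P {ω | 1 ≤ N ω A} := by
    refine measure_mono_ae ?_
    filter_upwards [hnat] with ω ⟨n, hn⟩ h0
    have h0' : N ω A ≠ 0 := h0
    show 1 ≤ N ω A
    rw [← hn] at h0' ⊢
    exact_mod_cast Nat.one_le_iff_ne_zero.2 (by exact_mod_cast h0')
  refine hle.trans ?_
  have := mul_meas_ge_le_lintegral (μ := P) (hN.measurable A hA) 1
  rwa [one_mul, hN.lintegral_apply hA] at this

end

theorem measurable_coe_rpow (r : ℝ) : Measurable fun z : ℝ≥0 => ((z ^ r : ℝ≥0) : ℝ≥0∞) :=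
  (measurable_id.pow_const r).coe_nnreal_ennreal

theorem setLIntegral_rpow_lt_top {r : ℝ} (hr : 1 < r) :
    ∫⁻ z in Ici 1, ((z ^ (-r) : ℝ≥0) : ℝ≥0∞) ∂nnrealLebesgue < ∞ := by
  have h : ∀ z : ℝ≥0, ((z ^ (-r) : ℝ≥0) : ℝ≥0∞) = ENNReal.ofReal ((z : ℝ) ^ (-r)) := fun z => by
    rw [← NNReal.coe_rpow, ENNReal.ofReal_coe_nnreal]
  simp_rw [h]
  rw [setLIntegral_nnrealLebesgue (fun x => ENNReal.ofReal (x ^ (-r)))]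
  have hi : IntegrableOn (fun x : ℝ => x ^ (-r)) (Ici ((1 : ℝ≥0) : ℝ)) :=
    (integrableOn_Ici_iff_integrableOn_Ioi (by simp)).2 (integrableOn_Ioi_rpow_of_lt (by linarith) (by simp))
  exact hi.lintegral_lt_top

section
variable {Ω : Type*} [MeasurableSpace Ω] {N : Ω → Measure (ℝ≥0 × ℝ≥0)} {P : Measure Ω}

/-- Almost surely, the sum of the jumps `z ^ (-1/b)` over a bounded time interval is finite,
simultaneously for all `b ∈ (0,1)`. -/
theorem IsPoissonRandomMeasure.ae_forall_lintegral_rpow_lt_top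
    (hN : IsPoissonRandomMeasure N quadrantLebesgue P) :
    ∀ᵐ ω ∂P, ∀ b ∈ Ioo (0 : ℝ) 1, ∀ T : ℝ≥0,
      ∫⁻ p in Ioc 0 T ×ˢ univ, ((p.2 ^ (-1 / b) : ℝ≥0) : ℝ≥0∞) ∂N ω < ∞ := by
  have h1 : ∀ᵐ ω ∂P, ∀ T : ℕ, N ω (Ioc 0 (T : ℝ≥0) ×ˢ Iio 1) < ∞ := ae_all_iff.2 fun T =>
    hN.ae_lt_top (measurableSet_Ioc.prod measurableSet_Iio) (by
      rw [quadrantLebesgue_prod, nnrealLebesgue_Iio]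
      exact ENNReal.mul_ne_top ENNReal.coe_ne_top ENNReal.coe_ne_top)
  -- The jump blows up as `z → 0`, so a whole strip near `z = 0` must be free of points; the strip
  -- of height `1/(k+1)` is hit with probability at most `T/(k+1)`.
  have h2 : ∀ᵐ ω ∂P, ∀ T : ℕ, ∃ k : ℕ,
      N ω (Ioc 0 (T : ℝ≥0) ×ˢ Iio ((k + 1 : ℝ≥0)⁻¹)) = 0 := by
    refine ae_all_iff.2 fun T => ?_
    rw [ae_iff]
    have hle : ∀ k : ℕ, P {ω | ¬∃ k : ℕ, N ω (Ioc 0 (T : ℝ≥0) ×ˢ Iio ((k + 1 : ℝ≥0)⁻¹)) = 0} ≤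
        (T * (k + 1 : ℝ≥0)⁻¹ : ℝ≥0) := by
      intro k
      refine (measure_mono fun ω hω => ?_).trans ((hN.measure_apply_ne_zero_le
        (measurableSet_Ioc.prod measurableSet_Iio) (A := Ioc 0 (T : ℝ≥0) ×ˢ Iio ((k + 1 : ℝ≥0)⁻¹))
        ?_).trans ?_)
      · exact fun h => hω ⟨k, h⟩
      · rw [quadrantLebesgue_prod, nnrealLebesgue_Iio]
        exact ENNReal.mul_ne_top ENNReal.coe_ne_top ENNReal.coe_ne_top
      · rw [quadrantLebesgue_prod, nnrealLebesgue_Iio, tsub_zero, ← ENNReal.coe_mul]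
    have hlim : Tendsto (fun k : ℕ => ((T * (k + 1 : ℝ≥0)⁻¹ : ℝ≥0) : ℝ≥0∞)) atTop (𝓝 0) := by
      rw [← ENNReal.coe_zero, ENNReal.tendsto_coe, ← mul_zero (T : ℝ≥0)]
      refine Tendsto.const_mul _ ?_
      have := tendsto_one_div_add_atTop_nhds_zero_nat (𝕜 := ℝ≥0)
      simpa using this
    exact le_antisymm (ge_of_tendsto' hlim hle) zero_le
  -- The countably many exponents `1 + 1/(k+1)` come below every `1/b > 1`, so one null set serves
  -- all `b`, including a random one.
  have h3 : ∀ᵐ ω ∂P, ∀ T k : ℕ, ∫⁻ p in Ioc 0 (T : ℝ≥0) ×ˢ Ici 1,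
      ((p.2 ^ (-(1 + 1 / (k + 1 : ℝ))) : ℝ≥0) : ℝ≥0∞) ∂N ω < ∞ := by
    refine ae_all_iff.2 fun T => ae_all_iff.2 fun k => ?_
    have hS : MeasurableSet (Ioc 0 (T : ℝ≥0) ×ˢ Ici (1 : ℝ≥0)) :=
      measurableSet_Ioc.prod measurableSet_Ici
    have hf : Measurable fun p : ℝ≥0 × ℝ≥0 =>
        ((p.2 ^ (-(1 + 1 / (k + 1 : ℝ))) : ℝ≥0) : ℝ≥0∞) :=
      (measurable_coe_rpow _).comp measurable_snd
    have hmean := hN.lintegral_lintegral (hf.indicator hS)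
    simp_rw [lintegral_indicator hS] at hmean
    refine MeasureTheory.ae_lt_top ?_ (hmean.trans_ne ?_)
    · have := (Measure.measurable_lintegral (hf.indicator hS)).comp hN.measurable_measure
      simpa only [Function.comp_def, lintegral_indicator hS] using this
    · refine (setLIntegral_quadrantLebesgue _ _ _ (measurable_coe_rpow _)).trans_ne ?_
      exact ENNReal.mul_ne_top ENNReal.coe_ne_top (setLIntegral_rpow_lt_top
        (by have : 0 < 1 / ((k : ℝ) + 1) := by positivity
            linarith)).ne
  filter_upwards [h1, h2, h3] with ω h1 h2 h3 b hb T
  obtain ⟨T', hT'⟩ := exists_nat_ge T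
  obtain ⟨m, hm⟩ := h2 T'
  obtain ⟨k, hk⟩ := exists_nat_one_div_lt (show 0 < 1 / b - 1 by
    rw [sub_pos, one_lt_div hb.1]; exact hb.2)
  have hsub : Ioc 0 T ×ˢ (univ : Set ℝ≥0) ⊆ (Ioc 0 (T' : ℝ≥0) ×ˢ Iio ((m + 1 : ℝ≥0)⁻¹)) ∪
      (Ioc 0 (T' : ℝ≥0) ×ˢ Ico ((m + 1 : ℝ≥0)⁻¹) 1) ∪ (Ioc 0 (T' : ℝ≥0) ×ˢ Ici 1) := by
    rintro ⟨s, z⟩ ⟨hs, -⟩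
    have hs' : s ∈ Ioc 0 (T' : ℝ≥0) := ⟨hs.1, hs.2.trans hT'⟩
    rcases lt_or_ge z ((m + 1 : ℝ≥0)⁻¹) with h | h
    · exact Or.inl (Or.inl ⟨hs', h⟩)
    rcases lt_or_ge z 1 with h' | h'
    · exact Or.inl (Or.inr ⟨hs', h, h'⟩)
    · exact Or.inr ⟨hs', h'⟩
  refine (lintegral_mono_set hsub).trans_lt ?_
  refine (lintegral_union_le _ _ _).trans_lt (ENNReal.add_lt_top.2 ⟨?_, ?_⟩)
  · refine (lintegral_union_le _ _ _).trans_lt (ENNReal.add_lt_top.2 ⟨?_, ?_⟩)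
    · rw [setLIntegral_measure_zero _ _ hm]; exact ENNReal.zero_lt_top
    · refine lt_of_le_of_lt (setLIntegral_mono (g := fun _ =>
        (((m + 1 : ℝ≥0)⁻¹ ^ (-1 / b) : ℝ≥0) : ℝ≥0∞)) measurable_const fun p hp => ?_) ?_
      · refine ENNReal.coe_le_coe.2 ?_
        rw [neg_div, NNReal.rpow_neg, NNReal.rpow_neg]
        have : 0 < ((m + 1 : ℝ≥0)⁻¹) ^ (1 / b) := NNReal.rpow_pos (by positivity)
        have hb' := hb.1
        gcongr
        exact hp.2.1
      · rw [setLIntegral_const]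
        exact ENNReal.mul_lt_top ENNReal.coe_lt_top ((measure_mono
          (Set.prod_mono le_rfl Ico_subset_Iio_self)).trans_lt (h1 T'))
  · refine lt_of_le_of_lt (setLIntegral_mono ((measurable_coe_rpow _).comp measurable_snd)
      fun p hp => ?_) (h3 T' k)
    refine ENNReal.coe_le_coe.2 (NNReal.rpow_le_rpow_of_exponent_le hp.2 ?_)
    rw [neg_div]
    linarith

/-- The dyadic number `2 ^ (-n)`. -/
noncomputable def dyadic (n : ℕ) : ℝ≥0 := 2 ^ (-(n : ℝ))

/-- With `d = dyadic n`, cut at the height `L = d ^ (-θ)`, `θ < 1`. Points below `L` occur with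
probability at most `d ^ (1 - θ)`. Above `L` the mean of the sum is at most `C * d ^ (1 + θ (r -
r'))`, so it exceeds `d ^ q` with probability at most `C * d ^ c`. Both bounds are summable in `n`,
and Borel–Cantelli concludes. -/
theorem IsPoissonRandomMeasure.ae_eventually_lintegral_rpow_le
    (hN : IsPoissonRandomMeasure N quadrantLebesgue P) (t₀ : ℝ≥0) {r q : ℝ} (hr : 1 < r)
    (hq : q < r) :
    ∀ᵐ ω ∂P, ∀ᶠ n in atTop, N ω (Ioc t₀ (t₀ + dyadic n) ×ˢ Iio 1) = 0 ∧
      ∫⁻ p in Ioc t₀ (t₀ + dyadic n) ×ˢ Ici 1, ((p.2 ^ (-r) : ℝ≥0) : ℝ≥0∞) ∂N ω ≤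
        ((dyadic n ^ q : ℝ≥0) : ℝ≥0∞) := by
  -- In the limit `θ = 1`, `r' = 1` the exponent `c` below equals `r - q > 0`; `θ` and `r'` are
  -- taken close enough to `1` to keep it positive, with `r' > 1` for integrability.
  obtain ⟨θ, hθ, hθ1⟩ : ∃ θ, max 0 ((q - 1) / (r - 1)) < θ ∧ θ < 1 := by
    refine exists_between (max_lt one_pos ?_)
    rw [div_lt_one (by linarith)]; linarith
  have hθ0 : 0 < θ := (le_max_left _ _).trans_lt hθ
  have hθq : (q - 1) / θ < r - 1 := by
    have := (le_max_right _ _).trans_lt hθ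
    rw [div_lt_iff₀ (by linarith)] at this
    rw [div_lt_iff₀ hθ0]; linarith
  obtain ⟨r', hr'1, hr'⟩ : ∃ r', 1 < r' ∧ r' < min r (r - (q - 1) / θ) :=
    exists_between (lt_min hr (by linarith))
  have hr'r : r' < r := hr'.trans_le (min_le_left _ _)
  have hc : 0 < 1 - q + θ * (r - r') := by
    have h1 : r' < r - (q - 1) / θ := hr'.trans_le (min_le_right _ _)
    have h2 : (q - 1) / θ < r - r' := by linarith
    rw [div_lt_iff₀ hθ0] at h2
    linarith
  set c := 1 - q + θ * (r - r')
  set L : ℕ → ℝ≥0 := fun n => 2 ^ ((n : ℝ) * θ)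
  have hL1 : ∀ n, 1 ≤ L n := fun n => NNReal.one_le_rpow (by norm_num) (by positivity)
  have hpow : ∀ (a : ℝ) (n : ℕ), (2 : ℝ≥0) ^ (-((n : ℝ) * a)) = (2 ^ (-a)) ^ n := fun a n => by
    rw [← NNReal.rpow_natCast, ← NNReal.rpow_mul]; congr 1; ring
  have hsum : ∀ (C : ℝ≥0∞) (a : ℝ), C ≠ ∞ → 0 < a →
      ∑' n : ℕ, C * (((2 : ℝ≥0) ^ (-((n : ℝ) * a)) : ℝ≥0) : ℝ≥0∞) ≠ ∞ := by
    intro C a hC ha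
    simp_rw [hpow, ENNReal.coe_pow]
    rw [ENNReal.tsum_mul_left, ENNReal.tsum_geometric]
    refine ENNReal.mul_ne_top hC (ENNReal.inv_ne_top.2 (tsub_pos_iff_lt.2 ?_).ne')
    exact_mod_cast NNReal.rpow_lt_one_of_one_lt_of_neg (by norm_num) (by linarith)
  have hE : ∀ n, MeasurableSet (Ioc t₀ (t₀ + dyadic n) ×ˢ Iio (L n)) := fun n =>
    measurableSet_Ioc.prod measurableSet_Iio
  have hF : ∀ n, MeasurableSet (Ioc t₀ (t₀ + dyadic n) ×ˢ Ici (L n)) := fun n =>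
    measurableSet_Ioc.prod measurableSet_Ici
  have hfm : Measurable fun p : ℝ≥0 × ℝ≥0 => ((p.2 ^ (-r) : ℝ≥0) : ℝ≥0∞) :=
    (measurable_coe_rpow _).comp measurable_snd
  set C := ∫⁻ z in Ici 1, ((z ^ (-r') : ℝ≥0) : ℝ≥0∞) ∂nnrealLebesgue
  have hmass : ∀ n, quadrantLebesgue (Ioc t₀ (t₀ + dyadic n) ×ˢ Iio (L n)) =
      1 * (((2 : ℝ≥0) ^ (-((n : ℝ) * (1 - θ))) : ℝ≥0) : ℝ≥0∞) := by
    intro n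
    rw [quadrantLebesgue_prod, nnrealLebesgue_Iio, add_tsub_cancel_left, ← ENNReal.coe_mul, one_mul]
    simp only [dyadic, L]
    rw [← NNReal.rpow_add (by norm_num)]
    congr 2
    ring
  have hA : ∀ᵐ ω ∂P, ∀ᶠ n in atTop,
      ω ∉ {ω | N ω (Ioc t₀ (t₀ + dyadic n) ×ˢ Iio (L n)) ≠ 0} := by
    refine ae_eventually_notMem (ne_top_of_le_ne_top
      (hsum 1 (1 - θ) ENNReal.one_ne_top (by linarith)) (ENNReal.tsum_le_tsum fun n => ?_))
    rw [← hmass]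
    refine hN.measure_apply_ne_zero_le (hE n) ?_
    rw [hmass]; simp
  have hB : ∀ᵐ ω ∂P, ∀ᶠ n in atTop, ω ∉ {ω | ((dyadic n ^ q : ℝ≥0) : ℝ≥0∞) ≤
      ∫⁻ p in Ioc t₀ (t₀ + dyadic n) ×ˢ Ici (L n), ((p.2 ^ (-r) : ℝ≥0) : ℝ≥0∞) ∂N ω} := by
    refine ae_eventually_notMem (ne_top_of_le_ne_top
      (hsum C c (setLIntegral_rpow_lt_top hr'1).ne hc) (ENNReal.tsum_le_tsum fun n => ?_))
    have hmean := hN.lintegral_lintegral (hfm.indicator (hF n))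
    have hmeas := (Measure.measurable_lintegral (hfm.indicator (hF n))).comp hN.measurable_measure
    simp_rw [lintegral_indicator (hF n)] at hmean hmeas
    simp only [Function.comp_def] at hmean hmeas
    have hdy : ((dyadic n ^ q : ℝ≥0) : ℝ≥0∞) ≠ 0 := by
      simpa using (NNReal.rpow_pos (by simp only [dyadic]; exact NNReal.rpow_pos (by norm_num))).ne'
    refine (meas_ge_le_lintegral_div hmeas.aemeasurable hdy ENNReal.coe_ne_top).trans ?_
    rw [hmean, setLIntegral_quadrantLebesgue _ _ _ (measurable_coe_rpow _), add_tsub_cancel_left]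
    have hint : ∫⁻ z in Ici (L n), ((z ^ (-r) : ℝ≥0) : ℝ≥0∞) ∂nnrealLebesgue ≤
        ((L n ^ (-(r - r')) : ℝ≥0) : ℝ≥0∞) * C := by
      have h1 : ∫⁻ z in Ici (L n), ((z ^ (-r) : ℝ≥0) : ℝ≥0∞) ∂nnrealLebesgue ≤
          ∫⁻ z in Ici (L n), ((L n ^ (-(r - r')) : ℝ≥0) : ℝ≥0∞) * ((z ^ (-r') : ℝ≥0) : ℝ≥0∞)
            ∂nnrealLebesgue := by
        refine setLIntegral_mono ((measurable_coe_rpow _).const_mul _) fun z hz => ?_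
        rw [← ENNReal.coe_mul, ENNReal.coe_le_coe]
        have hz0 : 0 < z := one_pos.trans_le ((hL1 n).trans hz)
        rw [show -r = -(r - r') + -r' by ring, NNReal.rpow_add hz0.ne']
        gcongr ?_ * _
        refine NNReal.rpow_le_rpow_of_nonpos (one_pos.trans_le (hL1 n)) hz (by linarith)
      refine h1.trans ?_
      rw [lintegral_const_mul _ (measurable_coe_rpow _)]
      gcongr
      exact lintegral_mono_set (Ici_subset_Ici.2 (hL1 n))
    rw [ENNReal.div_le_iff hdy ENNReal.coe_ne_top]
    refine (mul_le_mul_right hint _).trans (le_of_eq ?_)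
    rw [← mul_assoc, ← ENNReal.coe_mul, mul_comm, mul_assoc, ← ENNReal.coe_mul]
    congr 2
    simp only [dyadic, L]
    rw [← NNReal.rpow_mul, ← NNReal.rpow_mul, ← NNReal.rpow_add (by norm_num),
      ← NNReal.rpow_add (by norm_num)]
    congr 1
    simp only [c]
    ring
  filter_upwards [hA, hB] with ω hA hB
  filter_upwards [hA, hB] with n hA hB
  have hA' : N ω (Ioc t₀ (t₀ + dyadic n) ×ˢ Iio (L n)) = 0 := by simpa using hA
  refine ⟨measure_mono_null (Set.prod_mono le_rfl (Iio_subset_Iio (hL1 n))) hA', ?_⟩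
  have hsub : Ioc t₀ (t₀ + dyadic n) ×ˢ Ici 1 ⊆
      (Ioc t₀ (t₀ + dyadic n) ×ˢ Iio (L n)) ∪ (Ioc t₀ (t₀ + dyadic n) ×ˢ Ici (L n)) := by
    rintro ⟨s, z⟩ ⟨hs, -⟩
    rcases lt_or_ge z (L n) with h | h
    · exact Or.inl ⟨hs, h⟩
    · exact Or.inr ⟨hs, h⟩
  refine (lintegral_mono_set hsub).trans ((lintegral_union_le _ _ _).trans ?_)
  rw [setLIntegral_measure_zero _ _ hA', zero_add]
  exact (not_le.1 hB).le

end

/-! ### Pathwise comparison of the solution with a stable path -/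

/-- Both powers lie below `z ^ (-a)`, so it is enough to bound their distances to it. The first
follows from `(1 + 1/z) ^ (-a) ≥ 1 - a/z`. For the second, `z ^ (-(ρ - a)) ≥ 1 - (ρ - a) log z`, and
the logarithm is absorbed by the gap between `r` and `s`. -/
theorem abs_jump_sub_le {z ρ a r s : ℝ} (hz : 1 ≤ z) (hr : 0 < r) (hrs : r < s) (hsa : s ≤ a)
    (haρ : a ≤ ρ) :
    |(1 + z) ^ (-a) - z ^ (-ρ)| ≤ ρ * z ^ (-(r + 1)) + (ρ - a) / (s - r) * z ^ (-r) := by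
  have hz0 : 0 < z := by linarith
  have ha : 0 < a := by linarith
  have h1 : (1 + z) ^ (-a) ≤ z ^ (-a) :=
    Real.rpow_le_rpow_of_nonpos hz0 (by linarith) (by linarith)
  have h2 : z ^ (-ρ) ≤ z ^ (-a) := Real.rpow_le_rpow_of_exponent_le hz (by linarith)
  have h3 : z ^ (-a) - (1 + z) ^ (-a) ≤ ρ * z ^ (-(r + 1)) := by
    have hexp : (1 + z) ^ (-a) = z ^ (-a) * (1 + 1 / z) ^ (-a) := by
      rw [← Real.mul_rpow hz0.le (by positivity)]
      congr 1
      field_simp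
      ring
    have hber : 1 - a / z ≤ (1 + 1 / z) ^ (-a) := by
      have hpos : 0 < 1 + 1 / z := by positivity
      rw [Real.rpow_def_of_pos hpos]
      have hlog : Real.log (1 + 1 / z) ≤ 1 / z := by
        have := Real.log_le_sub_one_of_pos hpos
        linarith
      have hexp1 := Real.add_one_le_exp (Real.log (1 + 1 / z) * -a)
      have hmul : a * Real.log (1 + 1 / z) ≤ a * (1 / z) := mul_le_mul_of_nonneg_left hlog ha.le
      have : a / z = a * (1 / z) := by ring
      linarith
    have hza : 0 < z ^ (-a) := Real.rpow_pos_of_pos hz0 _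
    calc z ^ (-a) - (1 + z) ^ (-a) ≤ z ^ (-a) - z ^ (-a) * (1 - a / z) := by
          rw [hexp]; gcongr
      _ = a * z ^ (-(a + 1)) := by
          rw [neg_add, ← sub_eq_add_neg, Real.rpow_sub_one hz0.ne']; field_simp; ring
      _ ≤ ρ * z ^ (-(r + 1)) := by
          have : z ^ (-(a + 1)) ≤ z ^ (-(r + 1)) :=
            Real.rpow_le_rpow_of_exponent_le hz (by linarith)
          have h0 : 0 ≤ z ^ (-(a + 1)) := Real.rpow_nonneg hz0.le _
          gcongr
          linarith
  have h4 : z ^ (-a) - z ^ (-ρ) ≤ (ρ - a) / (s - r) * z ^ (-r) := by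
    have hexp : z ^ (-ρ) = z ^ (-a) * z ^ (-(ρ - a)) := by
      rw [← Real.rpow_add hz0]; congr 1; ring
    have hlow : 1 - (ρ - a) * Real.log z ≤ z ^ (-(ρ - a)) := by
      rw [Real.rpow_def_of_pos hz0]
      have := Real.add_one_le_exp (Real.log z * -(ρ - a))
      linarith
    have hlog : Real.log z ≤ z ^ (s - r) / (s - r) :=
      Real.log_le_rpow_div hz0.le (by linarith)
    have hlog0 : 0 ≤ Real.log z := Real.log_nonneg hz
    have hza : 0 < z ^ (-a) := Real.rpow_pos_of_pos hz0 _
    have hsr : 0 < s - r := by linarith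
    have hρa : 0 ≤ ρ - a := by linarith
    calc z ^ (-a) - z ^ (-ρ) ≤ z ^ (-a) - z ^ (-a) * (1 - (ρ - a) * Real.log z) := by
          rw [hexp]; gcongr
      _ = (ρ - a) * (z ^ (-a) * Real.log z) := by ring
      _ ≤ (ρ - a) * (z ^ (-s) * (z ^ (s - r) / (s - r))) := by
          have : z ^ (-a) ≤ z ^ (-s) := Real.rpow_le_rpow_of_exponent_le hz (by linarith)
          gcongr
      _ = (ρ - a) / (s - r) * z ^ (-r) := by
          have : z ^ (-r) = z ^ (-s) * z ^ (s - r) := by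
            rw [← Real.rpow_add hz0]; congr 1; ring
          rw [this]; ring
  rw [abs_le]
  have h5 : 0 ≤ (ρ - a) / (s - r) * z ^ (-r) :=
    mul_nonneg (div_nonneg (by linarith) (by linarith)) (Real.rpow_nonneg hz0.le _)
  have h6 : 0 ≤ ρ * z ^ (-(r + 1)) := mul_nonneg (by linarith) (Real.rpow_nonneg hz0.le _)
  constructor <;> linarith

theorem dyadic_pos (n : ℕ) : 0 < dyadic n := NNReal.rpow_pos (by norm_num)

theorem dyadic_rpow (n : ℕ) (a : ℝ) : ((dyadic n : ℝ)) ^ a = ((2 : ℝ) ^ (-a)) ^ n := by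
  simp only [dyadic, NNReal.coe_rpow, NNReal.coe_ofNat]
  rw [← Real.rpow_mul (by norm_num), ← Real.rpow_natCast, ← Real.rpow_mul (by norm_num)]
  congr 1
  ring

theorem tendsto_dyadic_rpow {a : ℝ} (ha : 0 < a) :
    Tendsto (fun n => (dyadic n : ℝ) ^ a) atTop (𝓝 0) := by
  simp_rw [dyadic_rpow]
  refine tendsto_pow_atTop_nhds_zero_of_lt_one (by positivity) ?_
  exact Real.rpow_lt_one_of_one_lt_of_neg (by norm_num) (by linarith)

theorem tendsto_dyadic : Tendsto dyadic atTop (𝓝 0) := by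
  rw [← NNReal.tendsto_coe]
  simpa using tendsto_dyadic_rpow one_pos

theorem eventually_dyadic_rpow_le {C₁ C₂ a b c δ : ℝ} (ha : c < a) (hb : c < b) (hδ : 0 < δ) :
    ∀ᶠ n in atTop, C₁ * (dyadic n : ℝ) ^ a + C₂ * (dyadic n : ℝ) ^ b ≤
      δ * (dyadic n : ℝ) ^ c := by
  have h : Tendsto (fun n => C₁ * (dyadic n : ℝ) ^ (a - c) + C₂ * (dyadic n : ℝ) ^ (b - c))
      atTop (𝓝 0) := by
    have := ((tendsto_dyadic_rpow (sub_pos.2 ha)).const_mul C₁).add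
      ((tendsto_dyadic_rpow (sub_pos.2 hb)).const_mul C₂)
    simpa using this
  filter_upwards [h.eventually (Iic_mem_nhds hδ)] with n hn
  have hd : (0 : ℝ) < dyadic n := dyadic_pos n
  have hm := mul_le_mul_of_nonneg_right (mem_Iic.1 hn) (Real.rpow_nonneg hd.le c)
  rw [add_mul, mul_assoc, mul_assoc, ← Real.rpow_add hd, ← Real.rpow_add hd, sub_add_cancel,
    sub_add_cancel] at hm
  exact hm

section
variable {m : Measure (ℝ≥0 × ℝ≥0)} {γ : ℝ≥0 → ℝ} {x : CadlagPath ℝ≥0 ℝ≥0}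

theorem setLIntegral_Ioc_prod_add (f : ℝ≥0 × ℝ≥0 → ℝ≥0∞) (t₀ t : ℝ≥0) :
    ∫⁻ p in Ioc 0 (t₀ + t) ×ˢ univ, f p ∂m =
      ∫⁻ p in Ioc 0 t₀ ×ˢ univ, f p ∂m + ∫⁻ p in Ioc t₀ (t₀ + t) ×ˢ univ, f p ∂m := by
  rw [← lintegral_union (measurableSet_Ioc.prod MeasurableSet.univ), ← union_prod,
    Ioc_union_Ioc_eq_Ioc zero_le le_self_add]
  rw [Set.disjoint_prod]
  exact Or.inl (Ioc_disjoint_Ioc_of_le le_rfl)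

theorem monotone_of_jump_eq {f : ℝ≥0 × ℝ≥0 → ℝ≥0∞}
    (hx : ∀ t, (x t : ℝ≥0∞) = ∫⁻ p in Ioc 0 t ×ˢ univ, f p ∂m) :
    Monotone (x : ℝ≥0 → ℝ≥0) := by
  intro s t hst
  rw [← ENNReal.coe_le_coe, hx, hx]
  exact lintegral_mono_set (Set.prod_mono (Ioc_subset_Ioc_right hst) le_rfl)

theorem setLIntegral_univ_eq_Ici (f : ℝ≥0 × ℝ≥0 → ℝ≥0∞) {s t u : ℝ≥0} (htu : t ≤ u)
    (h0 : m (Ioc s u ×ˢ Iio 1) = 0) :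
    ∫⁻ p in Ioc s t ×ˢ univ, f p ∂m = ∫⁻ p in Ioc s t ×ˢ Ici 1, f p ∂m := by
  refine le_antisymm ?_ (lintegral_mono_set (Set.prod_mono le_rfl (subset_univ _)))
  have hsub : Ioc s t ×ˢ (univ : Set ℝ≥0) ⊆ (Ioc s u ×ˢ Iio 1) ∪ (Ioc s t ×ˢ Ici 1) := by
    rintro ⟨r, z⟩ ⟨hr, -⟩
    rcases lt_or_ge z 1 with h | h
    · exact Or.inl ⟨Ioc_subset_Ioc_right htu hr, h⟩
    · exact Or.inr ⟨hr, h⟩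
  refine (lintegral_mono_set hsub).trans ((lintegral_union_le _ _ _).trans ?_)
  rw [setLIntegral_measure_zero _ _ h0, zero_add]

theorem measurable_coe_rpow_snd (r : ℝ) :
    Measurable fun p : ℝ≥0 × ℝ≥0 => ((p.2 ^ r : ℝ≥0) : ℝ≥0∞) :=
  (measurable_coe_rpow r).comp measurable_snd

/-- The increments of a solution of the jump equation after time `t₀` are close to those of the
stable path driven by the same point measure. -/
theorem eventually_abs_sub_stable_le {ε : ℝ} (hε : 0 < ε) (hγ : ∀ y, γ y ∈ Icc ε (1 - ε))
    {K : ℝ≥0} (hK : LipschitzWith K γ) (hmono : StrictMono γ) (t₀ : ℝ≥0)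
    (hx : ∀ t, (x t : ℝ≥0∞) = ∫⁻ p in Ioc 0 t ×ˢ univ,
      (jumpSize (γ (Function.leftLim x p.1)) p.2 : ℝ≥0∞) ∂m)
    (hS : ∀ T : ℝ≥0, ∫⁻ p in Ioc 0 T ×ˢ univ,
      ((p.2 ^ (-1 / γ (x t₀)) : ℝ≥0) : ℝ≥0∞) ∂m < ∞)
    (hm : ∀ r q : ℚ, 1 < (r : ℝ) → (q : ℝ) < r → ∀ᶠ n in atTop,
      m (Ioc t₀ (t₀ + dyadic n) ×ˢ Iio 1) = 0 ∧
      ∫⁻ p in Ioc t₀ (t₀ + dyadic n) ×ˢ Ici 1, ((p.2 ^ (-(r : ℝ)) : ℝ≥0) : ℝ≥0∞) ∂m ≤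
        ((dyadic n ^ (q : ℝ) : ℝ≥0) : ℝ≥0∞)) {δ : ℝ} (hδ : 0 < δ) :
    ∀ᶠ n in atTop, ∀ t ≤ dyadic n,
      |((x (t₀ + t) : ℝ) - x t₀) - (∫⁻ p in Ioc t₀ (t₀ + t) ×ˢ univ,
        ((p.2 ^ (-1 / γ (x t₀)) : ℝ≥0) : ℝ≥0∞) ∂m).toNNReal| ≤
        δ * (dyadic n : ℝ) ^ (1 / γ (x t₀)) := by
  have hxm := monotone_of_jump_eq hx
  set β := γ (x t₀) with hβ
  have hβε : ε ≤ β := (hγ _).1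
  have hβ0 : 0 < β := hε.trans_le hβε
  have hβ1 : β < 1 := (hγ _).2.trans_lt (by linarith)
  set ρ := 1 / β with hρ
  have hρ1 : 1 < ρ := by rw [hρ, one_lt_div hβ0]; exact hβ1
  -- The lower bounds on `r` leave room for `q < r` with `2q > ρ` and for `q' < r + 1` with `q' >
  -- ρ`: these make the two errors `d ^ (2q)` and `d ^ q'` negligible against `d ^ ρ`.
  obtain ⟨r, hr, hrρ⟩ := exists_rat_btwn (show max 1 (max (ρ / 2) (ρ - 1)) < ρ from
    max_lt hρ1 (max_lt (by linarith) (by linarith)))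
  have hr1 : (1 : ℝ) < r := (le_max_left _ _).trans_lt hr
  have hr2 : ρ / 2 < r := ((le_max_left _ _).trans (le_max_right _ _)).trans_lt hr
  have hr3 : ρ < r + 1 := by
    have : ρ - 1 < r := ((le_max_right _ _).trans (le_max_right _ _)).trans_lt hr
    linarith
  obtain ⟨q, hq, hqr⟩ := exists_rat_btwn hr2
  obtain ⟨q', hq', hqr'⟩ := exists_rat_btwn hr3
  obtain ⟨s, hrs, hsρ⟩ := exists_between hrρ
  have hlimγ : ∀ᶠ n in atTop, s < 1 / γ (x (t₀ + dyadic n)) := by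
    have h1 : Tendsto (fun n => t₀ + dyadic n) atTop (𝓝[Ici t₀] t₀) := by
      refine tendsto_nhdsWithin_iff.2 ⟨?_, Eventually.of_forall fun n => mem_Ici.2 le_self_add⟩
      simpa using tendsto_dyadic.const_add t₀
    have h2 := (tendsto_const_nhds (x := (1 : ℝ))).div
      ((hK.continuous.tendsto _).comp ((x.2 t₀).1.tendsto.comp h1)) hβ0.ne'
    exact h2.eventually (Ioi_mem_nhds hsρ)
  -- `K / ε ^ 2` is a Lipschitz constant of `1/γ`; the factor `1 / (s - r)` comes from absorbing the
  -- logarithm.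
  set C : ℝ := K / ε ^ 2 / (s - r)
  have hsr : 0 < s - r := by linarith
  have hC : 0 ≤ C := by positivity
  filter_upwards [hm r q hr1 hqr, hm (r + 1) q' (by push_cast; linarith) (by push_cast; linarith),
    hlimγ, eventually_dyadic_rpow_le (C₁ := ρ) (C₂ := C) (a := q') (b := 2 * q) (c := ρ) hq'
      (by linarith) hδ] with n hn1 hn2 hn3 hn4 t ht
  obtain ⟨hn0, hn1⟩ := hn1
  replace hn2 := hn2.2
  set d := dyadic n
  have hd : 0 < d := dyadic_pos n
  -- the left limits stay between the values at the end points
  have hleft : ∀ u ∈ Ioc t₀ (t₀ + d), β ≤ γ (Function.leftLim x u) ∧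
      γ (Function.leftLim x u) - β ≤ K * (x (t₀ + d) - x t₀) ∧
      s ≤ 1 / γ (Function.leftLim x u) ∧ 1 / γ (Function.leftLim x u) ≤ ρ := by
    intro u hu
    have h1 : x t₀ ≤ Function.leftLim x u := hxm.le_leftLim hu.1
    have h2 : Function.leftLim x u ≤ x (t₀ + d) := hxm.leftLim_le hu.2
    have h3 : β ≤ γ (Function.leftLim x u) := hmono.monotone h1
    have h4 : γ (Function.leftLim x u) ≤ γ (x (t₀ + d)) := hmono.monotone h2
    have h5 : 0 < γ (Function.leftLim x u) := hβ0.trans_le h3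
    refine ⟨h3, ?_, hn3.le.trans (one_div_le_one_div_of_le h5 h4), one_div_le_one_div_of_le hβ0 h3⟩
    have h6 := hK.dist_le_mul (x (t₀ + d)) (x t₀)
    rw [Real.dist_eq, NNReal.dist_eq] at h6
    have h7 : (x t₀ : ℝ) ≤ x (t₀ + d) := NNReal.coe_le_coe.2 (h1.trans h2)
    rw [abs_of_nonneg (sub_nonneg.2 h7)] at h6
    have := le_abs_self (γ (x (t₀ + d)) - γ (x t₀))
    linarith
  have hjump : ∀ p ∈ Ioc t₀ (t₀ + d) ×ˢ Ici (1 : ℝ≥0),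
      jumpSize (γ (Function.leftLim x p.1)) p.2 ≤ p.2 ^ (-(r : ℝ)) := by
    rintro ⟨u, z⟩ ⟨hu, hz⟩
    obtain ⟨-, -, h3, -⟩ := hleft u hu
    have hz1 : (1 : ℝ≥0) ≤ z := hz
    simp only [jumpSize]
    rw [neg_div]
    refine (NNReal.rpow_le_rpow_of_nonpos (one_pos.trans_le hz1) (le_add_of_nonneg_left zero_le)
      (by linarith)).trans
      (NNReal.rpow_le_rpow_of_exponent_le hz1 (by linarith))
  have hinc : ∀ t, (x (t₀ + t) : ℝ≥0∞) = x t₀ + ∫⁻ p in Ioc t₀ (t₀ + t) ×ˢ univ,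
      (jumpSize (γ (Function.leftLim x p.1)) p.2 : ℝ≥0∞) ∂m := fun t => by
    rw [hx, hx, setLIntegral_Ioc_prod_add]
  -- A crude first bound on the increment: every jump in the window is at most `z ^ (-r)`. It
  -- controls how far the exponent moves.
  have hΔ : (x (t₀ + d) : ℝ) - x t₀ ≤ (d : ℝ) ^ (q : ℝ) := by
    have h1 : (x (t₀ + d) : ℝ≥0∞) ≤ x t₀ + ((d ^ (q : ℝ) : ℝ≥0) : ℝ≥0∞) := by
      rw [hinc]
      gcongr
      rw [setLIntegral_univ_eq_Ici _ le_rfl hn0]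
      refine (setLIntegral_mono (measurable_coe_rpow_snd _) fun p hp =>
        ENNReal.coe_le_coe.2 (hjump p hp)).trans hn1
    rw [← ENNReal.coe_add, ENNReal.coe_le_coe, ← NNReal.coe_le_coe] at h1
    push_cast at h1
    linarith
  set B₂ : ℝ≥0 := Real.toNNReal (C * (d : ℝ) ^ (q : ℝ))
  set B₁ : ℝ≥0 := Real.toNNReal ρ
  set bd : ℝ≥0 × ℝ≥0 → ℝ≥0∞ := fun p => (B₁ : ℝ≥0∞) * ((p.2 ^ (-((r + 1 : ℚ) : ℝ)) : ℝ≥0) : ℝ≥0∞) +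
    (B₂ : ℝ≥0∞) * ((p.2 ^ (-(r : ℝ)) : ℝ≥0) : ℝ≥0∞)
  have hbdm : Measurable bd :=
    ((measurable_coe_rpow_snd _).const_mul _).add
      ((measurable_coe_rpow_snd _).const_mul _)
  have hpt : ∀ p ∈ Ioc t₀ (t₀ + d) ×ˢ Ici (1 : ℝ≥0),
      |(jumpSize (γ (Function.leftLim x p.1)) p.2 : ℝ) - ((p.2 ^ (-1 / β) : ℝ≥0) : ℝ)| ≤
        ((B₁ * p.2 ^ (-((r + 1 : ℚ) : ℝ)) + B₂ * p.2 ^ (-(r : ℝ)) : ℝ≥0) : ℝ) := by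
    rintro ⟨u, z⟩ ⟨hu, hz⟩
    obtain ⟨h1, h2, h3, h4⟩ := hleft u hu
    have hz1 : (1 : ℝ) ≤ z := NNReal.one_le_coe.2 hz
    have key := abs_jump_sub_le hz1 (by linarith) hrs h3 h4
    simp only [jumpSize, NNReal.coe_rpow, NNReal.coe_add, NNReal.coe_mul, NNReal.coe_one]
    rw [neg_div, neg_div]
    refine key.trans ?_
    rw [Real.coe_toNNReal _ (by linarith), Real.coe_toNNReal _ (by positivity)]
    push_cast
    have hz0 : (0 : ℝ) < (z : ℝ) ^ (-(r : ℝ)) := Real.rpow_pos_of_pos (by linarith) _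
    have hdiff : (ρ - 1 / γ (Function.leftLim x u)) / (s - r) ≤ C * (d : ℝ) ^ (q : ℝ) := by
      rw [div_mul_eq_mul_div]
      refine div_le_div_of_nonneg_right ?_ hsr.le
      have hγ0 : 0 < γ (Function.leftLim x u) := hβ0.trans_le h1
      have hγε : ε ≤ γ (Function.leftLim x u) := (hγ _).1
      rw [hρ, div_sub_div _ _ hβ0.ne' hγ0.ne', one_mul, mul_one, div_mul_eq_mul_div]
      have hK0 : (0 : ℝ) ≤ K := K.2
      refine div_le_div₀ (by positivity) ?_ (by positivity) ?_
      · exact h2.trans (mul_le_mul_of_nonneg_left hΔ hK0)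
      · rw [sq]; exact mul_le_mul hβε hγε hε.le hβ0.le
    gcongr
  have hB : ∀ t ≤ d, ∫⁻ p in Ioc t₀ (t₀ + t) ×ˢ Ici 1, bd p ∂m ≤
      ENNReal.ofReal (δ * (d : ℝ) ^ ρ) := by
    intro t ht
    have hsub : Ioc t₀ (t₀ + t) ×ˢ Ici (1 : ℝ≥0) ⊆ Ioc t₀ (t₀ + d) ×ˢ Ici 1 :=
      Set.prod_mono (Ioc_subset_Ioc_right (by gcongr)) le_rfl
    refine (lintegral_mono_set hsub).trans ?_
    simp only [bd]
    rw [lintegral_add_left ((measurable_coe_rpow_snd _).const_mul _),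
      lintegral_const_mul _ (measurable_coe_rpow_snd _),
      lintegral_const_mul _ (measurable_coe_rpow_snd _)]
    refine (add_le_add (mul_le_mul_right hn2 _) (mul_le_mul_right hn1 _)).trans ?_
    rw [← ENNReal.coe_mul, ← ENNReal.coe_mul, ← ENNReal.coe_add, ← ENNReal.ofReal_coe_nnreal]
    refine ENNReal.ofReal_le_ofReal ?_
    push_cast
    rw [Real.coe_toNNReal _ (by linarith), Real.coe_toNNReal _ (by positivity)]
    refine le_trans (le_of_eq ?_) hn4
    have hd' : (0 : ℝ) < d := hd
    rw [two_mul, Real.rpow_add hd']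
    ring
  set F := ∫⁻ p in Ioc t₀ (t₀ + t) ×ˢ univ, ((p.2 ^ (-1 / β) : ℝ≥0) : ℝ≥0∞) ∂m
  set J := ∫⁻ p in Ioc t₀ (t₀ + t) ×ˢ univ,
    (jumpSize (γ (Function.leftLim x p.1)) p.2 : ℝ≥0∞) ∂m
  have hsub : Ioc t₀ (t₀ + t) ×ˢ Ici (1 : ℝ≥0) ⊆ Ioc t₀ (t₀ + d) ×ˢ Ici 1 :=
    Set.prod_mono (Ioc_subset_Ioc_right (by gcongr)) le_rfl
  have hstrip : MeasurableSet (Ioc t₀ (t₀ + t) ×ˢ Ici (1 : ℝ≥0)) :=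
    measurableSet_Ioc.prod measurableSet_Ici
  have hle : t₀ + t ≤ t₀ + d := by gcongr
  -- The two one-sided bounds are proved in `ℝ≥0∞` and need measurability of `bd` only, not of the
  -- integrand with the left limits.
  have hJF : J ≤ F + ENNReal.ofReal (δ * (d : ℝ) ^ ρ) := by
    simp only [J, F]
    rw [setLIntegral_univ_eq_Ici _ hle hn0, setLIntegral_univ_eq_Ici _ hle hn0]
    refine le_trans ?_ (add_le_add le_rfl (hB t ht))
    rw [← lintegral_add_right _ hbdm]
    refine setLIntegral_mono' hstrip fun p hp => ?_
    simp only [bd]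
    rw [← ENNReal.coe_mul, ← ENNReal.coe_mul, ← ENNReal.coe_add, ← ENNReal.coe_add,
      ENNReal.coe_le_coe, ← NNReal.coe_le_coe, NNReal.coe_add]
    have := (abs_le.1 (hpt p (hsub hp))).2
    linarith
  have hFJ : F ≤ J + ENNReal.ofReal (δ * (d : ℝ) ^ ρ) := by
    simp only [J, F]
    rw [setLIntegral_univ_eq_Ici _ hle hn0, setLIntegral_univ_eq_Ici _ hle hn0]
    refine le_trans ?_ (add_le_add le_rfl (hB t ht))
    rw [← lintegral_add_right _ hbdm]
    refine setLIntegral_mono' hstrip fun p hp => ?_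
    simp only [bd]
    rw [← ENNReal.coe_mul, ← ENNReal.coe_mul, ← ENNReal.coe_add, ← ENNReal.coe_add,
      ENNReal.coe_le_coe, ← NNReal.coe_le_coe, NNReal.coe_add]
    have := (abs_le.1 (hpt p (hsub hp))).1
    linarith
  have hFfin : F ≠ ∞ := ((lintegral_mono_set (Set.prod_mono
    (Ioc_subset_Ioc_left zero_le) le_rfl)).trans_lt (hS (t₀ + t))).ne
  have hJeq : J = ((x (t₀ + t) - x t₀ : ℝ≥0) : ℝ≥0∞) := by
    have := hinc t
    rw [ENNReal.coe_sub, this, ENNReal.add_sub_cancel_left ENNReal.coe_ne_top]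
  have hx0 : x t₀ ≤ x (t₀ + t) := hxm le_self_add
  obtain ⟨f, hf⟩ : ∃ f : ℝ≥0, F = f := ⟨_, (ENNReal.coe_toNNReal hFfin).symm⟩
  rw [hf, ENNReal.toNNReal_coe]
  have hδd : 0 ≤ δ * (d : ℝ) ^ ρ := by positivity
  rw [hJeq, hf, ENNReal.ofReal, ← ENNReal.coe_add, ENNReal.coe_le_coe, ← NNReal.coe_le_coe,
    NNReal.coe_add, NNReal.coe_sub hx0, Real.coe_toNNReal _ hδd] at hJF hFJ
  rw [abs_le]
  constructor <;> linarith

end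

/-! ### The stable path driven by a random measure -/

/-- The sum of the jumps `z ^ (-1/b)` of the points with time in `(t₀, t₀ + t]`. -/
noncomputable def stableSum (b : ℝ) (t₀ t : ℝ≥0) (m : Measure (ℝ≥0 × ℝ≥0)) : ℝ≥0∞ :=
  ∫⁻ p in Ioc t₀ (t₀ + t) ×ˢ univ, ((p.2 ^ (-1 / b) : ℝ≥0) : ℝ≥0∞) ∂m

/-- The stable path after time `t₀`. -/
noncomputable def stablePath (b : ℝ) (t₀ : ℝ≥0) (m : Measure (ℝ≥0 × ℝ≥0)) : CadlagPath ℝ≥0 ℝ≥0 :=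
  CadlagPath.ofRat fun q => (stableSum b t₀ (q : ℝ≥0) m).toNNReal

theorem stableSum_mono (b : ℝ) (t₀ : ℝ≥0) (m : Measure (ℝ≥0 × ℝ≥0)) :
    Monotone fun t => stableSum b t₀ t m := fun _ _ h =>
  lintegral_mono_set (Set.prod_mono (Ioc_subset_Ioc_right (by gcongr)) subset_rfl)

theorem stableSum_zero (b : ℝ) (t₀ : ℝ≥0) (m : Measure (ℝ≥0 × ℝ≥0)) : stableSum b t₀ 0 m = 0 := by
  simp [stableSum]

theorem stableSum_restrict (b : ℝ) (t₀ t : ℝ≥0) (m : Measure (ℝ≥0 × ℝ≥0)) :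
    stableSum b t₀ t (m.restrict (Ioi t₀ ×ˢ univ)) = stableSum b t₀ t m := by
  rw [stableSum, Measure.restrict_restrict_of_subset
    (Set.prod_mono Ioc_subset_Ioi_self subset_rfl), stableSum]

theorem stablePath_restrict (b : ℝ) (t₀ : ℝ≥0) (m : Measure (ℝ≥0 × ℝ≥0)) :
    stablePath b t₀ (m.restrict (Ioi t₀ ×ˢ univ)) = stablePath b t₀ m := by
  simp only [stablePath, stableSum_restrict]

theorem tendsto_stableSum {b : ℝ} {t₀ : ℝ≥0} {m : Measure (ℝ≥0 × ℝ≥0)}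
    (h : ∀ t, stableSum b t₀ t m ≠ ∞) (t : ℝ≥0) :
    Tendsto (fun s => stableSum b t₀ s m) (𝓝[>] t) (𝓝 (stableSum b t₀ t m)) := by
  set ν := m.withDensity fun p => ((p.2 ^ (-1 / b) : ℝ≥0) : ℝ≥0∞)
  have hS : ∀ s, stableSum b t₀ s m = ν (Ioc t₀ (t₀ + s) ×ˢ univ) := fun s =>
    (withDensity_apply _ (measurableSet_Ioc.prod MeasurableSet.univ)).symm
  have hI : ⋂ r > t, Ioc t₀ (t₀ + r) ×ˢ (univ : Set ℝ≥0) = Ioc t₀ (t₀ + t) ×ˢ univ := by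
    ext p
    simp only [gt_iff_lt, mem_iInter, mem_prod, mem_Ioc, mem_univ, and_true]
    constructor
    · intro hp
      refine ⟨(hp (t + 1) (by simp)).1, le_of_forall_gt_imp_ge_of_dense fun c hc => ?_⟩
      have h0 : t₀ ≤ c := le_self_add.trans hc.le
      have := (hp (c - t₀) (lt_tsub_iff_left.2 hc)).2
      rwa [add_tsub_cancel_of_le h0] at this
    · exact fun hp r hr => ⟨hp.1, hp.2.trans (by gcongr)⟩
  simp_rw [hS]
  rw [← hI]
  exact tendsto_measure_biInter_gt (s := fun r => Ioc t₀ (t₀ + r) ×ˢ (univ : Set ℝ≥0))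
    (fun r _ => (measurableSet_Ioc.prod MeasurableSet.univ).nullMeasurableSet)
    (fun i j _ hij => Set.prod_mono (Ioc_subset_Ioc_right (by gcongr)) subset_rfl)
    ⟨t + 1, by simp, by rw [← hS]; exact h _⟩

/-- Once finite, the sum is monotone and right-continuous in time, so regularizing its rational
values changes nothing. -/
theorem stablePath_apply {b : ℝ} {t₀ : ℝ≥0} {m : Measure (ℝ≥0 × ℝ≥0)}
    (h : ∀ t, stableSum b t₀ t m ≠ ∞) (t : ℝ≥0) :
    (stablePath b t₀ m).1 t = (stableSum b t₀ t m).toNNReal := by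
  refine rightReg_eq (x := fun t : ℝ≥0 => (stableSum b t₀ t m).toNNReal)
    (fun s u hsu => ENNReal.toNNReal_mono (h u) (stableSum_mono b t₀ m hsu)) ?_
  rw [← continuousWithinAt_Ioi_iff_Ici]
  exact (ENNReal.tendsto_toNNReal (h t)).comp (tendsto_stableSum h t)

theorem stablePath_monotone (b : ℝ) (t₀ : ℝ≥0) (m : Measure (ℝ≥0 × ℝ≥0)) :
    Monotone (stablePath b t₀ m).1 :=
  rightReg_mono _

/-- Joint measurability in the exponent is needed because the exponent `γ (M t₀)` is random. -/
theorem measurable_stablePath {Ω : Type*} [MeasurableSpace Ω] (η : Kernel Ω (ℝ≥0 × ℝ≥0))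
    [IsSFiniteKernel η] (t₀ : ℝ≥0) :
    Measurable fun p : ℝ × Ω => stablePath p.1 t₀ (η p.2) := by
  refine CadlagPath.measurable_ofRat.comp (measurable_pi_lambda _ fun q => ?_)
  refine Measurable.ennreal_toNNReal ?_
  have hf : Measurable (Function.uncurry fun (p : ℝ × Ω) (x : ℝ≥0 × ℝ≥0) =>
      ((x.2 ^ (-1 / p.1) : ℝ≥0) : ℝ≥0∞)) := by
    simp only [Function.uncurry_def]
    exact (measurable_snd.snd.pow (measurable_const.div measurable_fst.fst)).coe_nnreal_ennreal
  exact Measurable.setLIntegral_kernel_prod_right (κ := Kernel.prodMkLeft ℝ η) hf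
    (measurableSet_Ioc.prod MeasurableSet.univ)

theorem measurable_stablePath_comp {Ω : Type*} [MeasurableSpace Ω]
    {N : Ω → Measure (ℝ≥0 × ℝ≥0)} (hN : Measurable N) (b : ℝ) (t₀ : ℝ≥0) :
    Measurable fun ω => stablePath b t₀ (N ω) := by
  refine CadlagPath.measurable_ofRat.comp (measurable_pi_lambda _ fun q => ?_)
  refine Measurable.ennreal_toNNReal ?_
  simp only [stableSum]
  simp_rw [← lintegral_indicator
    (measurableSet_Ioc.prod (MeasurableSet.univ (α := ℝ≥0)) : MeasurableSet (Ioc t₀ (t₀ + (q : ℝ≥0)) ×ˢ univ))]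
  exact (Measure.measurable_lintegral ((measurable_coe_rpow_snd _).indicator
    (measurableSet_Ioc.prod MeasurableSet.univ))).comp hN

theorem stableSum_ne_top_of_forall {b : ℝ} {m : Measure (ℝ≥0 × ℝ≥0)}
    (h : ∀ T : ℝ≥0, ∫⁻ p in Ioc 0 T ×ˢ univ, ((p.2 ^ (-1 / b) : ℝ≥0) : ℝ≥0∞) ∂m < ∞)
    (t₀ t : ℝ≥0) : stableSum b t₀ t m ≠ ∞ :=
  ((lintegral_mono_set (Set.prod_mono (Ioc_subset_Ioc_left zero_le) subset_rfl)).trans_lt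
    (h (t₀ + t))).ne

/-! ### Laws of càdlàg subordinators -/

theorem CadlagPath.exists_countable_monotone : ∃ s : Set I, s.Countable ∧
    ∀ x : CadlagPath I ℝ, Monotone x.1 ↔ ∀ p ∈ s, ∀ q ∈ s, p ≤ q → x p ≤ x q := by
  obtain ⟨s, hsc, hsd⟩ := TopologicalSpace.exists_countable_dense I
  have hne : ∀ t : I, (𝓝[Ici t ∩ insert 1 s] t).NeBot := fun t => by
    rw [← mem_closure_iff_nhdsWithin_neBot]
    rcases eq_or_ne t 1 with rfl | ht
    · exact subset_closure ⟨self_mem_Ici, mem_insert _ _⟩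
    have ht1 : t < 1 := lt_of_le_of_ne unitInterval.le_one' ht
    have h3 : closure (Ioi t) = Ici t := closure_Ioi' ⟨1, ht1⟩
    have h2 : t ∈ closure (Ioi t) := h3 ▸ self_mem_Ici
    exact closure_mono (inter_subset_inter Ioi_subset_Ici_self (subset_insert _ _))
      (closure_minimal (hsd.open_subset_closure_inter (isOpen_Ioi (a := t))) isClosed_closure h2)
  refine ⟨insert 1 s, hsc.insert 1, fun x => ⟨fun h p _ q _ hpq => h hpq, fun h => ?_⟩⟩
  have hlim : ∀ t, Tendsto x.1 (𝓝[Ici t ∩ insert 1 s] t) (𝓝 (x t)) := fun t =>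
    (x.2 t).1.tendsto.mono_left (nhdsWithin_mono _ inter_subset_left)
  have h1 : ∀ r ∈ insert 1 s, ∀ u, r ≤ u → x r ≤ x u := fun r hr u hru => by
    have := hne u
    refine ge_of_tendsto (hlim u) ?_
    filter_upwards [self_mem_nhdsWithin] with v hv using h r hr v hv.2 (hru.trans hv.1)
  intro t u htu
  rcases htu.eq_or_lt with rfl | htu
  · rfl
  have := hne t
  refine le_of_tendsto (hlim t) ?_
  filter_upwards [self_mem_nhdsWithin, mem_nhdsWithin_of_mem_nhds (Iio_mem_nhds htu)] with v hv hvu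
  exact h1 v hv.2 u (le_of_lt hvu)

theorem CadlagPath.measurableSet_monotone :
    MeasurableSet {x : CadlagPath I ℝ | Monotone x.1} := by
  obtain ⟨s, hs, h⟩ := CadlagPath.exists_countable_monotone
  simp_rw [h, ofPred_forall]
  exact MeasurableSet.biInter hs fun p _ => MeasurableSet.biInter hs fun q _ =>
    MeasurableSet.iInter fun _ =>
      measurableSet_le (CadlagPath.measurable_eval p) (CadlagPath.measurable_eval q)

theorem IsSubordinator.map {Ω : Type*} [MeasurableSpace Ω] {P : Measure Ω} [IsProbabilityMeasure P]
    {ν : Measure ℝ} {Y : Ω → CadlagPath I ℝ} (hY : Measurable Y)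
    (h : IsSubordinator ν (fun t ω => Y ω t) P) : IsSubordinatorLaw ν (P.map Y) where
  left := Measure.isProbabilityMeasure_map hY.aemeasurable
  right :=
    { levy_pos := h.levy_pos
      levy_fin := h.levy_fin
      zero := (ae_map_iff hY.aemeasurable
        ((CadlagPath.measurable_eval 0) (measurableSet_singleton 0))).2 h.zero
      mono := (ae_map_iff hY.aemeasurable CadlagPath.measurableSet_monotone).2 h.mono
      indep := fun n t ht => by
        have := Measure.isProbabilityMeasure_map (μ := P) hY.aemeasurable
        have hm : ∀ i : Fin n, Measurable fun x : CadlagPath I ℝ =>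
            x (t i.succ) - x (t i.castSucc) := fun i =>
          (CadlagPath.measurable_eval _).sub (CadlagPath.measurable_eval _)
        have h1 : iIndepFun (fun i : Fin n => (fun x : CadlagPath I ℝ =>
            x (t i.succ) - x (t i.castSucc)) ∘ Y) P := h.indep n t ht
        rw [iIndepFun_iff_map_fun_eq_pi_map fun i => ((hm i).comp hY).aemeasurable] at h1
        rw [iIndepFun_iff_map_fun_eq_pi_map fun i => (hm i).aemeasurable,
          Measure.map_map (measurable_pi_lambda _ hm) hY]
        simp_rw [Measure.map_map (hm _) hY]
        exact h1
      laplace := fun s t hst r hr => by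
        rw [integral_map hY.aemeasurable]
        · exact h.laplace s t hst r hr
        · exact (Real.measurable_exp.comp (((CadlagPath.measurable_eval t).sub
            (CadlagPath.measurable_eval s)).const_mul (-r))).aestronglyMeasurable }

/-! ### The stable Laplace exponent -/

section
variable {b : ℝ}

theorem stableLevyMeasure_Iic (b : ℝ) : stableLevyMeasure b (Iic 0) = 0 := by
  refine withDensity_absolutelyContinuous _ _ ?_
  rw [Measure.restrict_apply measurableSet_Iic, Iic_inter_Ioi, Ioc_self, measure_empty]

theorem lintegral_min_stableLevyMeasure_lt_top (hb : b ∈ Ioo (0 : ℝ) 1) :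
    ∫⁻ u, ENNReal.ofReal (min 1 u) ∂stableLevyMeasure b < ∞ := by
  have hm : Measurable fun u : ℝ => ENNReal.ofReal (b * u ^ (-1 - b)) := by fun_prop
  have hm2 : Measurable fun u : ℝ => ENNReal.ofReal (min 1 u) := by fun_prop
  rw [stableLevyMeasure, lintegral_withDensity_eq_lintegral_mul _ hm hm2,
    ← Ioc_union_Ioi_eq_Ioi (zero_le_one' ℝ)]
  refine (lintegral_union_le _ _ _).trans_lt (ENNReal.add_lt_top.2 ⟨?_, ?_⟩)
  · have hi : IntegrableOn (fun u : ℝ => b * u ^ (-b)) (Ioc 0 1) :=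
      ((intervalIntegrable_iff_integrableOn_Ioc_of_le zero_le_one).1
        (intervalIntegral.intervalIntegrable_rpow' (by linarith [hb.2]))).const_mul b
    refine lt_of_le_of_lt (setLIntegral_mono' measurableSet_Ioc fun u hu => ?_) hi.lintegral_lt_top
    rw [Pi.mul_apply, ← ENNReal.ofReal_mul (mul_nonneg hb.1.le (Real.rpow_nonneg hu.1.le _))]
    refine ENNReal.ofReal_le_ofReal (le_of_eq ?_)
    rw [min_eq_right hu.2, mul_assoc, ← Real.rpow_add_one hu.1.ne']
    congr 2; ring
  · have hi : IntegrableOn (fun u : ℝ => b * u ^ (-1 - b)) (Ioi 1) :=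
      (integrableOn_Ioi_rpow_of_lt (by linarith [hb.1]) one_pos).const_mul b
    refine lt_of_le_of_lt (setLIntegral_mono' measurableSet_Ioi fun u hu => ?_) hi.lintegral_lt_top
    rw [Pi.mul_apply, min_eq_left (le_of_lt hu), ENNReal.ofReal_one, mul_one]

/-- The substitution `z = u ^ (-b)`: the stable Lévy measure is the image of Lebesgue measure on
`(0,∞)` under `z ↦ z ^ (-1/b)`. -/
theorem integral_stableLevyMeasure (hb : 0 < b) (r : ℝ) :
    ∫ u, (1 - Real.exp (-r * u)) ∂stableLevyMeasure b =
      ∫ z in Ioi 0, (1 - Real.exp (-r * (z : ℝ) ^ (-1 / b))) := by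
  have hm : Measurable fun u : ℝ => ENNReal.ofReal (b * u ^ (-1 - b)) := by fun_prop
  rw [stableLevyMeasure, integral_withDensity_eq_integral_toReal_smul hm
    (Eventually.of_forall fun _ => ENNReal.ofReal_lt_top),
    ← integral_comp_rpow_Ioi (fun z : ℝ => 1 - Real.exp (-r * z ^ (-1 / b))) (neg_ne_zero.2 hb.ne')]
  refine setIntegral_congr_fun measurableSet_Ioi fun u hu => ?_
  have hu : 0 < u := hu
  have h1 : (u ^ (-b)) ^ (-1 / b) = u := by
    rw [← Real.rpow_mul hu.le]
    have : -b * (-1 / b) = 1 := by field_simp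
    rw [this, Real.rpow_one]
  simp only [h1, abs_neg, abs_of_pos hb]
  rw [ENNReal.toReal_ofReal (mul_nonneg hb.le (Real.rpow_nonneg hu.le _))]
  congr 3; ring

/-- Self-similarity, from the substitution `z ↦ α z`: slowing time by `α` and dividing space by `α ^
(1/b)` leaves the Laplace exponent unchanged. -/
theorem mul_integral_stable (hb : 0 < b) {α : ℝ} (hα : 0 < α) (r : ℝ) :
    α * ∫ z in Ioi 0, (1 - Real.exp (-(r / α ^ (1 / b)) * (z : ℝ) ^ (-1 / b))) =
      ∫ u, (1 - Real.exp (-r * u)) ∂stableLevyMeasure b := by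
  have h := integral_comp_mul_left_Ioi' (fun z : ℝ => 1 - Real.exp (-r * z ^ (-1 / b))) 0 hα
  rw [mul_zero, smul_eq_mul] at h
  rw [integral_stableLevyMeasure hb, ← h]
  congr 1
  refine setIntegral_congr_fun measurableSet_Ioi fun z hz => ?_
  have hz : 0 < z := hz
  simp only [Real.mul_rpow hα.le hz.le]
  have hαb : α ^ (-1 / b) = (α ^ (1 / b))⁻¹ := by rw [neg_div, Real.rpow_neg hα.le]
  rw [hαb]
  congr 2
  ring

theorem lintegral_stable_ne_top (hb : b ∈ Ioo (0 : ℝ) 1) (c : ℝ≥0) :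
    ∫⁻ z : ℝ≥0, ENNReal.ofReal (1 - Real.exp (-(c * (z : ℝ) ^ (-1 / b)))) ∂nnrealLebesgue ≠ ∞ := by
  rw [← setLIntegral_univ, ← Iio_union_Ici (a := (1 : ℝ≥0))]
  refine ((lintegral_union_le _ _ _).trans_lt (ENNReal.add_lt_top.2 ⟨?_, ?_⟩)).ne
  · refine lt_of_le_of_lt (lintegral_mono fun z => (?_ : _ ≤ (1 : ℝ≥0∞))) ?_
    · exact ENNReal.ofReal_le_one.2 (by linarith [Real.exp_pos (-(c * (z : ℝ) ^ (-1 / b)))])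
    · rw [lintegral_const, one_mul, Measure.restrict_apply_univ, nnrealLebesgue_Iio]
      exact ENNReal.coe_lt_top
  · refine lt_of_le_of_lt (lintegral_mono fun z =>
      (?_ : _ ≤ (c : ℝ≥0∞) * ((z ^ (-(1 / b)) : ℝ≥0) : ℝ≥0∞))) ?_
    · rw [← ENNReal.coe_mul, ← ENNReal.ofReal_coe_nnreal]
      refine ENNReal.ofReal_le_ofReal ?_
      push_cast
      have := Real.add_one_le_exp (-(c * (z : ℝ) ^ (-1 / b)))
      rw [neg_div] at this ⊢
      linarith
    · rw [lintegral_const_mul _ (measurable_coe_rpow _)]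
      exact ENNReal.mul_lt_top ENNReal.coe_lt_top
        (setLIntegral_rpow_lt_top ((one_lt_div hb.1).2 hb.2))

theorem toReal_lintegral_stable (c : ℝ≥0) :
    (∫⁻ z : ℝ≥0, ENNReal.ofReal (1 - Real.exp (-(c * (z : ℝ) ^ (-1 / b))))
      ∂nnrealLebesgue).toReal = ∫ z in Ioi 0, (1 - Real.exp (-c * (z : ℝ) ^ (-1 / b))) := by
  rw [lintegral_nnrealLebesgue (fun z => ENNReal.ofReal (1 - Real.exp (-(c * z ^ (-1 / b))))),
    setLIntegral_congr Ioi_ae_eq_Ici.symm, integral_eq_lintegral_of_nonneg_ae]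
  · simp only [neg_mul]
  · filter_upwards [ae_restrict_mem measurableSet_Ioi] with z hz
    have : 0 ≤ c * z ^ (-1 / b) := mul_nonneg c.2 (Real.rpow_nonneg (le_of_lt hz) _)
    simpa using this
  · exact Measurable.aestronglyMeasurable (by fun_prop)

end

/-! ### The stable path of a Poisson random measure is a stable subordinator -/

section
variable {Ω : Type*} [MeasurableSpace Ω] {P : Measure Ω} [IsProbabilityMeasure P]
  {N : Ω → Measure (ℝ≥0 × ℝ≥0)} {b : ℝ}

theorem IsPoissonRandomMeasure.laplace_stable (hN : IsPoissonRandomMeasure N quadrantLebesgue P)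
    (hb : b ∈ Ioo (0 : ℝ) 1) (c s t : ℝ≥0) :
    ∫ ω, Real.exp (-(c * (∫⁻ p in Ioc s t ×ˢ univ,
      ((p.2 ^ (-1 / b) : ℝ≥0) : ℝ≥0∞) ∂N ω).toReal)) ∂P =
    Real.exp (-((t - s : ℝ≥0) * ∫ z in Ioi 0, (1 - Real.exp (-c * (z : ℝ) ^ (-1 / b))))) := by
  set D : Set (ℝ≥0 × ℝ≥0) := Ioc s t ×ˢ univ with hDdef
  have hD : MeasurableSet D := measurableSet_Ioc.prod MeasurableSet.univ
  have hm := measurable_coe_rpow_snd (-1 / b)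
  set F : ℝ≥0 × ℝ≥0 → ℝ≥0∞ := D.indicator fun p => c * ((p.2 ^ (-1 / b) : ℝ≥0) : ℝ≥0∞) with hF
  have hFm : Measurable F := (hm.const_mul _).indicator hD
  have hFi : ∀ ω, ∫⁻ p, F p ∂N ω =
      c * ∫⁻ p in D, ((p.2 ^ (-1 / b) : ℝ≥0) : ℝ≥0∞) ∂N ω := fun ω => by
    rw [hF, lintegral_indicator hD, lintegral_const_mul _ hm]
  have hG : ∀ p, ENNReal.ofReal (1 - Real.exp (-(F p).toReal)) =
      D.indicator (fun p => ENNReal.ofReal (1 - Real.exp (-(c * (p.2 : ℝ) ^ (-1 / b))))) p := by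
    intro p
    by_cases hp : p ∈ D
    · simp [hF, hp]
    · simp [hF, hp]
  have hGi : ∫⁻ p, ENNReal.ofReal (1 - Real.exp (-(F p).toReal)) ∂quadrantLebesgue =
      (t - s : ℝ≥0) * ∫⁻ z : ℝ≥0, ENNReal.ofReal (1 - Real.exp (-(c * (z : ℝ) ^ (-1 / b))))
        ∂nnrealLebesgue := by
    simp_rw [hG]
    rw [lintegral_indicator hD, hDdef, setLIntegral_quadrantLebesgue s t univ
      (f := fun z : ℝ≥0 => ENNReal.ofReal (1 - Real.exp (-(c * (z : ℝ) ^ (-1 / b))))) (by fun_prop),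
      Measure.restrict_univ]
  have h := hN.laplace hFm (fun p => by
      by_cases hp : p ∈ D
      · simp only [hF, indicator_of_mem hp]; exact ENNReal.mul_ne_top ENNReal.coe_ne_top ENNReal.coe_ne_top
      · simp [hF, hp]) (by
      filter_upwards [hN.ae_forall_lintegral_rpow_lt_top] with ω hω
      rw [hFi]
      refine ENNReal.mul_ne_top ENNReal.coe_ne_top (lt_of_le_of_lt ?_ (hω b hb t)).ne
      exact lintegral_mono_set (Set.prod_mono (Ioc_subset_Ioc_left zero_le) subset_rfl))
    (by rw [hGi]; exact ENNReal.mul_ne_top ENNReal.coe_ne_top (lintegral_stable_ne_top hb c))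
  rw [hGi, ENNReal.toReal_mul, toReal_lintegral_stable] at h
  simp_rw [hFi, ENNReal.toReal_mul, ENNReal.coe_toReal] at h
  exact h

/-- Increments depend on the points in disjoint time strips, hence are independent, and their
Laplace transform is the Poisson one after scaling. The Lévy measure does not involve `α`, so by
uniqueness neither does the law. -/
theorem IsPoissonRandomMeasure.isSubordinatorLaw_stablePath
    (hN : IsPoissonRandomMeasure N quadrantLebesgue P) (hb : b ∈ Ioo (0 : ℝ) 1) (t₀ : ℝ≥0)
    {α : ℝ≥0} (hα : 0 < α) :
    IsSubordinatorLaw (stableLevyMeasure b)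
      (P.map fun ω => CadlagPath.rescale (fun _ => b) α (stablePath b t₀ (N ω))) := by
  have hY := (CadlagPath.measurable_rescale (γ := fun _ => b) measurable_const α).comp
    (measurable_stablePath_comp hN.measurable_measure b t₀)
  set τ : I → ℝ≥0 := fun t => t₀ + α * unitInterval.toNNReal t with hτ
  have hτm : Monotone τ := fun s t hst => by
    simp only [hτ]; gcongr; exact hst
  set J : I → I → Ω → ℝ≥0∞ := fun s t ω =>
    ∫⁻ p in Ioc (τ s) (τ t) ×ˢ univ, ((p.2 ^ (-1 / b) : ℝ≥0) : ℝ≥0∞) ∂N ω with hJ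
  have hαb : 0 < (α : ℝ) ^ (1 / b) :=
    Real.rpow_pos_of_pos (NNReal.coe_pos.2 hα) _
  have hpath : ∀ᵐ ω ∂P, ∀ t : I,
      (CadlagPath.rescale (fun _ => b) α (stablePath b t₀ (N ω))).1 t =
        (stableSum b t₀ (α * unitInterval.toNNReal t) (N ω)).toReal / (α : ℝ) ^ (1 / b) := by
    filter_upwards [hN.ae_forall_lintegral_rpow_lt_top] with ω hω t
    have hS := stableSum_ne_top_of_forall (hω b hb) t₀
    show (((stablePath b t₀ (N ω)).1 (α * unitInterval.toNNReal t) : ℝ) -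
      ((stablePath b t₀ (N ω)).1 0 : ℝ)) / _ = _
    rw [stablePath_apply hS, stablePath_apply hS, stableSum_zero, ENNReal.toNNReal_zero,
      NNReal.coe_zero, sub_zero]
    rfl
  have hinc : ∀ s t : I, s ≤ t → ∀ᵐ ω ∂P,
      (CadlagPath.rescale (fun _ => b) α (stablePath b t₀ (N ω))).1 t -
        (CadlagPath.rescale (fun _ => b) α (stablePath b t₀ (N ω))).1 s =
      (J s t ω).toReal / (α : ℝ) ^ (1 / b) := by
    intro s t hst
    filter_upwards [hpath, hN.ae_forall_lintegral_rpow_lt_top] with ω hω hfin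
    have hS := stableSum_ne_top_of_forall (hfin b hb) t₀
    have hadd : stableSum b t₀ (α * unitInterval.toNNReal t) (N ω) =
        stableSum b t₀ (α * unitInterval.toNNReal s) (N ω) + J s t ω := by
      have h1 : t₀ ≤ τ s := le_self_add
      rw [hJ, stableSum, stableSum, ← lintegral_union (measurableSet_Ioc.prod MeasurableSet.univ),
        ← union_prod, Ioc_union_Ioc_eq_Ioc h1 (hτm hst)]
      exact Set.disjoint_prod.2 (Or.inl (Ioc_disjoint_Ioc_of_le le_rfl))
    have hJt : J s t ω ≠ ∞ := fun h => hS (α * unitInterval.toNNReal t) (by rw [hadd, h, add_top])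
    rw [hω t, hω s, ← sub_div, hadd, ENNReal.toReal_add (hS _) hJt, add_sub_cancel_left]
  refine IsSubordinator.map hY
    { levy_pos := stableLevyMeasure_Iic b
      levy_fin := lintegral_min_stableLevyMeasure_lt_top hb
      zero := ?_
      mono := Eventually.of_forall fun ω s t hst => ?_
      indep := fun n t ht => ?_
      laplace := fun s t hst r hr => ?_ }
  · filter_upwards [hpath] with ω hω
    refine (hω 0).trans ?_
    have : unitInterval.toNNReal 0 = 0 := rfl
    rw [this, mul_zero, stableSum_zero]
    simp
  · show (((stablePath b t₀ (N ω)).1 (α * unitInterval.toNNReal s) : ℝ) -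
      ((stablePath b t₀ (N ω)).1 0 : ℝ)) / (α : ℝ) ^ (1 / b) ≤
      (((stablePath b t₀ (N ω)).1 (α * unitInterval.toNNReal t) : ℝ) -
      ((stablePath b t₀ (N ω)).1 0 : ℝ)) / (α : ℝ) ^ (1 / b)
    gcongr
    exact stablePath_monotone b t₀ (N ω) (by gcongr; exact hst)
  · have hind : iIndep (fun i : Fin n => restrictionSigma N
        (Ioc (τ (t i.castSucc)) (τ (t i.succ)) ×ˢ univ)) P := by
      refine hN.iIndep_restrictionSigma (fun i => measurableSet_Ioc.prod MeasurableSet.univ)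
        fun i j hij => Set.disjoint_prod.2 (Or.inl ?_)
      have hmono : Monotone fun k => τ (t k) := hτm.comp ht
      rcases lt_or_gt_of_ne hij with h | h
      · exact Set.Ioc_disjoint_Ioc_of_le (hmono (Fin.succ_le_castSucc_iff.2 h))
      · exact (Set.Ioc_disjoint_Ioc_of_le (hmono (Fin.succ_le_castSucc_iff.2 h))).symm
    have hfun : iIndepFun (fun (i : Fin n) ω =>
        (J (t i.castSucc) (t i.succ) ω).toReal / (α : ℝ) ^ (1 / b)) P := by
      rw [iIndepFun_iff_iIndep]
      refine iIndep_of_iIndep_of_le hind fun i => measurable_iff_comap_le.1 ?_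
      exact ((measurable_setLIntegral_restrictionSigma
        (measurableSet_Ioc.prod MeasurableSet.univ)
        (measurable_coe_rpow_snd (-1 / b))).ennreal_toReal).div_const _
    exact hfun.congr fun i => (hinc _ _ (ht (Fin.castSucc_le_succ i))).mono fun ω h => h.symm
  · obtain ⟨c, hc⟩ : ∃ c : ℝ≥0, (c : ℝ) = r / (α : ℝ) ^ (1 / b) := ⟨⟨_, by positivity⟩, rfl⟩
    have h1 : ∀ᵐ ω ∂P, Real.exp (-r *
        ((CadlagPath.rescale (fun _ => b) α (stablePath b t₀ (N ω))).1 t -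
        (CadlagPath.rescale (fun _ => b) α (stablePath b t₀ (N ω))).1 s)) =
        Real.exp (-(c * (J s t ω).toReal)) := by
      filter_upwards [hinc s t hst] with ω hω
      rw [hω, hc]
      congr 1; ring
    refine (integral_congr_ae h1).trans ((hN.laplace_stable hb c (τ s) (τ t)).trans ?_)
    rw [← mul_integral_stable hb.1 (NNReal.coe_pos.2 hα) r, ← hc]
    have hτst : ((τ t - τ s : ℝ≥0) : ℝ) = α * ((t : ℝ) - s) := by
      rw [NNReal.coe_sub (hτm hst)]
      simp only [hτ]
      push_cast
      have h2 : ∀ u : I, ((unitInterval.toNNReal u : ℝ≥0) : ℝ) = u := fun _ => rfl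
      rw [h2, h2]; ring
    rw [hτst]
    congr 1
    ring

end

/-! ### Pairs of paths with the same behaviour at zero -/

/-- Pairs `(x, y)` with `sup_{t ≤ 2⁻ⁿ} |(x t - x 0) - (y t - y 0)| = o(2^{-n/γ(x 0)})`. -/
def closePairs (γ : ℝ≥0 → ℝ) : Set (CadlagPath ℝ≥0 ℝ≥0 × CadlagPath ℝ≥0 ℝ≥0) :=
  ⋂ k : ℕ, ⋃ n₀ : ℕ, ⋂ n : ℕ, ⋂ _ : n₀ ≤ n, ⋂ q : ℚ≥0, ⋂ _ : (q : ℝ≥0) ≤ dyadic n,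
    {p | |((p.1 q : ℝ) - p.1 0) - ((p.2 q : ℝ) - p.2 0)| ≤
      1 / ((k : ℝ) + 1) * (dyadic n : ℝ) ^ (1 / γ (p.1 0))}

theorem mem_closePairs {γ : ℝ≥0 → ℝ} {p : CadlagPath ℝ≥0 ℝ≥0 × CadlagPath ℝ≥0 ℝ≥0} :
    p ∈ closePairs γ ↔ ∀ k : ℕ, ∀ᶠ n in atTop, ∀ q : ℚ≥0, (q : ℝ≥0) ≤ dyadic n →
      |((p.1 q : ℝ) - p.1 0) - ((p.2 q : ℝ) - p.2 0)| ≤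
        1 / ((k : ℝ) + 1) * (dyadic n : ℝ) ^ (1 / γ (p.1 0)) := by
  simp only [closePairs, mem_iInter, mem_iUnion, eventually_atTop]
  rfl

theorem measurableSet_closePairs {γ : ℝ≥0 → ℝ} (hγ : Measurable γ) :
    MeasurableSet (closePairs γ) := by
  refine MeasurableSet.iInter fun k => MeasurableSet.iUnion fun n₀ => MeasurableSet.iInter fun n =>
    MeasurableSet.iInter fun _ => MeasurableSet.iInter fun q => MeasurableSet.iInter fun _ => ?_
  have h1 : ∀ t, Measurable fun p : CadlagPath ℝ≥0 ℝ≥0 × CadlagPath ℝ≥0 ℝ≥0 => p.1 t := fun t =>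
    (CadlagPath.measurable_eval t).comp measurable_fst
  have h2 : ∀ t, Measurable fun p : CadlagPath ℝ≥0 ℝ≥0 × CadlagPath ℝ≥0 ℝ≥0 => p.2 t := fun t =>
    (CadlagPath.measurable_eval t).comp measurable_snd
  refine measurableSet_le (continuous_abs.measurable.comp
    (((h1 _).coe_nnreal_real.sub (h1 _).coe_nnreal_real).sub
    ((h2 _).coe_nnreal_real.sub (h2 _).coe_nnreal_real))) ?_
  exact (measurable_const.pow (measurable_const.div (hγ.comp (h1 0)))).const_mul _

/-- Right-continuity along rationals decreasing to `t`; these must stay below `d`, hence the strict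
inequality `t < d`. -/
theorem abs_sub_le_of_nnrat {x y : CadlagPath ℝ≥0 ℝ≥0} {d : ℝ≥0} {C : ℝ}
    (h : ∀ q : ℚ≥0, (q : ℝ≥0) ≤ d → |((x q : ℝ) - x 0) - ((y q : ℝ) - y 0)| ≤ C) {t : ℝ≥0}
    (ht : t < d) : |((x t : ℝ) - x 0) - ((y t : ℝ) - y 0)| ≤ C := by
  have := nhdsGT_inf_range_nnrat_neBot t
  have hx := (NNReal.tendsto_coe.2 (x.2.tendsto_nnrat t)).sub_const ((x.1 0 : ℝ≥0) : ℝ)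
  have hy := (NNReal.tendsto_coe.2 (y.2.tendsto_nnrat t)).sub_const ((y.1 0 : ℝ≥0) : ℝ)
  refine le_of_tendsto (hx.sub hy).abs ?_
  have h1 : ∀ᶠ s in 𝓝[>] t ⊓ 𝓟 (range fun q : ℚ≥0 => (q : ℝ≥0)), s < d :=
    mem_inf_of_left (mem_nhdsWithin_of_mem_nhds (Iio_mem_nhds ht))
  have h2 : ∀ᶠ s in 𝓝[>] t ⊓ 𝓟 (range fun q : ℚ≥0 => (q : ℝ≥0)),
      s ∈ range fun q : ℚ≥0 => (q : ℝ≥0) := mem_inf_of_right (mem_principal_self _)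
  filter_upwards [h1, h2] with s hs hq
  obtain ⟨q, rfl⟩ := hq
  exact h q hs.le

theorem dyadic_eq_pow (n : ℕ) : dyadic n = (1 / 2) ^ n := by
  rw [dyadic, NNReal.rpow_neg, NNReal.rpow_natCast, one_div, inv_pow]

theorem tendsto_supEdist_of_mem_closePairs {γ : ℝ≥0 → ℝ} {x y : CadlagPath ℝ≥0 ℝ≥0}
    (h : (x, y) ∈ closePairs γ) (hγ : 0 < γ (x 0)) :
    Tendsto (fun α : ℝ≥0 => supEdist (CadlagPath.rescale γ α x)
      (CadlagPath.rescale (fun _ => γ (x 0)) α y)) (𝓝[>] 0) (𝓝 0) := by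
  set β := γ (x 0) with hβ
  -- Each small `α` is compared with the dyadic `2⁻ᵐ` for which `2⁻ᵐ / 4 < α ≤ 2⁻ᵐ / 2`. One level
  -- is skipped to get `α < 2⁻ᵐ` strictly, and the price in the error is the factor `4 ^ (1/β)`.
  set c : ℝ := 4 ^ (1 / β) with hc
  have hc0 : 0 < c := Real.rpow_pos_of_pos (by norm_num) _
  rw [ENNReal.tendsto_nhds_zero]
  intro ε hε
  obtain ⟨δ, hδ, hδε⟩ : ∃ δ : ℝ, 0 < δ ∧ ENNReal.ofReal δ ≤ ε := by
    rcases eq_or_ne ε ∞ with rfl | hε'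
    · exact ⟨1, one_pos, le_top⟩
    · exact ⟨ε.toReal, ENNReal.toReal_pos hε.ne' hε', by rw [ENNReal.ofReal_toReal hε']⟩
  obtain ⟨k, hk⟩ := exists_nat_gt (c / δ)
  have hkc : 1 / ((k : ℝ) + 1) * c ≤ δ := by
    rw [one_div_mul_eq_div, div_le_iff₀ (by positivity)]
    rw [div_lt_iff₀ hδ] at hk
    nlinarith
  obtain ⟨n₀, hn₀⟩ := eventually_atTop.1 (mem_closePairs.1 h k)
  have hpos : 0 < dyadic (n₀ + 1) := dyadic_pos _
  filter_upwards [self_mem_nhdsWithin, mem_nhdsWithin_of_mem_nhds (Iio_mem_nhds hpos)] with α hα hα2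
  have hα : 0 < α := hα
  have hα2 : α < dyadic (n₀ + 1) := hα2
  have hhalf : (1 / 2 : ℝ≥0) < 1 := by
    rw [← NNReal.coe_lt_coe]; norm_num
  have hα1 : α ≤ 1 := hα2.le.trans (by rw [dyadic_eq_pow]; exact pow_le_one₀ zero_le hhalf.le)
  obtain ⟨n, hn1, hn2⟩ := exists_nat_pow_near_of_lt_one hα hα1 (by positivity) hhalf
  have hn : n₀ + 1 < n + 1 := by
    rw [dyadic_eq_pow] at hα2
    exact (pow_lt_pow_iff_right_of_lt_one₀ (by positivity) hhalf).1 (hn1.trans hα2)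
  obtain ⟨m, rfl⟩ : ∃ m, n = m + 1 := ⟨n - 1, by omega⟩
  have hm : n₀ ≤ m := by omega
  have hαm : α < dyadic m := by
    rw [dyadic_eq_pow]
    exact hn2.trans_lt (pow_lt_pow_right_of_lt_one₀ (by positivity) hhalf (Nat.lt_succ_self m))
  have hm4 : (dyadic m : ℝ) ≤ 4 * α := by
    rw [← NNReal.coe_lt_coe] at hn1
    rw [dyadic_eq_pow]
    push_cast at hn1 ⊢
    rw [pow_succ, pow_succ] at hn1
    linarith
  have hαβ : 0 < (α : ℝ) ^ (1 / β) := Real.rpow_pos_of_pos (NNReal.coe_pos.2 hα) _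
  refine iSup_le fun t => le_trans ?_ hδε
  have ht : α * unitInterval.toNNReal t < dyadic m := by
    refine lt_of_le_of_lt (mul_le_of_le_one_right zero_le ?_) hαm
    exact t.2.2
  have hb := abs_sub_le_of_nnrat (hn₀ m hm) ht
  rw [edist_dist, Real.dist_eq]
  refine ENNReal.ofReal_le_ofReal ?_
  show |((x.1 (α * unitInterval.toNNReal t) : ℝ) - x.1 0) / (α : ℝ) ^ (1 / β) -
    ((y.1 (α * unitInterval.toNNReal t) : ℝ) - y.1 0) / (α : ℝ) ^ (1 / β)| ≤ δ
  rw [← sub_div, abs_div, abs_of_pos hαβ, div_le_iff₀ hαβ]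
  refine hb.trans ?_
  calc 1 / ((k : ℝ) + 1) * (dyadic m : ℝ) ^ (1 / β)
      ≤ 1 / ((k : ℝ) + 1) * (4 * α : ℝ) ^ (1 / β) := by gcongr
    _ = 1 / ((k : ℝ) + 1) * c * (α : ℝ) ^ (1 / β) := by
      rw [Real.mul_rpow (by norm_num) α.coe_nonneg, mul_assoc]
    _ ≤ δ * (α : ℝ) ^ (1 / β) := by gcongr

theorem IsJumpSolution.ae_monotone {Ω : Type*} [MeasurableSpace Ω] {P : Measure Ω} {γ : ℝ≥0 → ℝ}
    {N : Ω → Measure (ℝ≥0 × ℝ≥0)} {M : Ω → CadlagPath ℝ≥0 ℝ≥0} (hM : IsJumpSolution γ N P M) :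
    ∀ᵐ ω ∂P, Monotone (M ω).1 := by
  filter_upwards [hM.eq] with ω hω using monotone_of_jump_eq hω

theorem IsJumpSolution.ae_mem_closePairs {Ω : Type*} [MeasurableSpace Ω] {P : Measure Ω}
    [IsProbabilityMeasure P] {γ : ℝ≥0 → ℝ} {ε : ℝ} (hε : 0 < ε) (hγ : ∀ y, γ y ∈ Icc ε (1 - ε))
    {K : ℝ≥0} (hK : LipschitzWith K γ) (hmono : StrictMono γ)
    {N : Ω → Measure (ℝ≥0 × ℝ≥0)} (hN : IsPoissonRandomMeasure N quadrantLebesgue P)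
    {M : Ω → CadlagPath ℝ≥0 ℝ≥0} (hM : IsJumpSolution γ N P M) (t₀ : ℝ≥0) :
    ∀ᵐ ω ∂P, ((M ω).shift t₀, stablePath (γ (M ω t₀)) t₀ (N ω)) ∈ closePairs γ := by
  -- Rational `r` and `q` give a single null set, so that the estimate can be used with exponents
  -- chosen after `ω`.
  have hev : ∀ᵐ ω ∂P, ∀ r q : ℚ, 1 < (r : ℝ) → (q : ℝ) < r → ∀ᶠ n in atTop,
      N ω (Ioc t₀ (t₀ + dyadic n) ×ˢ Iio 1) = 0 ∧
      ∫⁻ p in Ioc t₀ (t₀ + dyadic n) ×ˢ Ici 1, ((p.2 ^ (-(r : ℝ)) : ℝ≥0) : ℝ≥0∞) ∂N ω ≤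
        ((dyadic n ^ (q : ℝ) : ℝ≥0) : ℝ≥0∞) := by
    refine ae_all_iff.2 fun r => ae_all_iff.2 fun q => ?_
    by_cases hr : 1 < (r : ℝ)
    · by_cases hq : (q : ℝ) < r
      · filter_upwards [hN.ae_eventually_lintegral_rpow_le t₀ hr hq] with ω hω _ _ using hω
      · exact Eventually.of_forall fun ω _ h => absurd h hq
    · exact Eventually.of_forall fun ω h => absurd h hr
  filter_upwards [hM.eq, hN.ae_forall_lintegral_rpow_lt_top, hev] with ω hω hfin hm
  set β := γ ((M ω).1 t₀) with hβ
  have hβ1 : β ∈ Ioo (0 : ℝ) 1 := ⟨hε.trans_le (hγ _).1, (hγ _).2.trans_lt (by linarith)⟩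
  have hS := stableSum_ne_top_of_forall (hfin β hβ1) t₀
  have hs : ∀ q : ℝ≥0, ((M ω).shift t₀).1 q = (M ω).1 (t₀ + q) := fun _ => rfl
  have hs0 : ((M ω).shift t₀).1 0 = (M ω).1 t₀ := by rw [hs, add_zero]
  refine mem_closePairs.2 fun k => ?_
  have := eventually_abs_sub_stable_le hε hγ hK hmono t₀ hω (hfin β hβ1) hm
    (δ := 1 / ((k : ℝ) + 1)) (by positivity)
  filter_upwards [this] with n hn q hq
  have h1 := hn q hq
  simp only [hs0]
  rw [hs, stablePath_apply hS, stablePath_apply hS, stableSum_zero, ENNReal.toNNReal_zero,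
    NNReal.coe_zero, sub_zero]
  exact h1

/-! ### Conditional laws -/

theorem map_prodMk_eq_compProd_iff {Ω B E : Type*} [MeasurableSpace Ω] [MeasurableSpace B]
    [MeasurableSpace E] {P : Measure Ω} [IsProbabilityMeasure P] {H : Ω → B} (hH : Measurable H)
    {Y : Ω → E} (hY : Measurable Y) {κ : Kernel B E} [IsMarkovKernel κ] :
    P.map (fun ω => (H ω, Y ω)) = P.map H ⊗ₘ κ ↔
      ∀ A, MeasurableSet A → ∀ C, MeasurableSet C →
        P (H ⁻¹' A ∩ Y ⁻¹' C) = ∫⁻ ω in H ⁻¹' A, κ (H ω) C ∂P := by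
  have h1 : ∀ A, MeasurableSet A → ∀ C, MeasurableSet C →
      P.map (fun ω => (H ω, Y ω)) (A ×ˢ C) = P (H ⁻¹' A ∩ Y ⁻¹' C) := fun A hA C hC => by
    rw [Measure.map_apply (hH.prodMk hY) (hA.prod hC)]; rfl
  have h2 : ∀ A, MeasurableSet A → ∀ C, MeasurableSet C →
      (P.map H ⊗ₘ κ) (A ×ˢ C) = ∫⁻ ω in H ⁻¹' A, κ (H ω) C ∂P := fun A hA C hC => by
    rw [Measure.compProd_apply_prod hA hC, setLIntegral_map hA (κ.measurable_coe hC) hH]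
  constructor
  · intro h A hA C hC
    rw [← h1 A hA C hC, h, h2 A hA C hC]
  · intro h
    have := Measure.isProbabilityMeasure_map (μ := P) (hH.prodMk hY).aemeasurable
    refine Measure.ext_prod fun {A} {C} hA hC => ?_
    rw [h1 A hA C hC, h A hA C hC, h2 A hA C hC]

/-- A random path that is almost surely monotone has a regular conditional law. -/
theorem exists_condLaw_of_monotone {Ω B : Type*} [MeasurableSpace Ω] [MeasurableSpace B]
    {P : Measure Ω} [IsProbabilityMeasure P] {H : Ω → B} (hH : Measurable H)
    {X : Ω → CadlagPath ℝ≥0 ℝ≥0} (hX : Measurable X) (hXm : ∀ᵐ ω ∂P, Monotone (X ω).1) :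
    ∃ κ : Kernel B (CadlagPath ℝ≥0 ℝ≥0), IsMarkovKernel κ ∧
      P.map (fun ω => (H ω, X ω)) = P.map H ⊗ₘ κ := by
  have hZ : Measurable fun ω => (X ω).toRat := CadlagPath.measurable_toRat.comp hX
  have := Measure.isProbabilityMeasure_map (μ := P) hH.aemeasurable
  refine ⟨(condDistrib (fun ω => (X ω).toRat) H P).map CadlagPath.ofRat,
    Kernel.IsMarkovKernel.map _ CadlagPath.measurable_ofRat, ?_⟩
  rw [Measure.compProd_map CadlagPath.measurable_ofRat, compProd_map_condDistrib hZ.aemeasurable,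
    Measure.map_map (measurable_id.prodMap CadlagPath.measurable_ofRat) (hH.prodMk hZ)]
  refine Measure.map_congr ?_
  filter_upwards [hXm] with ω hω
  simp only [Function.comp_apply, Prod.map_apply, id, CadlagPath.ofRat_toRat hω]

/-! ### Conditional convergence in law -/

/-- `H` stands for the past, `V` for the independent future, and `Φ (b (H), V)` for the stable path
with exponent read off from the past. Given `H = h`, the exponent is the constant `b h` while `V`
keeps its law, so the rescaled stable path has a law free of `α`. The coupling lemma is then applied
under the conditional joint law of `X` and the stable path. -/
theorem ae_tendstoInLaw_rescale {Ω B W : Type*} [MeasurableSpace Ω] [MeasurableSpace B]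
    [MeasurableSpace W] {P : Measure Ω} [IsProbabilityMeasure P] {H : Ω → B} (hH : Measurable H)
    {V : Ω → W} (hV : Measurable V)
    (hind : P.map (fun ω => (H ω, V ω)) = (P.map H).prod (P.map V))
    {Φ : ℝ × W → CadlagPath ℝ≥0 ℝ≥0} (hΦ : Measurable Φ) (hΦm : ∀ p, Monotone (Φ p).1)
    (hlaw : ∀ β ∈ Ioo (0 : ℝ) 1, ∀ α : ℝ≥0, 0 < α → IsSubordinatorLaw (stableLevyMeasure β)
      (P.map fun ω => CadlagPath.rescale (fun _ => β) α (Φ (β, V ω))))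
    {b : B → ℝ} (hb : Measurable b) (hb1 : ∀ h, b h ∈ Ioo (0 : ℝ) 1)
    {γ : ℝ≥0 → ℝ} (hγ : Measurable γ)
    {X : Ω → CadlagPath ℝ≥0 ℝ≥0} (hX : Measurable X) (hXm : ∀ᵐ ω ∂P, Monotone (X ω).1)
    (hX0 : ∀ᵐ ω ∂P, γ ((X ω).1 0) = b (H ω))
    (hclose : ∀ᵐ ω ∂P, (X ω, Φ (b (H ω), V ω)) ∈ closePairs γ)
    {κ : Kernel B (CadlagPath ℝ≥0 ℝ≥0)} [IsMarkovKernel κ]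
    (hκ : P.map (fun ω => (H ω, X ω)) = P.map H ⊗ₘ κ) :
    ∀ᵐ h ∂P.map H, ∃ μ : Measure (CadlagPath I ℝ), IsSubordinatorLaw (stableLevyMeasure (b h)) μ ∧
      TendstoInLaw (fun α : ℝ≥0 => (κ h).map (CadlagPath.rescale γ α)) (𝓝[>] 0) μ := by
  have := Measure.isProbabilityMeasure_map (μ := P) hH.aemeasurable
  have := Measure.isProbabilityMeasure_map (μ := P) hV.aemeasurable
  set Y : Ω → CadlagPath ℝ≥0 ℝ≥0 := fun ω => Φ (b (H ω), V ω) with hYdef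
  have hY : Measurable Y := hΦ.comp ((hb.comp hH).prodMk hV)
  set Z : Ω → (ℚ≥0 → ℝ≥0) × (ℚ≥0 → ℝ≥0) := fun ω => ((X ω).toRat, (Y ω).toRat)
  have hZ : Measurable Z := (CadlagPath.measurable_toRat.comp hX).prodMk
    (CadlagPath.measurable_toRat.comp hY)
  set ρ : (ℚ≥0 → ℝ≥0) × (ℚ≥0 → ℝ≥0) → CadlagPath ℝ≥0 ℝ≥0 × CadlagPath ℝ≥0 ℝ≥0 :=
    Prod.map CadlagPath.ofRat CadlagPath.ofRat
  have hρ : Measurable ρ := CadlagPath.measurable_ofRat.prodMap CadlagPath.measurable_ofRat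
  set θ := condDistrib Z H P
  have hθ : P.map H ⊗ₘ θ = P.map fun ω => (H ω, Z ω) := compProd_map_condDistrib hZ.aemeasurable
  have hρZ : ∀ᵐ ω ∂P, ρ (Z ω) = (X ω, Y ω) := by
    filter_upwards [hXm] with ω hω
    exact Prod.ext (CadlagPath.ofRat_toRat hω) (CadlagPath.ofRat_toRat (hΦm _))
  have hθρ : P.map H ⊗ₘ θ.map ρ = P.map fun ω => (H ω, (X ω, Y ω)) := by
    rw [Measure.compProd_map hρ, hθ, Measure.map_map (by fun_prop) (by fun_prop)]
    refine Measure.map_congr ?_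
    filter_upwards [hρZ] with ω hω
    simp only [Function.comp_apply, Prod.map_apply, id, hω]
  -- Any version `κ` is almost everywhere the first marginal of the joint conditional law, so
  -- proving the limit for that marginal settles all versions.
  have hfst : (κ : B → Measure _) =ᵐ[P.map H] (θ.map ρ).map Prod.fst := by
    have := Kernel.IsMarkovKernel.map θ hρ
    have := Kernel.IsMarkovKernel.map (θ.map ρ) (measurable_fst (α := CadlagPath ℝ≥0 ℝ≥0)
      (β := CadlagPath ℝ≥0 ℝ≥0))
    refine Kernel.ae_eq_of_compProd_eq ?_
    rw [Measure.compProd_map measurable_fst, hθρ, Measure.map_map (by fun_prop) (by fun_prop), ← hκ]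
    rfl
  set L : Kernel B (CadlagPath ℝ≥0 ℝ≥0) :=
    (Kernel.prod Kernel.id (Kernel.const B (P.map V))).map fun p : B × W => Φ (b p.1, p.2)
  have hΨ : Measurable fun p : B × W => Φ (b p.1, p.2) := by fun_prop
  have hL : ∀ h, L h = P.map fun ω => Φ (b h, V ω) := fun h => by
    have hm : Measurable fun w => Φ (b h, w) := by fun_prop
    rw [Kernel.map_apply _ hΨ, Kernel.prod_apply, Kernel.id_apply, Kernel.const_apply,
      Measure.dirac_prod, Measure.map_map hΨ (by fun_prop), Measure.map_map (by fun_prop) hV]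
    rfl
  -- Independence of `H` and `V` allows the second marginal to be computed by freezing `h` and
  -- integrating over `V` alone.
  have hsnd : (L : B → Measure _) =ᵐ[P.map H] (θ.map ρ).map Prod.snd := by
    have := Kernel.IsMarkovKernel.map θ hρ
    have := Kernel.IsMarkovKernel.map (θ.map ρ) (measurable_snd (α := CadlagPath ℝ≥0 ℝ≥0)
      (β := CadlagPath ℝ≥0 ℝ≥0))
    have : IsMarkovKernel L := Kernel.IsMarkovKernel.map _ hΨ
    refine Kernel.ae_eq_of_compProd_eq ?_
    rw [Measure.compProd_map measurable_snd, hθρ, Measure.map_map (by fun_prop) (by fun_prop)]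
    ext s hs
    have hΨ' : Measurable fun p : B × W => (p.1, Φ (b p.1, p.2)) := measurable_fst.prodMk hΨ
    have h1 : (Prod.map id Prod.snd ∘ fun ω => (H ω, (X ω, Y ω))) =
        (fun p : B × W => (p.1, Φ (b p.1, p.2))) ∘ fun ω => (H ω, V ω) := rfl
    rw [h1, ← Measure.map_map hΨ' (hH.prodMk hV), hind, Measure.map_apply hΨ' hs,
      Measure.prod_apply (hΨ' hs), Measure.compProd_apply hs]
    refine lintegral_congr fun h => ?_
    rw [hL, Measure.map_apply (by fun_prop) (measurable_prodMk_left hs),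
      Measure.map_apply hV (measurable_prodMk_left (hΨ' hs))]
    rfl
  have hgood : ∀ᵐ h ∂P.map H, ∀ᵐ p ∂(θ.map ρ) h, p ∈ closePairs γ ∧ γ (p.1.1 0) = b h := by
    have := Kernel.IsMarkovKernel.map θ hρ
    have hms : MeasurableSet {q : B × (CadlagPath ℝ≥0 ℝ≥0 × CadlagPath ℝ≥0 ℝ≥0) |
        q.2 ∈ closePairs γ ∧ γ (q.2.1.1 0) = b q.1} :=
      (measurable_snd (measurableSet_closePairs hγ)).inter (measurableSet_eq_fun
        (hγ.comp ((CadlagPath.measurable_eval 0).comp measurable_snd.fst)) (hb.comp measurable_fst))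
    refine Measure.ae_ae_of_ae_compProd (p := fun q : B × (CadlagPath ℝ≥0 ℝ≥0 × CadlagPath ℝ≥0 ℝ≥0) =>
      q.2 ∈ closePairs γ ∧ γ (q.2.1.1 0) = b q.1) ?_
    rw [hθρ, ae_map_iff (by fun_prop) hms]
    filter_upwards [hclose, hX0] with ω h1 h2 using ⟨h1, h2⟩
  filter_upwards [hfst, hsnd, hgood] with h h1 h2 h3
  rw [Kernel.map_apply _ hρ] at h3
  rw [Kernel.map_apply _ measurable_fst, Kernel.map_apply _ hρ, Measure.map_map measurable_fst hρ]
    at h1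
  rw [Kernel.map_apply _ measurable_snd, Kernel.map_apply _ hρ, Measure.map_map measurable_snd hρ,
    hL] at h2
  have hr := fun α => CadlagPath.measurable_rescale hγ α
  have hr' := fun α => CadlagPath.measurable_rescale (γ := fun _ => b h) measurable_const α
  have hVh : Measurable fun ω => Φ (b h, V ω) := by fun_prop
  -- The law at `α = 1` represents the common law of all rescalings.
  refine ⟨_, hlaw (b h) (hb1 h) 1 one_pos, ?_⟩
  have key := tendstoInLaw_of_coupling (Q := θ h) (l := 𝓝[>] (0 : ℝ≥0))
    (Z := Prod.fst) measurable_fst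
    (g := fun α a => CadlagPath.rescale γ α (CadlagPath.ofRat a))
    (fun α => (hr α).comp CadlagPath.measurable_ofRat)
    (Y := fun α p => CadlagPath.rescale (fun _ => b h) α (CadlagPath.ofRat p.2))
    (fun α => (hr' α).comp (CadlagPath.measurable_ofRat.comp measurable_snd))
    (μ := P.map fun ω => CadlagPath.rescale (fun _ => b h) 1 (Φ (b h, V ω))) ?_ ?_
  · convert key using 2 with α
    rw [h1, Measure.map_map (hr α) (measurable_fst.comp hρ)]
    rfl
  · filter_upwards [self_mem_nhdsWithin] with α hα
    have h4 : (θ h).map (fun p => CadlagPath.rescale (fun _ => b h) α (CadlagPath.ofRat p.2)) =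
        P.map fun ω => CadlagPath.rescale (fun _ => b h) α (Φ (b h, V ω)) := by
      have h5 := congrArg (Measure.map (CadlagPath.rescale (fun _ => b h) α)) h2
      rw [Measure.map_map (hr' α) hVh, Measure.map_map (hr' α) (measurable_snd.comp hρ)] at h5
      exact h5.symm
    rw [h4]
    exact (hlaw _ (hb1 h) α hα).unique (hlaw _ (hb1 h) 1 one_pos)
  · filter_upwards [ae_of_ae_map hρ.aemeasurable h3] with p hp
    have hp2 : γ ((CadlagPath.ofRat p.1).1 0) = b h := hp.2
    have := tendsto_supEdist_of_mem_closePairs (x := CadlagPath.ofRat p.1)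
      (y := CadlagPath.ofRat p.2) hp.1 ((hb1 h).1.trans_eq hp2.symm)
    rwa [hp2] at this

/-! ### The main theorem -/

/-- Conditioning on `F` is conditioning on the identity map into `Ω` equipped with `F`. Two
σ-algebras on `Ω` are in play, so instances are given explicitly. -/
theorem isRegularCondLaw_iff {Ω E : Type*} [mΩ : MeasurableSpace Ω] [MeasurableSpace E]
    {P : Measure Ω} [IsProbabilityMeasure P] {F : MeasurableSpace Ω} (hF : F ≤ mΩ) {Y : Ω → E}
    (hY : @Measurable Ω E mΩ _ Y) {κ : @Kernel Ω E F _} :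
    IsRegularCondLaw P F Y κ ↔ @IsMarkovKernel Ω E F _ κ ∧
      @Measure.map Ω (Ω × E) mΩ (@Prod.instMeasurableSpace Ω E F _) (fun ω => (ω, Y ω)) P =
        @Measure.compProd Ω E F _ (@Measure.map Ω Ω mΩ F id P) κ := by
  have hid : @Measurable Ω Ω mΩ F id := measurable_id'' hF
  constructor
  · rintro ⟨h1, h2⟩
    have hκ : @IsMarkovKernel Ω E F _ κ := @IsMarkovKernel.mk Ω E F _ κ h1
    exact ⟨hκ, (@map_prodMk_eq_compProd_iff Ω Ω E mΩ F _ P _ id hid Y hY κ hκ).2 h2⟩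
  · rintro ⟨hκ, h⟩
    exact ⟨@IsMarkovKernel.isProbabilityMeasure Ω E F _ κ hκ,
      (@map_prodMk_eq_compProd_iff Ω Ω E mΩ F _ P _ id hid Y hY κ hκ).1 h⟩

/-- Independence of the points in `D` and in `E`, with the two σ-algebras placed on the two copies
of `Ω`; this is the product form needed for past and future. -/
theorem IsPoissonRandomMeasure.map_prodMk_id_eq_prod {Ω S : Type*} [mΩ : MeasurableSpace Ω]
    [MeasurableSpace S] {P : Measure Ω} [IsProbabilityMeasure P] {N : Ω → Measure S} {Λ : Measure S}
    (hN : IsPoissonRandomMeasure N Λ P) {D E : Set S} (hD : MeasurableSet D) (hE : MeasurableSet E)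
    (hDE : Disjoint D E) :
    @Measure.map Ω (Ω × Ω) mΩ
      (@Prod.instMeasurableSpace Ω Ω (restrictionSigma N D) (restrictionSigma N E))
      (fun ω => (ω, ω)) P =
    @Measure.prod Ω Ω (restrictionSigma N D) (restrictionSigma N E)
      (@Measure.map Ω Ω mΩ (restrictionSigma N D) id P)
      (@Measure.map Ω Ω mΩ (restrictionSigma N E) id P) := by
  have hi : iIndep (fun i : Bool => restrictionSigma N (if i then D else E)) P := by
    refine hN.iIndep_restrictionSigma (fun i => by cases i <;> simpa) fun i j hij => ?_
    cases i <;> cases j <;> simp_all [hDE.symm]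
  have h2 : Indep (restrictionSigma N D) (restrictionSigma N E) P :=
    hi.indep (i := true) (j := false) (by simp)
  have h3 : @IndepFun Ω Ω Ω mΩ (restrictionSigma N D) (restrictionSigma N E) id id P := by
    refine (@IndepFun_iff_Indep Ω Ω Ω mΩ (restrictionSigma N D) (restrictionSigma N E) id id P).2 ?_
    rw [MeasurableSpace.comap_id, MeasurableSpace.comap_id]
    exact h2
  exact (@indepFun_iff_map_prod_eq_prod_map_map Ω Ω Ω mΩ P id id (restrictionSigma N D)
    (restrictionSigma N E) _
    (@Measurable.aemeasurable _ _ mΩ (restrictionSigma N D) _ _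
      (measurable_id'' (restrictionSigma_le hN.measurable D)))
    (@Measurable.aemeasurable _ _ mΩ (restrictionSigma N E) _ _
      (measurable_id'' (restrictionSigma_le hN.measurable E)))).1 h3

theorem mainTheorem5 {Ω : Type*} [mΩ : MeasurableSpace Ω] (P : Measure Ω) [IsProbabilityMeasure P]
    (γ : ℝ≥0 → ℝ) (hγ_bdd : ∃ ε : ℝ, 0 < ε ∧ ∀ y, γ y ∈ Set.Icc ε (1 - ε))
    (hγ_lip : ∃ K : ℝ≥0, LipschitzWith K γ) (hγ_mono : StrictMono γ)
    (N : Ω → Measure (ℝ≥0 × ℝ≥0))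
    (hN : IsPoissonRandomMeasure N (nnrealLebesgue.prod nnrealLebesgue) P)
    (M : Ω → CadlagPath ℝ≥0 ℝ≥0) (hM : IsJumpSolution γ N P M) (t₀ : ℝ≥0) :
    (∃ κ : @Kernel Ω (CadlagPath ℝ≥0 ℝ≥0) (poissonFiltration N t₀) _,
      IsRegularCondLaw P (poissonFiltration N t₀) (fun ω => (M ω).shift t₀) κ) ∧
    ∀ κ : @Kernel Ω (CadlagPath ℝ≥0 ℝ≥0) (poissonFiltration N t₀) _,
      IsRegularCondLaw P (poissonFiltration N t₀) (fun ω => (M ω).shift t₀) κ →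
      ∀ᵐ ω ∂P, ∃ μ : Measure (CadlagPath I ℝ),
        IsSubordinatorLaw (stableLevyMeasure (γ (M ω t₀))) μ ∧
        TendstoInLaw (fun α : ℝ≥0 => (κ ω).map (CadlagPath.rescale γ α)) (𝓝[>] 0) μ := by
  obtain ⟨ε, hε, hγ⟩ := hγ_bdd
  obtain ⟨K, hK⟩ := hγ_lip
  have hγm : Measurable γ := hK.continuous.measurable
  have hγ1 : ∀ y, γ y ∈ Ioo (0 : ℝ) 1 := fun y =>
    ⟨hε.trans_le (hγ y).1, (hγ y).2.trans_lt (by linarith)⟩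
  -- `poissonFiltration N t₀` unfolds to the restriction σ-algebra of the strip up to time `t₀`.
  have hF := restrictionSigma_le hN.measurable (Iic t₀ ×ˢ (univ : Set ℝ≥0))
  have hG := restrictionSigma_le hN.measurable (Ioi t₀ ×ˢ (univ : Set ℝ≥0))
  have hX : Measurable fun ω => (M ω).shift t₀ :=
    (CadlagPath.measurable_shift t₀).comp hM.measurable
  have hXm : ∀ᵐ ω ∂P, Monotone ((M ω).shift t₀).1 := by
    filter_upwards [hM.ae_monotone] with ω hω s t hst
    exact hω (by gcongr)
  have hidF : @Measurable Ω Ω mΩ (poissonFiltration N t₀) id := measurable_id'' hF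
  have hidG : @Measurable Ω Ω mΩ (restrictionSigma N (Ioi t₀ ×ˢ univ)) id := measurable_id'' hG
  refine ⟨?_, fun κ hκ => ?_⟩
  · obtain ⟨κ, h1, h2⟩ := @exists_condLaw_of_monotone Ω Ω mΩ (poissonFiltration N t₀) P _ id hidF
      _ hX hXm
    exact ⟨κ, (isRegularCondLaw_iff hF hX).2 ⟨h1, h2⟩⟩
  · obtain ⟨hκ1, hκ2⟩ := (isRegularCondLaw_iff hF hX).1 hκ
    obtain ⟨η, hη, hηN⟩ := hN.exists_kernel (measurableSet_Ioi.prod MeasurableSet.univ :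
      MeasurableSet (Ioi t₀ ×ˢ (univ : Set ℝ≥0)))
    -- `M t₀` is adapted only up to null sets; the exponent must be a genuinely measurable function
    -- of the past.
    set m₀ := (hM.adapted t₀).mk
    have hm₀ : Measurable[poissonFiltration N t₀] m₀ :=
      (hM.adapted t₀).stronglyMeasurable_mk.measurable
    have hMm₀ : (fun ω => M ω t₀) =ᵐ[P] m₀ := (hM.adapted t₀).ae_eq_mk
    have hstable : ∀ᵐ ω ∂P, ∀ β, stablePath β t₀ (η ω) = stablePath β t₀ (N ω) := by
      filter_upwards [hηN] with ω hω β
      rw [hω, stablePath_restrict]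
    -- Past and future are both the identity of `Ω`, under the σ-algebras of the points up to and
    -- after `t₀`. The version `η` replaces `N` because it is a kernel for the latter.
    have key := @ae_tendstoInLaw_rescale Ω Ω Ω mΩ (poissonFiltration N t₀)
      (restrictionSigma N (Ioi t₀ ×ˢ univ)) P _ id hidF id hidG
      (hN.map_prodMk_id_eq_prod (measurableSet_Iic.prod MeasurableSet.univ)
        (measurableSet_Ioi.prod MeasurableSet.univ)
        (Set.disjoint_prod.2 (Or.inl (Iic_disjoint_Ioi le_rfl))))
      (fun p => stablePath p.1 t₀ (η p.2))
      (@measurable_stablePath Ω (restrictionSigma N (Ioi t₀ ×ˢ univ)) η hη t₀)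
      (fun p => stablePath_monotone _ _ _) (fun β hβ α hα => ?_)
      (fun ω => γ (m₀ ω)) (hγm.comp hm₀) (fun ω => hγ1 _) γ hγm _ hX hXm ?_ ?_ κ hκ1 hκ2
    · filter_upwards [@ae_of_ae_map Ω Ω mΩ (poissonFiltration N t₀) P id
        (@Measurable.aemeasurable Ω Ω mΩ (poissonFiltration N t₀) id P hidF) _ key,
        hMm₀] with ω h1 h2
      rw [show (M ω).1 t₀ = m₀ ω from h2]
      exact h1
    · have := hN.isSubordinatorLaw_stablePath hβ t₀ hα
      rwa [Measure.map_congr (g := fun ω => CadlagPath.rescale (fun _ => β) α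
        (stablePath β t₀ (η ω)))] at this
      filter_upwards [hstable] with ω hω
      rw [hω]
    · filter_upwards [hMm₀] with ω hω
      have h0 : ((M ω).shift t₀).1 0 = m₀ ω := Eq.trans (congrArg (M ω).1 (add_zero t₀)) hω
      exact congrArg γ h0
    · filter_upwards [hMm₀, hstable, hM.ae_mem_closePairs hε hγ hK hγ_mono hN t₀] with ω h1 h2 h3
      have h4 : (M ω).1 t₀ = m₀ ω := h1
      simp only [id]
      rw [h2, ← h4]
      exact h3
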